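/- **Setting.** Graphs are finite, simple and undirected. For a vertex set $S$ let $N(S)=\bigl(\bigcup_{v\in S}N(v)\bigr)\setminus S$. The *surplus* of an independent set $I$ is $|N(I)|-|I|$. A *critical set* is a non-empty independent set $I$ such that every non-empty $J\subseteq I$ has surplus at least that of $I$. A *funnel* is a vertex $u$ with a neighbor $x$ such that $N(u)\setminus\{x\}$ is a clique. A graph is *simplified* if it has no critical set of surplus $\le 0$ (rule P1 does not apply), no critical set of surplus $1$ (rule P2 does not apply) and no funnel (rule P3 does not apply). An instance $\langle G,k\rangle$ ($k\in\mathbb Z$) is *feasible* if $G$ has a vertex cover of size at most $k$. Let $\lambda(G)$ be the minimum of $\sum_v\theta(v)$ over $\theta:V\to[0,1]$ with $\theta(u)+\theta(v)\ge 1$ for all edges $uv$, and let $\mu(G,k)=k-\lambda(G)$. An instance $\langle G',k'\rangle$ has *drop* $(\Delta\mu,\Delta k)$ with respect to $\langle G,k\rangle$ if $k'\le k-\Delta k$ and $\mu(G',k')\le\mu(G,k)-\Delta\mu$. A *branching* for $G$ is a finite list of pairs $(G_i,d_i)$, with $G_i$ a graph and $d_i\in\mathbb N$, such that for every $k$ the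 instance $\langle G,k\rangle$ is feasible if and only if at least one of the instances $\langle G_i,k-d_i\rangle$ is. It has *branch-seq* $[(\Delta\mu_1,\Delta k_1),\dots,(\Delta\mu_t,\Delta k_t)]$ if it consists of $t$ pairs and, for every $k$ and $i$, the instance $\langle G_i,k-d_i\rangle$ has drop $(\Delta\mu_i,\Delta k_i)$ with respect to $\langle G,k\rangle$. A branch-seq $B'$ *dominates* $B$ if $\mathrm{val}_{a,b}(B')\le\mathrm{val}_{a,b}(B)$ for all real $a,b\ge 0$, where $\mathrm{val}_{a,b}(B)=\sum_i e^{-a\Delta\mu_i-b\Delta k_i}$. **Theorem.** For each of the following three items there is a deterministic algorithm which, given a simplified graph $G$ whose maximum degree $r$ is as stated (encoded by its adjacency matrix), computes in time polynomial in the size of $G$ a branching for $G$ that has a branch-seq dominating at least one of the listed branch-seqs (which one may depend on $G$): 1. if $r\ge 4$: $[(1,3),(1,5)]$ or $[(0.5,1),(1.5,4)]$; 2. if $r\ge 5$: $[(1,3),(1,5)]$ or $[(0.5,1),(2,5)]$; 3. if $r\ge 6$: $[(1,3),(1,5)]$, or $[(0.5,2),(2,5)]$, or $[(0.5,1),(2.5,r)]$.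 -/

import Mathlib

/-! ### A machine model with a step count

Data are binary trees. A program is built from the usual list primitives, sequencing, tests and
while-loops, and maps a tree to a tree. Each executed instruction is charged the size of the tree
it is applied to, so that every tree produced in time `t` has size at most `t`, and polynomial
time in this model is polynomial time on a Turing machine. -/

/-- Binary trees: `nil` is the empty list, `cons a b` is a pair (or a list with head `a`). -/
inductive Data : Type
  | nil : Data
  | cons : Data → Data → Data

namespace Data

/-- The number of nodes of a tree (leaves included). -/
def size : Data → ℕ
  | nil => 1
  | cons a b => a.size + b.size + 1

/-- First component (`nil` for the empty tree). -/
def head : Data → Data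
  | nil => nil
  | cons a _ => a

/-- Second component (`nil` for the empty tree). -/
def tail : Data → Data
  | nil => nil
  | cons _ b => b

/-- A list of trees as a single tree. -/
def ofList : List Data → Data
  | [] => nil
  | a :: l => cons a (ofList l)

/-- A truth value as a tree. -/
def ofBool : Bool → Data
  | false => nil
  | true => cons nil nil

/-- A natural number in unary. -/
def ofNat (n : ℕ) : Data := ofList (List.replicate n nil)

end Data

/-- Programs. `seq p q` runs `p` and then `q` on the result; `pair p q` runs both on the same input
and pairs the results; `ite c p q` runs `p` if `c` returns a non-empty tree and `q` otherwise;
`loop c p` replaces the current value `x` by `p x` as long as `c x` is non-empty. -/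
inductive Prog : Type
  | id : Prog
  | nil : Prog
  | head : Prog
  | tail : Prog
  | pair : Prog → Prog → Prog
  | seq : Prog → Prog → Prog
  | ite : Prog → Prog → Prog → Prog
  | loop : Prog → Prog → Prog

/-- `Run p x y t`: program `p` halts on input `x` with output `y` after time exactly `t`. -/
inductive Run : Prog → Data → Data → ℕ → Prop
  | id (x : Data) : Run Prog.id x x x.size
  | nil (x : Data) : Run Prog.nil x Data.nil x.size
  | head (x : Data) : Run Prog.head x x.head x.size
  | tail (x : Data) : Run Prog.tail x x.tail x.size
  | pair {p q : Prog} {x y z : Data} {s t : ℕ} :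
      Run p x y s → Run q x z t → Run (Prog.pair p q) x (Data.cons y z) (x.size + s + t)
  | seq {p q : Prog} {x y z : Data} {s t : ℕ} :
      Run p x y s → Run q y z t → Run (Prog.seq p q) x z (x.size + s + t)
  | iteTrue {c p q : Prog} {x a b y : Data} {s t : ℕ} :
      Run c x (Data.cons a b) s → Run p x y t → Run (Prog.ite c p q) x y (x.size + s + t)
  | iteFalse {c p q : Prog} {x y : Data} {s t : ℕ} :
      Run c x Data.nil s → Run q x y t → Run (Prog.ite c p q) x y (x.size + s + t)
  | loopStep {c p : Prog} {x a b y z : Data} {s t u : ℕ} :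
      Run c x (Data.cons a b) s → Run p x y t → Run (Prog.loop c p) y z u →
      Run (Prog.loop c p) x z (x.size + s + t + u)
  | loopExit {c p : Prog} {x : Data} {s : ℕ} :
      Run c x Data.nil s → Run (Prog.loop c p) x x (x.size + s)

/-- Given an `x` with `D x`, one can efficiently (in deterministic polynomial time) find some `y`
with `R x y`: one program, and one polynomial that bounds its time in the size of the encoded
input, work for all `x` with `D x`. -/
def EfficientlyFind {α β : Type} (encα : α → Data) (encβ : β → Data)
    (D : α → Prop) (R : α → β → Prop) : Prop :=
  ∃ (p : Prog) (P : Polynomial ℕ), ∀ x : α, D x →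
    ∃ (y : β) (t : ℕ), Run p (encα x) (encβ y) t ∧ t ≤ P.eval (encα x).size ∧ R x y

/-! ### Independent sets, surplus, preprocessing rules -/

section Graph

variable {V : Type} [Fintype V]

open Classical in
/-- The open neighborhood `N(S) = (⋃ v ∈ S, N(v)) \ S` of a vertex set. -/
noncomputable def nbhd (G : SimpleGraph V) (S : Finset V) : Finset V :=
  Finset.univ.filter fun w => w ∉ S ∧ ∃ v ∈ S, G.Adj v w

/-- The surplus `|N(I)| - |I|`. -/
noncomputable def surplus (G : SimpleGraph V) (I : Finset V) : ℤ :=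
  ((nbhd G I).card : ℤ) - (I.card : ℤ)

/-- A critical set: a non-empty independent set `I` all of whose non-empty subsets have surplus at
least that of `I`. -/
def IsCriticalSet (G : SimpleGraph V) (I : Finset V) : Prop :=
  I.Nonempty ∧ G.IsIndepSet (I : Set V) ∧
    ∀ J : Finset V, J ⊆ I → J.Nonempty → surplus G I ≤ surplus G J

/-- `u` is a funnel with out-neighbor `x`: `x` is a neighbor of `u`, and the other neighbors of `u`
form a clique. -/
def IsFunnel (G : SimpleGraph V) (u x : V) : Prop :=
  G.Adj u x ∧ G.IsClique (G.neighborSet u \ {x})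

/-- The first preprocessing rule applies: there is a critical set of surplus at most `0`. -/
def RuleOneApplies (G : SimpleGraph V) : Prop :=
  ∃ I : Finset V, IsCriticalSet G I ∧ surplus G I ≤ 0

/-- The second preprocessing rule applies: there is a critical set of surplus `1`. -/
def RuleTwoApplies (G : SimpleGraph V) : Prop :=
  ∃ I : Finset V, IsCriticalSet G I ∧ surplus G I = 1

/-- The third preprocessing rule applies: there is a funnel. -/
def RuleThreeApplies (G : SimpleGraph V) : Prop :=
  ∃ u x : V, IsFunnel G u x

/-- A graph is simplified if no preprocessing rule applies to it. -/
def Simplified (G : SimpleGraph V) : Prop :=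
  ¬ RuleOneApplies G ∧ ¬ RuleTwoApplies G ∧ ¬ RuleThreeApplies G

/-! ### Vertex cover, its linear program, and the measure `μ` -/

/-- `⟨G, k⟩` is feasible: `G` has a vertex cover of size at most `k`. -/
def Feasible (G : SimpleGraph V) (k : ℤ) : Prop :=
  ∃ C : Finset V, G.IsVertexCover (C : Set V) ∧ (C.card : ℤ) ≤ k

/-- Feasible solutions of the vertex cover linear program. -/
def IsFractionalCover (G : SimpleGraph V) (θ : V → ℝ) : Prop :=
  (∀ v, 0 ≤ θ v ∧ θ v ≤ 1) ∧ ∀ u v, G.Adj u v → 1 ≤ θ u + θ v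

/-- The optimal value `λ(G)` of the vertex cover linear program. -/
noncomputable def lpOpt (G : SimpleGraph V) : ℝ :=
  sInf {s : ℝ | ∃ θ : V → ℝ, IsFractionalCover G θ ∧ s = ∑ v, θ v}

/-- The measure `μ = k - λ(G)` of the instance `⟨G, k⟩`. -/
noncomputable def mu (G : SimpleGraph V) (k : ℤ) : ℝ := (k : ℝ) - lpOpt G

end Graph

/-! ### Branching -/

/-- A finite graph, on the vertex set `Fin n`. -/
structure FinGraph : Type where
  n : ℕ
  graph : SimpleGraph (Fin n)

open Classical in
/-- The maximum degree `r`. -/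
noncomputable def FinGraph.maxDeg (G : FinGraph) : ℕ := G.graph.maxDegree

/-- A subproblem: it turns an instance `⟨G, k⟩` into the instance `⟨graph, k - dk⟩`. -/
structure Subproblem : Type where
  toFinGraph : FinGraph
  dk : ℕ

open Classical in
/-- A graph is encoded by its adjacency matrix, a list of rows. -/
noncomputable def FinGraph.enc (G : FinGraph) : Data :=
  Data.ofList (List.ofFn fun i : Fin G.n =>
    Data.ofList (List.ofFn fun j : Fin G.n => Data.ofBool (decide (G.graph.Adj i j))))

/-- A subproblem is encoded as the pair of its graph and its decrement of `k`. -/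
noncomputable def Subproblem.enc (S : Subproblem) : Data :=
  Data.cons S.toFinGraph.enc (Data.ofNat S.dk)

/-- A list of subproblems is encoded as the list of their encodings. -/
noncomputable def encSubproblems (L : List Subproblem) : Data :=
  Data.ofList (L.map Subproblem.enc)

/-- The subproblems `L` form a valid branching for `G`: for every `k`, the instance `⟨G, k⟩` is
feasible if and only if at least one of the generated instances is. -/
def IsBranching (G : FinGraph) (L : List Subproblem) : Prop :=
  ∀ k : ℤ, Feasible G.graph k ↔ ∃ S ∈ L, Feasible S.toFinGraph.graph (k - (S.dk : ℤ))

/-- A list of drops `(Δμ, Δk)`. -/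
abbrev BranchSeq : Type := List (ℝ × ℝ)

/-- The instance `⟨H, k'⟩` has drop `d = (Δμ, Δk)` with respect to the instance `⟨G, k⟩`. -/
def HasDrop (G : FinGraph) (k : ℤ) (H : FinGraph) (k' : ℤ) (d : ℝ × ℝ) : Prop :=
  (k' : ℝ) ≤ (k : ℝ) - d.2 ∧ mu H.graph k' ≤ mu G.graph k - d.1

/-- The subproblems `L` of `G` have the drops listed in `B`, in this order, for every `k`. -/
def HasBranchSeq (G : FinGraph) (L : List Subproblem) (B : BranchSeq) : Prop :=
  List.Forall₂ (fun S d => ∀ k : ℤ, HasDrop G k S.toFinGraph (k - (S.dk : ℤ)) d) L B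

/-- The value `val_{a,b}(B) = ∑ exp (- a Δμ - b Δk)`. -/
noncomputable def BranchSeq.val (a b : ℝ) (B : BranchSeq) : ℝ :=
  (B.map fun d => Real.exp (-a * d.1 - b * d.2)).sum

/-- `B'` dominates `B`. -/
def Dominates (B' B : BranchSeq) : Prop :=
  ∀ a b : ℝ, 0 ≤ a → 0 ≤ b → BranchSeq.val a b B' ≤ BranchSeq.val a b B

/-- On the graphs `G` with `D G`, one of the branch-seqs in `Bs G` is always available: one can
efficiently find a branching for `G` with a branch-seq that dominates a member of `Bs G`. -/
def Available (D : FinGraph → Prop) (Bs : FinGraph → Set BranchSeq) : Prop :=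
  EfficientlyFind FinGraph.enc encSubproblems D fun G L =>
    IsBranching G L ∧ ∃ B' : BranchSeq, HasBranchSeq G L B' ∧ ∃ B ∈ Bs G, Dominates B' B

set_option linter.unusedSectionVars false

/-! ### Polynomial-time functions between encoded types -/

/-! Surplus governs both the linear program and the branchings. Twice the LP optimum, `lam G`,
equals |V| plus the minimum surplus of an independent set (`lam_le_surplus`,
`exists_surplus_le_lam`). In a simplified graph every non-empty independent set has surplus at least
2 (`Simplified.expanding`), so the all-halves solution is optimal. Putting a set U into the cover
then lowers μ by at least min(|U|, 2)/2 (`Expanding.le_lam_delG`). Leaving X out, that is taking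
N(X), lowers μ by `sig G X`/2, where `sig G X` is the least surplus of an independent superset of X
(`sig_le`, `exists_sig`). Branching on one vertex u thus has drops (1/2, 1) and (sig{u}/2, deg u).
It remains to see that sig{u} is at least 3, 4, 5 when deg u is at least 4, 5, 6, unless a better
branching exists.

If sig{u} is too small, let I be an independent set of that surplus containing u. When a cover
misses u, an exchange argument makes it miss all of I at no cost (`Cov.swap_of_surplus`). This
validates branchings "U in the cover, or X out of it" with small U and X inside I
(`ValidBase.feasible_iff`). Further decreases of k come from reductions that never raise μ: leaves
and critical sets of surplus one (`Red.leaf`, `Red.crit_del`, `Red.crit_con`). Several vertices of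
degree at most two can be reduced in a row under Hall's condition (`Gain.of_hall`).

The case analysis assumes that none of the five branchings in `TWin` exists (`Stuck`). For deg u ≥ 5
and surplus 3, all other members of I have degree three (`Stuck.dg_eq_three`). This produces heavy
vertices of degree exactly 5, each with a blocker x satisfying N(x) ⊆ N(u), and counting edges
between heavy vertices and blockers gives a contradiction (`Stuck.not_heavy`). For deg u ≥ 6 and
surplus 4, a smallest such I contains a vertex x of degree three; each of its three neighbors yields
one extra reduction in one of the two branches (`Stuck.sig_ne_four`).

The algorithm needs none of this analysis. It enumerates all U and X of at most three vertices,
tests validity and drops by computing LP values, and returns the first branching that passes. LP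
values come from a maximum matching of the bipartite double cover, found by an auction
(`IsAdj.nu_eq_lam`). Polynomial time follows from closure properties of `PT`, above all folds with
bounded accumulators (`PT.foldl`). Domination reduces to polynomial inequalities in p = exp(-a/2)
and q = exp(-b). -/

theorem Data.size_pos (d : Data) : 0 < d.size := by cases d <;> simp [Data.size]

/-- Each instruction pays for the size of its input, so time bounds are also size bounds. This is
what makes polynomial bounds compose. -/
theorem Run.size_le {p : Prog} {x y : Data} {t : ℕ} (h : Run p x y t) : y.size ≤ t := by
  induction h with
  | id => exact le_rfl
  | nil x => exact x.size_pos
  | head x => cases x <;> simp [Data.head, Data.size]; omega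
  | tail x => cases x <;> simp [Data.tail, Data.size]; omega
  | @pair p q x y z s t _ _ h1 h2 =>
    have := x.size_pos
    simp only [Data.size]; omega
  | _ => omega

theorem Polynomial.eval_nat_mono (P : Polynomial ℕ) {m n : ℕ} (h : m ≤ n) :
    P.eval m ≤ P.eval n := by
  rw [Polynomial.eval_eq_sum, Polynomial.eval_eq_sum]
  exact Finset.sum_le_sum fun i _ => Nat.mul_le_mul_left _ (Nat.pow_le_pow_left h i)

/-- Types whose elements are encoded as trees. -/
class Enc (α : Type) where
  enc : α → Data

instance : Enc Bool := ⟨Data.ofBool⟩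
instance : Enc ℕ := ⟨Data.ofNat⟩
instance {α β : Type} [Enc α] [Enc β] : Enc (α × β) := ⟨fun x => Data.cons (Enc.enc x.1) (Enc.enc x.2)⟩
instance {α : Type} [Enc α] : Enc (List α) := ⟨fun l => Data.ofList (l.map Enc.enc)⟩

/-- The size of the encoding. -/
def esize {α : Type} [Enc α] (x : α) : ℕ := (Enc.enc x).size

/-- `f` is computed by a program in polynomial time. -/
@[fun_prop]
def PT {α β : Type} [Enc α] [Enc β] (f : α → β) : Prop :=
  ∃ (p : Prog) (P : Polynomial ℕ), ∀ x, ∃ t, Run p (Enc.enc x) (Enc.enc (f x)) t ∧ t ≤ P.eval (esize x)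

section PT
variable {α β γ δ σ : Type} [Enc α] [Enc β] [Enc γ] [Enc δ] [Enc σ]

theorem esize_pos (x : α) : 0 < esize x := Data.size_pos _

theorem esize_nil : esize ([] : List α) = 1 := rfl

theorem esize_cons (a : α) (l : List α) : esize (a :: l) = esize a + esize l + 1 := rfl

theorem esize_prod (x : α × β) : esize x = esize x.1 + esize x.2 + 1 := rfl

theorem esize_nat (n : ℕ) : esize n = 2 * n + 1 := by
  induction n with
  | zero => rfl
  | succ n ih =>
    have : esize (n + 1) = 1 + esize n + 1 := rfl
    omega

theorem esize_append (l m : List α) : esize (l ++ m) + 1 = esize l + esize m := by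
  induction l with
  | nil => simp [esize_nil]; omega
  | cons a l ih => simp only [List.cons_append, esize_cons]; omega

theorem esize_reverse (l : List α) : esize l.reverse = esize l := by
  induction l with
  | nil => rfl
  | cons a l ih =>
    have := esize_append l.reverse [a]
    simp only [List.reverse_cons, esize_cons, esize_nil] at *; omega

theorem length_le_esize (l : List α) : l.length ≤ esize l := by
  induction l with
  | nil => simp
  | cons a l ih => simp only [List.length_cons, esize_cons]; omega

theorem PT.size_le {f : α → β} (hf : PT f) : ∃ P : Polynomial ℕ, ∀ x, esize (f x) ≤ P.eval (esize x) := by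
  obtain ⟨p, P, h⟩ := hf
  refine ⟨P, fun x => ?_⟩
  obtain ⟨t, h1, h2⟩ := h x
  exact h1.size_le.trans h2

@[fun_prop]
theorem PT.id' : PT (fun x : α => x) :=
  ⟨Prog.id, Polynomial.X, fun x => ⟨_, Run.id _, by simp [esize]⟩⟩

@[fun_prop]
theorem PT.comp' {g : β → γ} {f : α → β} (hg : PT g) (hf : PT f) : PT (fun x => g (f x)) := by
  obtain ⟨p, P, hp⟩ := hf
  obtain ⟨q, Q, hq⟩ := hg
  refine ⟨Prog.seq p q, Polynomial.X + P + Q.comp P, fun x => ?_⟩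
  obtain ⟨s, h1, h2⟩ := hp x
  obtain ⟨t, h3, h4⟩ := hq (f x)
  refine ⟨_, Run.seq h1 h3, ?_⟩
  have := Q.eval_nat_mono (h1.size_le.trans h2)
  simp only [Polynomial.eval_add, Polynomial.eval_X, Polynomial.eval_comp]
  unfold esize at *
  omega

theorem exists_const_prog (d : Data) : ∃ (p : Prog) (c : ℕ), ∀ x, ∃ t, Run p x d t ∧ t ≤ c * x.size := by
  induction d with
  | nil => exact ⟨Prog.nil, 1, fun x => ⟨_, Run.nil x, by simp⟩⟩
  | cons a b iha ihb =>
    obtain ⟨p, c, hp⟩ := iha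
    obtain ⟨q, d, hq⟩ := ihb
    refine ⟨Prog.pair p q, 1 + c + d, fun x => ?_⟩
    obtain ⟨s, h1, h2⟩ := hp x
    obtain ⟨t, h3, h4⟩ := hq x
    exact ⟨_, Run.pair h1 h3, by rw [add_mul, add_mul]; omega⟩

@[fun_prop]
theorem PT.const' (b : β) : PT (fun _ : α => b) := by
  obtain ⟨p, c, hp⟩ := exists_const_prog (Enc.enc b)
  refine ⟨p, Polynomial.C c * Polynomial.X, fun x => ?_⟩
  obtain ⟨s, h1, h2⟩ := hp (Enc.enc x)
  exact ⟨s, h1, by simpa [esize] using h2⟩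

@[fun_prop]
theorem PT.prodMk {f : α → β} {g : α → γ} (hf : PT f) (hg : PT g) : PT (fun x => (f x, g x)) := by
  obtain ⟨p, P, hp⟩ := hf
  obtain ⟨q, Q, hq⟩ := hg
  refine ⟨Prog.pair p q, Polynomial.X + P + Q, fun x => ?_⟩
  obtain ⟨s, h1, h2⟩ := hp x
  obtain ⟨t, h3, h4⟩ := hq x
  refine ⟨_, Run.pair h1 h3, ?_⟩
  simp only [Polynomial.eval_add, Polynomial.eval_X]
  unfold esize at *
  omega

@[fun_prop]
theorem PT.prodFst : PT (Prod.fst : α × β → α) :=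
  ⟨Prog.head, Polynomial.X, fun x => ⟨_, Run.head _, by simp [esize]⟩⟩

@[fun_prop]
theorem PT.prodSnd : PT (Prod.snd : α × β → β) :=
  ⟨Prog.tail, Polynomial.X, fun x => ⟨_, Run.tail _, by simp [esize]⟩⟩

@[fun_prop]
theorem PT.bcond {b : α → Bool} {f g : α → β} (hb : PT b) (hf : PT f) (hg : PT g) :
    PT (fun x => cond (b x) (f x) (g x)) := by
  obtain ⟨r, R, hr⟩ := hb
  obtain ⟨p, P, hp⟩ := hf
  obtain ⟨q, Q, hq⟩ := hg
  refine ⟨Prog.ite r p q, Polynomial.X + R + P + Q, fun x => ?_⟩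
  obtain ⟨s, h1, h2⟩ := hr x
  obtain ⟨t, h3, h4⟩ := hp x
  obtain ⟨u, h5, h6⟩ := hq x
  simp only [Polynomial.eval_add, Polynomial.eval_X]
  cases hx : b x with
  | true => rw [hx] at h1; exact ⟨_, Run.iteTrue h1 h3, by unfold esize at *; omega⟩
  | false => rw [hx] at h1; exact ⟨_, Run.iteFalse h1 h5, by unfold esize at *; omega⟩

@[fun_prop]
theorem PT.list_cons {f : α → β} {g : α → List β} (hf : PT f) (hg : PT g) :
    PT (fun x => f x :: g x) := PT.prodMk hf hg

@[fun_prop]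
theorem PT.list_tail : PT (List.tail : List α → List α) :=
  ⟨Prog.tail, Polynomial.X, fun x => ⟨esize x, by cases x <;> exact Run.tail _, by simp⟩⟩

@[fun_prop]
theorem PT.list_isEmpty : PT (List.isEmpty : List α → Bool) := by
  refine ⟨Prog.ite Prog.id Prog.nil (Prog.pair Prog.nil Prog.nil), Polynomial.C 10 * Polynomial.X, fun x => ?_⟩
  cases x with
  | nil => exact ⟨_, Run.iteFalse (Run.id _) (Run.pair (Run.nil _) (Run.nil _)), by simp [esize]; omega⟩
  | cons a l => exact ⟨_, Run.iteTrue (Run.id _) (Run.nil _), by simp [esize]; omega⟩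

@[fun_prop]
theorem PT.list_headD {f : α → List β} {d : α → β} (hf : PT f) (hd : PT d) :
    PT (fun x => (f x).headD (d x)) := by
  have : PT (fun p : List β × β => p.1.headD p.2) := by
    refine ⟨Prog.ite Prog.head (Prog.seq Prog.head Prog.head) Prog.tail, Polynomial.C 20 * Polynomial.X,
      fun x => ?_⟩
    obtain ⟨l, d⟩ := x
    cases l with
    | nil => exact ⟨_, Run.iteFalse (Run.head _) (Run.tail _), by simp [esize]; omega⟩
    | cons a l =>
      refine ⟨_, Run.iteTrue (Run.head _) (Run.seq (Run.head _) (Run.head _)), ?_⟩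
      simp only [Polynomial.eval_mul, Polynomial.eval_C, Polynomial.eval_X, esize, Enc.enc, Data.size,
        Data.head, List.map, Data.ofList]
      omega
  exact PT.comp' this (PT.prodMk hf hd)

/-- The loop that folds over a list: its state is `(l, acc, c)`. -/
def foldBody (p : Prog) : Prog :=
  Prog.pair (Prog.seq Prog.head Prog.tail)
    (Prog.pair
      (Prog.seq (Prog.pair (Prog.seq Prog.tail Prog.tail)
        (Prog.pair (Prog.seq Prog.tail Prog.head) (Prog.seq Prog.head Prog.head))) p)
      (Prog.seq Prog.tail Prog.tail))

theorem run_foldBody {p : Prog} {a r s c s' : Data} {t : ℕ}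
    (h : Run p (Data.cons c (Data.cons s a)) s' t) :
    ∃ u, Run (foldBody p) (Data.cons (Data.cons a r) (Data.cons s c)) (Data.cons r (Data.cons s' c)) u ∧
      u ≤ 40 * (a.size + r.size + s.size + c.size + 2) + t := by
  refine ⟨_, Run.pair (Run.seq (Run.head _) (Run.tail _)) (Run.pair (Run.seq (Run.pair
    (Run.seq (Run.tail _) (Run.tail _)) (Run.pair (Run.seq (Run.tail _) (Run.head _))
      (Run.seq (Run.head _) (Run.head _)))) h) (Run.seq (Run.tail _) (Run.tail _))), ?_⟩
  simp only [Data.size, Data.head, Data.tail]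
  omega

theorem run_foldLoop {f : γ → σ → α → σ} {p : Prog} {P : Polynomial ℕ}
    (hp : ∀ x : γ × σ × α, ∃ t, Run p (Enc.enc x) (Enc.enc (f x.1 x.2.1 x.2.2)) t ∧ t ≤ P.eval (esize x))
    (c : γ) (B : ℕ) (l : List α) : ∀ s : σ,
    (∀ l₁ l₂, l = l₁ ++ l₂ → esize (l₁.foldl (f c) s) ≤ B) →
    ∃ t, Run (Prog.loop Prog.head (foldBody p)) (Enc.enc (l, s, c)) (Enc.enc (([] : List α), l.foldl (f c) s, c)) t ∧
      t ≤ (l.length + 1) * (50 * (esize l + B + esize c + 3) + P.eval (esize l + B + esize c + 3)) := by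
  induction l with
  | nil =>
    intro s hs
    refine ⟨_, Run.loopExit (Run.head _), ?_⟩
    have := hs [] [] rfl
    have h1 : (Enc.enc (([] : List α), s, c)).size = 1 + (esize s + esize c + 1) + 1 := rfl
    have h2 : (esize ([] : List α)) = 1 := rfl
    simp only [List.foldl_nil, List.length_nil, h1, h2] at *
    omega
  | cons a l ih =>
    intro s hs
    have hs0 := hs [] (a :: l) rfl
    obtain ⟨t, h1, h2⟩ := hp (c, s, a)
    obtain ⟨u, h3, h4⟩ := run_foldBody (r := Enc.enc l) h1
    obtain ⟨v, h5, h6⟩ := ih (f c s a) (fun l₁ l₂ h => hs (a :: l₁) l₂ (by rw [h]; rfl))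
    refine ⟨_, Run.loopStep (Run.head _) h3 h5, ?_⟩
    have e1 : (Enc.enc (a :: l, s, c)).size = (esize a + esize l + 1) + (esize s + esize c + 1) + 1 := rfl
    have e2 : esize (c, s, a) = esize c + (esize s + esize a + 1) + 1 := rfl
    have e3 : esize (a :: l) = esize a + esize l + 1 := rfl
    have e4 := P.eval_nat_mono (m := esize (c, s, a)) (n := esize (a :: l) + B + esize c + 3)
      (by simp only [List.foldl_nil] at hs0; omega)
    have e5 := P.eval_nat_mono (m := esize l + B + esize c + 3) (n := esize (a :: l) + B + esize c + 3)
      (by omega)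
    have e6 : (l.length + 1) * (50 * (esize l + B + esize c + 3) + P.eval (esize l + B + esize c + 3))
        ≤ (l.length + 1) * (50 * (esize (a :: l) + B + esize c + 3) + P.eval (esize (a :: l) + B + esize c + 3)) :=
      Nat.mul_le_mul_left _ (by omega)
    rw [List.length_cons, add_mul (l.length + 1) 1, one_mul]
    have e7 : (Data.cons (Enc.enc a) (Enc.enc l)).size = esize a + esize l + 1 := rfl
    simp only [List.foldl_nil] at hs0
    change u ≤ 40 * (esize a + esize l + esize s + esize c + 2) + t at h4
    change _ + (Enc.enc (a :: l, s, c)).size + u + v ≤ _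
    omega

/-- A polynomial-time step may double its accumulator, so iterating it need not stay polynomial. The
hypothesis `hQ` bounds the accumulator after every prefix of the list; each pass of the loop then
costs polynomially much, and there are at most `esize (l c)` passes. -/
theorem PT.foldl {l : γ → List α} {s : γ → σ} {f : γ → σ → α → σ} (hl : PT l) (hs : PT s)
    (hf : PT (fun x : γ × σ × α => f x.1 x.2.1 x.2.2)) (Q : Polynomial ℕ)
    (hQ : ∀ c l₁ l₂, l c = l₁ ++ l₂ → esize (l₁.foldl (f c) (s c)) ≤ Q.eval (esize c)) :
    PT (fun c => (l c).foldl (f c) (s c)) := by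
  obtain ⟨p, P, hp⟩ := hf
  have h1 : PT (fun c => (l c, s c, c)) := by fun_prop
  obtain ⟨L, hL⟩ := hl.size_le
  have h2 : PT (fun x : List α × σ × γ => x.2.1) := by fun_prop
  obtain ⟨p1, P1, hp1⟩ := h1
  obtain ⟨p2, P2, hp2⟩ := h2
  refine ⟨Prog.seq p1 (Prog.seq (Prog.loop Prog.head (foldBody p)) p2),
    Polynomial.X + P1 + (P1 + (L + 1) * (Polynomial.C 50 * (L + Q + Polynomial.X + 3) +
      P.comp (L + Q + Polynomial.X + 3)) + P2.comp (Q + Polynomial.X + 3)) +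
      (L + 1) * (Polynomial.C 50 * (L + Q + Polynomial.X + 3) + P.comp (L + Q + Polynomial.X + 3)), fun c => ?_⟩
  obtain ⟨t1, r1, b1⟩ := hp1 c
  obtain ⟨t2, r2, b2⟩ := run_foldLoop hp c (Q.eval (esize c)) (l c) (s c) (hQ c)
  obtain ⟨t3, r3, b3⟩ := hp2 ([], (l c).foldl (f c) (s c), c)
  refine ⟨_, Run.seq r1 (Run.seq r2 r3), ?_⟩
  have e1 : (Enc.enc (l c, s c, c)).size ≤ t1 := r1.size_le
  have e2 := hL c
  have e3 := hQ c (l c) [] (by simp)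
  have e4 : esize (([] : List α), (l c).foldl (f c) (s c), c) = 1 + (esize ((l c).foldl (f c) (s c)) + esize c + 1) + 1 := rfl
  have e5 := P2.eval_nat_mono (m := esize (([] : List α), (l c).foldl (f c) (s c), c)) (n := Q.eval (esize c) + esize c + 3)
    (by omega)
  have e6 : ((l c).length + 1) * (50 * (esize (l c) + Q.eval (esize c) + esize c + 3) + P.eval (esize (l c) + Q.eval (esize c) + esize c + 3))
     ≤ (L.eval (esize c) + 1) * (50 * (L.eval (esize c) + Q.eval (esize c) + esize c + 3) + P.eval (L.eval (esize c) + Q.eval (esize c) + esize c + 3)) := by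
    have := length_le_esize (l c)
    have := P.eval_nat_mono (m := esize (l c) + Q.eval (esize c) + esize c + 3) (n := L.eval (esize c) + Q.eval (esize c) + esize c + 3) (by omega)
    exact Nat.mul_le_mul (by omega) (by omega)
  have e7 : (Enc.enc c).size = esize c := rfl
  simp only [Polynomial.eval_add, Polynomial.eval_mul, Polynomial.eval_comp, Polynomial.eval_X, Polynomial.eval_C,
    Polynomial.eval_one, Polynomial.eval_ofNat]
  omega

@[fun_prop]
theorem PT.and {f g : α → Bool} (hf : PT f) (hg : PT g) : PT (fun x => f x && g x) := by
  have : (fun x => f x && g x) = fun x => cond (f x) (g x) false := by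
    ext x; cases f x <;> rfl
  rw [this]; fun_prop

@[fun_prop]
theorem PT.or {f g : α → Bool} (hf : PT f) (hg : PT g) : PT (fun x => f x || g x) := by
  have : (fun x => f x || g x) = fun x => cond (f x) true (g x) := by
    ext x; cases f x <;> rfl
  rw [this]; fun_prop

@[fun_prop]
theorem PT.not {f : α → Bool} (hf : PT f) : PT (fun x => !(f x)) := by
  have : (fun x => !(f x)) = fun x => cond (f x) false true := by
    ext x; cases f x <;> rfl
  rw [this]; fun_prop

theorem foldl_flip_cons {α : Type} (l m : List α) : l.foldl (fun s a => a :: s) m = l.reverse ++ m := by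
  induction l generalizing m <;> simp_all

@[fun_prop]
theorem PT.list_reverse {f : γ → List α} (hf : PT f) : PT (fun c => (f c).reverse) := by
  have h : (fun l : List α => l.reverse) = fun l => l.foldl (fun s a => a :: s) [] := by
    ext1 l; rw [foldl_flip_cons, List.append_nil]
  have : PT (fun l : List α => l.reverse) := by
    rw [h]
    refine PT.foldl (by fun_prop) (by fun_prop) (by fun_prop) (Polynomial.X) fun c l₁ l₂ hc => ?_
    have := esize_append l₁ l₂
    have := esize_pos l₂
    rw [foldl_flip_cons, List.append_nil, esize_reverse, Polynomial.eval_X, hc]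
    omega
  exact PT.comp' this hf

@[fun_prop]
theorem PT.list_append {f g : γ → List α} (hf : PT f) (hg : PT g) : PT (fun c => f c ++ g c) := by
  have h : (fun x : List α × List α => x.1 ++ x.2) = fun x => x.1.reverse.foldl (fun s a => a :: s) x.2 := by
    ext1 x; rw [foldl_flip_cons, List.reverse_reverse]
  have : PT (fun x : List α × List α => x.1 ++ x.2) := by
    rw [h]
    refine PT.foldl (by fun_prop) (by fun_prop) (by fun_prop) (Polynomial.X) fun c l₁ l₂ hc => ?_
    have h1 := esize_append l₁ l₂
    have h2 := esize_append l₁.reverse c.2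
    have := esize_pos l₂
    rw [foldl_flip_cons, Polynomial.eval_X]
    rw [esize_reverse] at h2
    rw [← hc, esize_reverse] at h1
    rw [esize_prod]
    omega
  exact PT.comp' (f := fun c => (f c, g c)) this (by fun_prop)

theorem esize_flatMap_le {α : Type} (g : α → List β) (l : List α) (B : ℕ) (h : ∀ a ∈ l, esize (g a) ≤ B) :
    esize (l.flatMap g) ≤ l.length * B + 1 := by
  induction l with
  | nil => simp [esize_nil]
  | cons a l ih =>
    have := ih (fun b hb => h b (List.mem_cons_of_mem _ hb))
    have := h a List.mem_cons_self
    have := esize_append (g a) (l.flatMap g)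
    rw [List.flatMap_cons, List.length_cons, add_mul]
    omega

theorem esize_mem_le {l : List α} {a : α} (h : a ∈ l) : esize a ≤ esize l := by
  induction l with
  | nil => simp at h
  | cons b l ih =>
    rw [esize_cons]
    rcases List.mem_cons.1 h with rfl | h
    · omega
    · have := ih h; omega

@[fun_prop]
theorem PT.list_flatMap {l : γ → List α} {g : γ → α → List β} (hl : PT l)
    (hg : PT (fun x : γ × α => g x.1 x.2)) : PT (fun c => (l c).flatMap (g c)) := by
  have h : (fun c => (l c).flatMap (g c)) = fun c => (l c).reverse.foldl (fun s a => g c a ++ s) [] := by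
    ext1 c
    rw [List.foldl_reverse]
    induction l c <;> simp_all
  rw [h]
  obtain ⟨L, hL⟩ := hl.size_le
  obtain ⟨P, hP⟩ := hg.size_le
  refine PT.foldl (by fun_prop) (by fun_prop) ?_
    (L * P.comp (Polynomial.X + L + 1) + 1) fun c l₁ l₂ hc => ?_
  · have : PT (fun x : γ × List β × α => g x.1 x.2.2) :=
      PT.comp' (f := fun x : γ × List β × α => (x.1, x.2.2)) hg (by fun_prop)
    fun_prop
  · have h2 : ∀ l : List α, l.foldl (fun s a => g c a ++ s) [] = l.reverse.flatMap (g c) := by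
      intro l
      rw [← List.reverse_reverse l, List.foldl_reverse, List.reverse_reverse]
      induction l.reverse <;> simp_all
    rw [h2]
    have h3 := length_le_esize (l c)
    have h4 := hL c
    have h5 : l₁.length ≤ (l c).length := by
      have := congrArg List.length hc
      simp at this; omega
    refine (esize_flatMap_le _ _ (P.eval (esize c + L.eval (esize c) + 1)) fun a ha => ?_).trans ?_
    · have ha' : a ∈ l c := by
        rw [← List.mem_reverse, hc]
        exact List.mem_append_left _ (List.mem_reverse.1 ha)
      have := esize_mem_le ha'
      have h6 := hP (c, a)
      refine h6.trans (P.eval_nat_mono ?_)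
      rw [esize_prod]
      simp only
      omega
    · simp only [List.length_reverse, Polynomial.eval_add, Polynomial.eval_mul, Polynomial.eval_comp,
        Polynomial.eval_X, Polynomial.eval_one]
      exact Nat.add_le_add_right (Nat.mul_le_mul_right _ (by omega)) _

@[fun_prop]
theorem PT.list_map {l : γ → List α} {g : γ → α → β} (hl : PT l)
    (hg : PT (fun x : γ × α => g x.1 x.2)) : PT (fun c => (l c).map (g c)) := by
  have h : (fun c => (l c).map (g c)) = fun c => (l c).flatMap (fun a => [g c a]) := by
    ext1 c; rw [List.map_eq_flatMap]
  rw [h]; fun_prop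

@[fun_prop]
theorem PT.list_filter {l : γ → List α} {g : γ → α → Bool} (hl : PT l)
    (hg : PT (fun x : γ × α => g x.1 x.2)) : PT (fun c => (l c).filter (g c)) := by
  have h : (fun c => (l c).filter (g c)) = fun c => (l c).flatMap (fun a => cond (g c a) [a] []) := by
    ext1 c
    induction l c with
    | nil => rfl
    | cons a l ih => rw [List.filter_cons, List.flatMap_cons, ih]; cases g c a <;> rfl
  rw [h]; fun_prop

@[fun_prop]
theorem PT.list_any {l : γ → List α} {g : γ → α → Bool} (hl : PT l)
    (hg : PT (fun x : γ × α => g x.1 x.2)) : PT (fun c => (l c).any (g c)) := by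
  have h : (fun c => (l c).any (g c)) = fun c => !((l c).filter (g c)).isEmpty := by
    ext1 c
    induction l c with
    | nil => rfl
    | cons a l ih => rw [List.filter_cons, List.any_cons, ih]; cases g c a <;> simp
  rw [h]; fun_prop

@[fun_prop]
theorem PT.list_all {l : γ → List α} {g : γ → α → Bool} (hl : PT l)
    (hg : PT (fun x : γ × α => g x.1 x.2)) : PT (fun c => (l c).all (g c)) := by
  have h : (fun c => (l c).all (g c)) = fun c => !((l c).any (fun a => !(g c a))) := by
    ext1 c; simp [List.all_eq_not_any_not]
  rw [h]; fun_prop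

/-! ### Unary numbers -/

/-- Numbers are unary and `false` is the empty tree, so both sides have the same encoding and the
identity program suffices. Numbers can thereby drive folds. -/
theorem PT.replicate_unit : PT (fun n : ℕ => List.replicate n false) :=
  ⟨Prog.id, Polynomial.X, fun n => ⟨esize n, by
    have : Enc.enc (List.replicate n false) = Enc.enc n := by
      change Data.ofList _ = Data.ofList _
      rw [List.map_replicate]; rfl
    rw [this]; exact Run.id _, by simp⟩⟩

theorem PT.natFold {n : γ → ℕ} {s : γ → σ} {f : γ → σ → σ} (hn : PT n) (hs : PT s)
    (hf : PT (fun x : γ × σ => f x.1 x.2)) (Q : Polynomial ℕ)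
    (hQ : ∀ c m, m ≤ n c → esize ((f c)^[m] (s c)) ≤ Q.eval (esize c)) :
    PT (fun c => (f c)^[n c] (s c)) := by
  have h : ∀ (c : γ) (m : ℕ) (s : σ), (List.replicate m false).foldl (fun s _ => f c s) s = (f c)^[m] s := by
    intro c m
    induction m with
    | zero => intro s; rfl
    | succ m ih => intro s; rw [List.replicate_succ, List.foldl_cons, ih]; rfl
  simp only [← h]
  refine PT.foldl (PT.comp' PT.replicate_unit hn) hs ?_ Q fun c l₁ l₂ hc => ?_
  · exact PT.comp' (f := fun x : γ × σ × Bool => (x.1, x.2.1)) hf (by fun_prop)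
  · have h1 : l₁ = List.replicate l₁.length false := by
      rw [List.eq_replicate_iff]
      refine ⟨rfl, fun b hb => ?_⟩
      have : b ∈ List.replicate (n c) false := by rw [hc]; exact List.mem_append_left _ hb
      exact List.eq_of_mem_replicate this
    have h2 : l₁.length ≤ n c := by
      have := congrArg List.length hc
      simp at this; omega
    rw [h1, h]
    exact hQ c _ h2

theorem esize_nat_iter {f : γ → ℕ} (hf : PT f) : ∃ P : Polynomial ℕ, ∀ c, f c ≤ P.eval (esize c) := by
  obtain ⟨P, hP⟩ := hf.size_le
  exact ⟨P, fun c => by have := hP c; rw [esize_nat] at this; omega⟩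

theorem PT.succ : PT Nat.succ := by
  have : PT (fun n : ℕ => false :: List.replicate n false) := PT.list_cons (PT.const' _) PT.replicate_unit
  obtain ⟨p, P, h⟩ := this
  refine ⟨p, P, fun n => ?_⟩
  have e : Enc.enc n.succ = Enc.enc (false :: List.replicate n false) := by
    change Data.ofList _ = Data.ofList _
    rw [List.map_cons, List.map_replicate]; rfl
  rw [e]; exact h n

theorem PT.pred : PT Nat.pred := by
  refine ⟨Prog.tail, Polynomial.X, fun n => ⟨esize n, ?_, by simp⟩⟩
  have : Enc.enc n.pred = (Enc.enc n).tail := by cases n <;> rfl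
  rw [this]; exact Run.tail _

@[fun_prop]
theorem PT.add {f g : γ → ℕ} (hf : PT f) (hg : PT g) : PT (fun c => f c + g c) := by
  have h : (fun c => f c + g c) = fun c => Nat.succ^[g c] (f c) := by
    ext1 c; exact (Nat.succ_iterate _ _).symm
  rw [h]
  obtain ⟨P, hP⟩ := esize_nat_iter hf
  obtain ⟨Q, hQ⟩ := esize_nat_iter hg
  refine PT.natFold hg hf (PT.comp' PT.succ PT.prodSnd) (2 * (P + Q) + 1) fun c m hm => ?_
  have := hP c
  have := hQ c
  rw [Nat.succ_iterate, esize_nat]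
  simp only [Polynomial.eval_add, Polynomial.eval_mul, Polynomial.eval_ofNat, Polynomial.eval_one]
  omega

@[fun_prop]
theorem PT.sub {f g : γ → ℕ} (hf : PT f) (hg : PT g) : PT (fun c => f c - g c) := by
  have h : (fun c => f c - g c) = fun c => Nat.pred^[g c] (f c) := by
    ext1 c; exact (Nat.pred_iterate _ _).symm
  rw [h]
  obtain ⟨P, hP⟩ := esize_nat_iter hf
  refine PT.natFold hg hf (PT.comp' PT.pred PT.prodSnd) (2 * P + 1) fun c m hm => ?_
  have := hP c
  rw [Nat.pred_iterate, esize_nat]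
  simp only [Polynomial.eval_add, Polynomial.eval_mul, Polynomial.eval_ofNat, Polynomial.eval_one]
  omega

@[fun_prop]
theorem PT.mul {f g : γ → ℕ} (hf : PT f) (hg : PT g) : PT (fun c => f c * g c) := by
  have e : ∀ a m : ℕ, (fun s => s + a)^[m] 0 = a * m := by
    intro a m; rw [add_right_iterate]; simp [mul_comm]
  have h : (fun c => f c * g c) = fun c => (fun s => s + f c)^[g c] 0 := by
    ext1 c; exact (e _ _).symm
  rw [h]
  obtain ⟨P, hP⟩ := esize_nat_iter hf
  obtain ⟨Q, hQ⟩ := esize_nat_iter hg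
  refine PT.natFold hg (by fun_prop) (by fun_prop) (2 * (P * Q) + 1) fun c m hm => ?_
  have := Nat.mul_le_mul (hP c) (hm.trans (hQ c))
  rw [e, esize_nat]
  simp only [Polynomial.eval_add, Polynomial.eval_mul, Polynomial.eval_ofNat, Polynomial.eval_one]
  omega

theorem PT.isZero : PT (fun n : ℕ => Nat.beq n 0) := by
  have h : (fun n : ℕ => Nat.beq n 0) = fun n => (List.replicate n false).isEmpty := by
    ext1 n; cases n <;> rfl
  rw [h]
  exact PT.comp' PT.list_isEmpty PT.replicate_unit

@[fun_prop]
theorem PT.ble {f g : γ → ℕ} (hf : PT f) (hg : PT g) : PT (fun c => Nat.ble (f c) (g c)) := by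
  have h : (fun c => Nat.ble (f c) (g c)) = fun c => Nat.beq (f c - g c) 0 := by
    ext1 c
    rw [Bool.eq_iff_iff, Nat.ble_eq, Nat.beq_eq]; omega
  rw [h]
  exact PT.comp' PT.isZero (PT.sub hf hg)

@[fun_prop]
theorem PT.beq {f g : γ → ℕ} (hf : PT f) (hg : PT g) : PT (fun c => Nat.beq (f c) (g c)) := by
  have h : (fun c => Nat.beq (f c) (g c)) = fun c => Nat.ble (f c) (g c) && Nat.ble (g c) (f c) := by
    ext1 c
    rw [Bool.eq_iff_iff, Bool.and_eq_true, Nat.ble_eq, Nat.ble_eq, Nat.beq_eq]; omega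
  rw [h]; fun_prop

@[fun_prop]
theorem PT.list_length {f : γ → List α} (hf : PT f) : PT (fun c => (f c).length) := by
  have h : (fun l : List α => l.length) = fun l => l.foldl (fun s _ => Nat.succ s) 0 := by
    ext1 l
    have : ∀ (l : List α) s, l.foldl (fun s _ => Nat.succ s) s = s + l.length := by
      intro l; induction l with
      | nil => intro s; rfl
      | cons a l ih => intro s; rw [List.foldl_cons, ih, List.length_cons]; omega
    rw [this, zero_add]
  have : PT (fun l : List α => l.length) := by
    rw [h]
    refine PT.foldl (by fun_prop) (by fun_prop) (PT.comp' PT.succ (by fun_prop)) (2 * Polynomial.X + 1) fun c l₁ l₂ hc => ?_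
    have : l₁.length = _ := congrFun h l₁
    rw [← this, esize_nat]
    have h1 := length_le_esize c
    have h2 := congrArg List.length hc
    rw [List.length_append] at h2
    simp only [Polynomial.eval_add, Polynomial.eval_mul, Polynomial.eval_ofNat, Polynomial.eval_one, Polynomial.eval_X]
    omega
  exact PT.comp' this hf

@[fun_prop]
theorem PT.list_range {f : γ → ℕ} (hf : PT f) : PT (fun c => List.range (f c)) := by
  have e : ∀ m : ℕ, (fun s : List ℕ => s ++ [s.length])^[m] [] = List.range m := by
    intro m
    induction m with
    | zero => rfl
    | succ m ih => rw [Function.iterate_succ_apply', ih, List.range_succ, List.length_range]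
  have h : (fun n => List.range n) = fun n => (fun s : List ℕ => s ++ [s.length])^[n] [] := by
    ext1 n; exact (e n).symm
  have : PT (fun n => List.range n) := by
    rw [h]
    refine PT.natFold (by fun_prop) (by fun_prop) (by fun_prop) (Polynomial.X * (2 * Polynomial.X + 2) + 1) fun n m hm => ?_
    rw [e]
    have h1 := esize_flatMap_le (fun a : ℕ => [a]) (List.range m) (2 * esize n + 2) fun a ha => by
      have := List.mem_range.1 ha
      rw [esize_cons, esize_nil, esize_nat, esize_nat]; omega
    rw [← List.map_eq_flatMap, List.map_id', List.length_range] at h1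
    simp only [Polynomial.eval_add, Polynomial.eval_mul, Polynomial.eval_ofNat, Polynomial.eval_one, Polynomial.eval_X]
    have h2 : m ≤ esize n := by rw [esize_nat]; omega
    have := Nat.mul_le_mul_right (2 * esize n + 2) h2
    omega
  exact PT.comp' this hf

theorem tail_iterate {α : Type} (l : List α) (i : ℕ) : List.tail^[i] l = l.drop i := by
  induction i generalizing l with
  | zero => rfl
  | succ i ih => rw [Function.iterate_succ_apply, ih]; cases l <;> simp

theorem esize_drop_le (l : List α) (i : ℕ) : esize (l.drop i) ≤ esize l := by
  have := esize_append (l.take i) (l.drop i)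
  have := esize_pos (l.take i)
  rw [List.take_append_drop] at *
  omega

@[fun_prop]
theorem PT.list_getD {f : γ → List α} {i : γ → ℕ} {d : γ → α} (hf : PT f) (hi : PT i) (hd : PT d) :
    PT (fun c => (f c).getD (i c) (d c)) := by
  have h : (fun c => (f c).getD (i c) (d c)) = fun c => (List.tail^[i c] (f c)).headD (d c) := by
    ext1 c
    rw [tail_iterate, List.getD_eq_getElem?_getD, List.headD_eq_head?_getD, List.head?_drop]
  rw [h]
  refine PT.list_headD ?_ hd
  obtain ⟨P, hP⟩ := hf.size_le
  refine PT.natFold hi hf (by fun_prop) P fun c m hm => ?_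
  rw [tail_iterate]
  exact (esize_drop_le _ _).trans (hP c)

end PT

/-! ### Adjacency matrices and the value of the linear program -/

/-- Boolean matrices, as lists of rows. -/
abbrev Mat : Type := List (List Bool)

/-- Entry of a matrix. -/
def adj (M : Mat) (i j : ℕ) : Bool := (M.getD i []).getD j false

/-- The adjacency matrix of the graph on `n` vertices generated by the relation `f`. -/
def mk (n : ℕ) (f : ℕ → ℕ → Bool) : Mat :=
  (List.range n).map fun i => (List.range n).map fun j => !(Nat.beq i j) && (f i j || f j i)

/-- `M` is the adjacency matrix of a graph on `n` vertices. -/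
def IsAdj (n : ℕ) (M : Mat) : Prop := ∃ f, M = mk n f

/-- The graph on `Fin n` of an adjacency matrix. -/
def gr (n : ℕ) (M : Mat) : SimpleGraph (Fin n) := SimpleGraph.fromRel fun i j => adj M i j = true

theorem adj_map_range (n : ℕ) (f : ℕ → ℕ → Bool) {i j : ℕ} (hi : i < n) (hj : j < n) :
    adj ((List.range n).map fun i => (List.range n).map fun j => f i j) i j = f i j := by
  simp [adj, hi, hj]

theorem adj_mk {n : ℕ} {f : ℕ → ℕ → Bool} {i j : ℕ} (hi : i < n) (hj : j < n) :
    adj (mk n f) i j = (!(Nat.beq i j) && (f i j || f j i)) := adj_map_range n _ hi hj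

theorem gr_mk_adj {n : ℕ} {f : ℕ → ℕ → Bool} {i j : Fin n} :
    (gr n (mk n f)).Adj i j ↔ i ≠ j ∧ (f i j = true ∨ f j i = true) := by
  rw [gr, SimpleGraph.fromRel_adj, adj_mk i.2 j.2, adj_mk j.2 i.2]
  simp only [Bool.and_eq_true, Bool.not_eq_true', Bool.or_eq_true, ← Bool.not_eq_true, Nat.beq_eq,
    ne_eq, Fin.ext_iff]
  tauto

theorem IsAdj.length {n : ℕ} {M : Mat} (h : IsAdj n M) : M.length = n := by
  obtain ⟨f, rfl⟩ := h
  simp [mk]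

theorem IsAdj.adj_iff {n : ℕ} {M : Mat} (h : IsAdj n M) {i j : Fin n} :
    (gr n M).Adj i j ↔ adj M i j = true := by
  obtain ⟨f, rfl⟩ := h
  rw [gr_mk_adj, adj_mk i.2 j.2]
  simp only [Bool.and_eq_true, Bool.not_eq_true', Bool.or_eq_true, ← Bool.not_eq_true, Nat.beq_eq,
    ne_eq, Fin.ext_iff]

theorem isAdj_mk (n : ℕ) (f : ℕ → ℕ → Bool) : IsAdj n (mk n f) := ⟨f, rfl⟩

/-- All pairs of numbers below `n`. -/
def pairs (n : ℕ) : List (ℕ × ℕ) :=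
  (List.range n).flatMap fun i => (List.range n).map fun j => (i, j)

theorem mem_pairs {n : ℕ} {x : ℕ × ℕ} : x ∈ pairs n ↔ x.1 < n ∧ x.2 < n := by
  obtain ⟨i, j⟩ := x
  simp [pairs]

/-! ### Bipartite matching by an auction -/

/-- Price of a column in an auction state, a list of pairs (price, owner plus one). -/
def price (s : List (ℕ × ℕ)) (j : ℕ) : ℕ := (s.getD j (0, 0)).1

/-- Owner of a column, plus one; zero if there is none. -/
def owner (s : List (ℕ × ℕ)) (j : ℕ) : ℕ := (s.getD j (0, 0)).2

/-- Row `x.1` owns no column, and `x.2` is a cheapest column for it, with price at most `n`. -/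
def bidOK (M : Mat) (s : List (ℕ × ℕ)) (x : ℕ × ℕ) : Bool :=
  adj M x.1 x.2 && Nat.ble (price s x.2) M.length &&
  ((List.range M.length).all fun j => !(Nat.beq (owner s j) (x.1 + 1))) &&
  (List.range M.length).all fun j => !(adj M x.1 j) || Nat.ble (price s x.2) (price s j)

/-- Row `x.1` takes the column `x.2` and increases its price. -/
def bid (n : ℕ) (s : List (ℕ × ℕ)) (x : ℕ × ℕ) : List (ℕ × ℕ) :=
  (List.range n).map fun k => cond (Nat.beq k x.2) (price s k + 1, x.1 + 1) (price s k, owner s k)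

/-- The possible bids. -/
def bids (M : Mat) (s : List (ℕ × ℕ)) : List (ℕ × ℕ) := (pairs M.length).filter fun x => bidOK M s x

/-- One step of the auction. -/
def auctionStep (M : Mat) (s : List (ℕ × ℕ)) : List (ℕ × ℕ) :=
  cond (bids M s).isEmpty s (bid M.length s ((bids M s).headD (0, 0)))

/-- The initial state of the auction. -/
def auctionInit (M : Mat) : List (ℕ × ℕ) := (List.range M.length).map fun _ => (0, 0)

/-- The final state of the auction. -/
def auction (M : Mat) : List (ℕ × ℕ) :=
  (auctionStep M)^[M.length * (M.length + 1) + 1] (auctionInit M)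

/-- The size of a maximum matching between rows and columns. -/
def nu (M : Mat) : ℕ :=
  ((List.range M.length).filter fun j => !(Nat.beq (owner (auction M) j) 0)).length

/-- The invariant of the auction. -/
structure AuctionInv (M : Mat) (s : List (ℕ × ℕ)) : Prop where
  len : s.length = M.length
  price_le : ∀ j < M.length, price s j ≤ M.length + 1
  owner_le : ∀ j < M.length, owner s j ≤ M.length
  owned : ∀ j < M.length, 0 < price s j → owner s j ≠ 0
  adj : ∀ j < M.length, ∀ i, owner s j = i + 1 → adj M i j = true
  inj : ∀ j < M.length, ∀ k < M.length, owner s j ≠ 0 → owner s j = owner s k → j = k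
  slack : ∀ j < M.length, ∀ k < M.length, ∀ i, owner s j = i + 1 → _root_.adj M i k = true →
    price s j ≤ price s k + 1

theorem getD_map_range {α : Type} (n : ℕ) (f : ℕ → α) (d : α) {i : ℕ} (hi : i < n) :
    ((List.range n).map f).getD i d = f i := by simp [hi]

theorem bidOK_iff {M : Mat} {s : List (ℕ × ℕ)} {x : ℕ × ℕ} : bidOK M s x = true ↔
    adj M x.1 x.2 = true ∧ price s x.2 ≤ M.length ∧ (∀ j < M.length, owner s j ≠ x.1 + 1) ∧
    ∀ j < M.length, adj M x.1 j = true → price s x.2 ≤ price s j := by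
  simp only [bidOK, Bool.and_eq_true, List.all_eq_true, List.mem_range, Bool.not_eq_true',
    ← Bool.not_eq_true, Nat.beq_eq, Nat.ble_eq, Bool.or_eq_true, ne_eq, and_assoc]
  simp only [← imp_iff_not_or]

theorem auctionInv_init (M : Mat) : AuctionInv M (auctionInit M) := by
  have hp : ∀ j, price (auctionInit M) j = 0 ∧ owner (auctionInit M) j = 0 := by
    intro j
    by_cases hj : j < M.length
    · rw [price, owner, auctionInit, getD_map_range _ _ _ hj]; simp
    · rw [price, owner, auctionInit, List.getD_eq_default _ _ (by simpa using hj)]; exact ⟨rfl, rfl⟩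
  exact ⟨by simp [auctionInit], by simp [hp], by simp [hp], by simp [hp], by simp [hp], by simp [hp],
    by simp [hp]⟩

theorem price_bid {n : ℕ} {s : List (ℕ × ℕ)} {x : ℕ × ℕ} {j : ℕ} (hj : j < n) :
    price (bid n s x) j = if j = x.2 then price s j + 1 else price s j := by
  rw [price, bid, getD_map_range _ _ _ hj]
  by_cases h : j = x.2
  · simp [h]
  · have : Nat.beq j x.2 = false := by rw [← Bool.not_eq_true, Nat.beq_eq]; exact h
    simp [h, this]

theorem owner_bid {n : ℕ} {s : List (ℕ × ℕ)} {x : ℕ × ℕ} {j : ℕ} (hj : j < n) :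
    owner (bid n s x) j = if j = x.2 then x.1 + 1 else owner s j := by
  rw [owner, bid, getD_map_range _ _ _ hj]
  by_cases h : j = x.2
  · simp [h]
  · have : Nat.beq j x.2 = false := by rw [← Bool.not_eq_true, Nat.beq_eq]; exact h
    simp [h, this]

/-- The bidder owns nothing, so ownership stays injective. It takes a cheapest column and raises the
price by one, which gives the slack of one for the new owner; for the other owners the slack
survives because prices only increase. -/
theorem AuctionInv.bid {M : Mat} {s : List (ℕ × ℕ)} (h : AuctionInv M s) {x : ℕ × ℕ}
    (hx1 : x.1 < M.length) (hx : bidOK M s x = true) : AuctionInv M (bid M.length s x) := by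
  obtain ⟨h1, h2, h3, h4⟩ := bidOK_iff.1 hx
  constructor
  · simp [_root_.bid]
  · intro j hj
    rw [price_bid hj]
    split_ifs with e
    · subst e; omega
    · exact h.price_le j hj
  · intro j hj
    rw [owner_bid hj]
    split_ifs with e
    · omega
    · exact h.owner_le j hj
  · intro j hj
    rw [owner_bid hj, price_bid hj]
    split_ifs with e
    · omega
    · exact h.owned j hj
  · intro j hj i
    rw [owner_bid hj]
    split_ifs with e
    · intro e'; subst e; rw [show i = x.1 by omega]; exact h1
    · exact h.adj j hj i
  · intro j hj k hk
    rw [owner_bid hj, owner_bid hk]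
    split_ifs with e e' e'
    · intros; omega
    · intro _ e2; exact absurd e2.symm (h3 k hk)
    · intro _ e2; exact absurd e2 (h3 j hj)
    · exact h.inj j hj k hk
  · intro j hj k hk i
    have hs := h.slack j hj k hk i
    rw [owner_bid hj, price_bid hj, price_bid hk]
    split_ifs with e e' e'
    · rw [e, e']; intros; omega
    · intro e2 e3
      have := h4 k hk (by rwa [show x.1 = i by omega])
      rw [e]; omega
    · intro e2 e3; have := hs e2 e3; omega
    · exact hs

theorem AuctionInv.step {M : Mat} {s : List (ℕ × ℕ)} (h : AuctionInv M s) :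
    AuctionInv M (auctionStep M s) := by
  rw [auctionStep]
  rcases hl : bids M s with _ | ⟨x, l⟩
  · exact h
  · have hx : x ∈ bids M s := by rw [hl]; exact List.mem_cons_self
    rw [bids, List.mem_filter, mem_pairs] at hx
    exact h.bid hx.1.1 hx.2

theorem auctionInv_iterate (M : Mat) (m : ℕ) : AuctionInv M ((auctionStep M)^[m] (auctionInit M)) := by
  induction m with
  | zero => exact auctionInv_init M
  | succ m ih => rw [Function.iterate_succ_apply']; exact ih.step

/-- Every bid raises the sum of the prices by one. Prices are at most `M.length + 1`, so more than
`M.length * (M.length + 1)` bids are impossible and the number of steps in `auction` is enough to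
get stuck. -/
theorem auction_potential (M : Mat) (m : ℕ) :
    bids M ((auctionStep M)^[m] (auctionInit M)) = [] ∨
      m ≤ ∑ j ∈ Finset.range M.length, price ((auctionStep M)^[m] (auctionInit M)) j := by
  induction m with
  | zero => right; simp
  | succ m ih =>
    rw [Function.iterate_succ_apply']
    set s := (auctionStep M)^[m] (auctionInit M)
    rcases hl : bids M s with _ | ⟨x, l⟩
    · left
      rw [auctionStep, hl]
      exact hl
    · right
      have ih : m ≤ _ := ih.resolve_left (by rw [hl]; simp)
      have hx : x ∈ bids M s := by rw [hl]; exact List.mem_cons_self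
      rw [bids, List.mem_filter, mem_pairs] at hx
      have e : auctionStep M s = bid M.length s x := by rw [auctionStep, hl]; rfl
      have e2 : ∑ j ∈ Finset.range M.length, price (bid M.length s x) j =
          ∑ j ∈ Finset.range M.length, (price s j + if j = x.2 then 1 else 0) := by
        refine Finset.sum_congr rfl fun j hj => ?_
        rw [price_bid (Finset.mem_range.1 hj)]
        split_ifs <;> simp
      rw [e, e2, Finset.sum_add_distrib, Finset.sum_ite_eq', if_pos (Finset.mem_range.2 hx.1.2)]
      omega

theorem auction_stuck (M : Mat) : bids M (auction M) = [] := by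
  refine (auction_potential M (M.length * (M.length + 1) + 1)).resolve_right fun h => ?_
  have : ∑ j ∈ Finset.range M.length, price (auction M) j ≤
      ∑ j ∈ Finset.range M.length, (M.length + 1) :=
    Finset.sum_le_sum fun j hj => (auctionInv_iterate M _).price_le j (Finset.mem_range.1 hj)
  rw [Finset.sum_const, Finset.card_range, smul_eq_mul] at this
  rw [auction] at this
  omega

theorem auction_unassigned {M : Mat} {i : ℕ} (hi : i < M.length)
    (hu : ∀ j < M.length, owner (auction M) j ≠ i + 1) {j : ℕ} (hj : j < M.length)
    (hij : adj M i j = true) : M.length < price (auction M) j := by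
  by_contra hlt
  have hne : ((Finset.range M.length).filter fun j => adj M i j = true).Nonempty :=
    ⟨j, by simp [hj, hij]⟩
  obtain ⟨k, hk, hmin⟩ := Finset.exists_min_image _ (price (auction M)) hne
  simp only [Finset.mem_filter, Finset.mem_range] at hk hmin
  have : (i, k) ∈ bids M (auction M) := by
    rw [bids, List.mem_filter, mem_pairs]
    refine ⟨⟨hi, hk.1⟩, bidOK_iff.2 ⟨hk.2, ?_, hu, fun l hl h => hmin l ⟨hl, h⟩⟩⟩
    have := hmin j ⟨hj, hij⟩
    simp only; omega
  rw [auction_stuck] at this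
  simp at this

theorem nu_eq_card (M : Mat) :
    nu M = ((Finset.range M.length).filter fun j => owner (auction M) j ≠ 0).card := by
  rw [nu, ← List.toFinset_card_of_nodup (List.nodup_range.filter _)]
  congr 1
  ext j
  simp only [List.mem_toFinset, List.mem_filter, List.mem_range, Finset.mem_filter, Finset.mem_range,
    Bool.not_eq_true', ← Bool.not_eq_true, Nat.beq_eq, ne_eq]

/-- A cover of the rows and columns of size `nu M`. -/
theorem exists_cover_nu (M : Mat) : ∃ A B : Finset ℕ, A.card + B.card ≤ nu M ∧
    ∀ i < M.length, ∀ j < M.length, adj M i j = true → i ∈ A ∨ j ∈ B := by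
  have inv : AuctionInv M (auction M) := auctionInv_iterate M _
  set s := auction M
  -- There are `M.length + 1` levels and only `M.length` columns, so some level is the price of no
  -- column. The cover is cut at this gap: rows owning a column below it, and columns above it.
  obtain ⟨l, hl, hlp⟩ : ∃ l ∈ Finset.range (M.length + 1), l ∉ (Finset.range M.length).image (price s) := by
    by_contra! h
    have := Finset.card_le_card (show Finset.range (M.length + 1) ⊆ _ from h)
    have := this.trans Finset.card_image_le
    simp at this
  simp only [Finset.mem_image, Finset.mem_range, not_exists, not_and] at hl hlp
  refine ⟨((Finset.range M.length).filter fun j => owner s j ≠ 0 ∧ price s j ≤ l).image (fun j => owner s j - 1),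
    (Finset.range M.length).filter fun j => l < price s j, ?_, ?_⟩
  · rw [nu_eq_card]
    calc _ ≤ ((Finset.range M.length).filter fun j => owner s j ≠ 0 ∧ price s j ≤ l).card +
          ((Finset.range M.length).filter fun j => l < price s j).card :=
        Nat.add_le_add_right Finset.card_image_le _
      _ = _ := (Finset.card_union_of_disjoint (by
          rw [Finset.disjoint_filter]; intros; omega)).symm
      _ ≤ _ := by
        refine Finset.card_le_card fun j hj => ?_
        simp only [Finset.mem_union, Finset.mem_filter, Finset.mem_range] at hj ⊢
        rcases hj with hj | hj
        · exact ⟨hj.1, hj.2.1⟩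
        · exact ⟨hj.1, inv.owned j hj.1 (by omega)⟩
  · intro i hi j hj hij
    by_cases hu : ∀ k < M.length, owner s k ≠ i + 1
    · right
      have := auction_unassigned hi hu hj hij
      simp only [Finset.mem_filter, Finset.mem_range]
      exact ⟨hj, by change _ < price s j at this; omega⟩
    · push Not at hu
      obtain ⟨k, hk, hok⟩ := hu
      by_cases hkl : price s k ≤ l
      · left
        refine Finset.mem_image.2 ⟨k, ?_, by omega⟩
        simp only [Finset.mem_filter, Finset.mem_range]
        exact ⟨hk, by omega, hkl⟩
      · right
        -- The owned column lies above the gap, so by the slack of one the price of `j` is at least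
        -- `l`; it is not `l`, hence it exceeds `l`.
        have h1 := inv.slack k hk j hj i hok hij
        have h2 := hlp j hj
        simp only [Finset.mem_filter, Finset.mem_range]
        exact ⟨hj, by omega⟩

/-- The matching found by the auction bounds every fractional cover. -/
theorem nu_le_of_fractional (M : Mat) (θ : ℕ → ℝ) (h0 : ∀ i, 0 ≤ θ i)
    (h1 : ∀ i j, adj M i j = true → 1 ≤ θ i + θ j) (hM : ∀ i j, adj M i j = true → i < M.length) :
    (nu M : ℝ) ≤ 2 * ∑ i ∈ Finset.range M.length, θ i := by
  have inv : AuctionInv M (auction M) := auctionInv_iterate M _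
  rw [nu_eq_card]
  set s := auction M
  set O := (Finset.range M.length).filter fun j => owner s j ≠ 0
  have hO : ∀ j ∈ O, j < M.length ∧ owner s j ≠ 0 := fun j hj => by simpa [O] using hj
  have hadj : ∀ j ∈ O, adj M (owner s j - 1) j = true := fun j hj =>
    inv.adj j (hO j hj).1 _ (by have := (hO j hj).2; omega)
  calc (O.card : ℝ) = ∑ j ∈ O, (1 : ℝ) := by simp
    _ ≤ ∑ j ∈ O, (θ (owner s j - 1) + θ j) := Finset.sum_le_sum fun j hj => h1 _ _ (hadj j hj)
    _ = ∑ i ∈ O.image (fun j => owner s j - 1), θ i + ∑ j ∈ O, θ j := by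
      rw [Finset.sum_add_distrib, Finset.sum_image]
      intro j hj k hk e
      have h2 := hO j hj
      have h3 := hO k hk
      exact inv.inj j h2.1 k h3.1 h2.2 (by simp only at e; omega)
    _ ≤ ∑ i ∈ Finset.range M.length, θ i + ∑ j ∈ Finset.range M.length, θ j := by
      refine add_le_add (Finset.sum_le_sum_of_subset_of_nonneg ?_ fun i _ _ => h0 i)
        (Finset.sum_le_sum_of_subset_of_nonneg (Finset.filter_subset _ _) fun i _ _ => h0 i)
      intro i hi
      obtain ⟨j, hj, rfl⟩ := Finset.mem_image.1 hi
      exact Finset.mem_range.2 (hM _ _ (hadj j hj))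
    _ = _ := by ring

/-! ### Half-integrality of the linear program -/

section lam
variable {V : Type} [Fintype V]

/-- Half-integral covers, multiplied by two. -/
def IsDoubleCover (G : SimpleGraph V) (g : V → ℕ) : Prop := ∀ u v, G.Adj u v → 2 ≤ g u + g v

/-- Twice the optimal value of the linear program. -/
noncomputable def lam (G : SimpleGraph V) : ℕ := sInf {s | ∃ g, IsDoubleCover G g ∧ s = ∑ v, g v}

theorem lam_le {G : SimpleGraph V} {g : V → ℕ} (h : IsDoubleCover G g) : lam G ≤ ∑ v, g v :=
  Nat.sInf_le ⟨g, h, rfl⟩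

theorem exists_lam (G : SimpleGraph V) : ∃ g, IsDoubleCover G g ∧ lam G = ∑ v, g v :=
  Nat.sInf_mem (s := {s | ∃ g, IsDoubleCover G g ∧ s = ∑ v, g v}) ⟨_, fun _ => 1, fun _ _ _ => le_rfl, rfl⟩

end lam

/-- Every vertex occurs once as a row and once as a column. Counting how many of its two copies lie
in the König cover gives a doubled half-integral cover, while the matching bounds all fractional
covers from below. Both bounds meet at `nu M`. -/
theorem IsAdj.nu_spec {n : ℕ} {M : Mat} (h : IsAdj n M) :
    (∃ g, IsDoubleCover (gr n M) g ∧ ∑ v, g v ≤ nu M) ∧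
    ∀ θ : Fin n → ℝ, IsFractionalCover (gr n M) θ → (nu M : ℝ) ≤ 2 * ∑ v, θ v := by
  have hn := h.length
  constructor
  · obtain ⟨A, B, hc, hcov⟩ := exists_cover_nu M
    refine ⟨fun v => (if (v : ℕ) ∈ A then 1 else 0) + if (v : ℕ) ∈ B then 1 else 0, ?_, ?_⟩
    · intro u v huv
      have h1 := hcov u (hn ▸ u.2) v (hn ▸ v.2) (h.adj_iff.1 huv)
      have h2 := hcov v (hn ▸ v.2) u (hn ▸ u.2) (h.adj_iff.1 huv.symm)
      simp only
      rcases h1 with h1 | h1 <;> rcases h2 with h2 | h2 <;> simp only [h1, h2, if_true] <;> omega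
    · have key : ∀ A : Finset ℕ, (∑ v : Fin n, if (v : ℕ) ∈ A then 1 else 0) ≤ A.card := by
        intro A
        rw [Fin.sum_univ_eq_sum_range (fun i => if i ∈ A then 1 else 0), Finset.sum_ite_mem,
          Finset.sum_const, smul_eq_mul, mul_one]
        exact Finset.card_le_card Finset.inter_subset_right
      rw [Finset.sum_add_distrib]
      exact (add_le_add (key A) (key B)).trans hc
  · intro θ hθ
    obtain ⟨f, hf⟩ := id h
    have hlt : ∀ i j, adj M i j = true → i < n ∧ j < n := by
      intro i j hij
      by_contra hcon
      have : adj M i j = false := by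
        rw [hf, adj, mk]
        by_cases hi : i < n
        · rw [getD_map_range _ _ _ hi, List.getD_eq_default _ _ (by simp; omega)]
        · rw [List.getD_eq_default (n := i) _ _ (by simpa using hi)]; rfl
      simp [this] at hij
    have := nu_le_of_fractional M (fun i => if hi : i < n then θ ⟨i, hi⟩ else 0) (fun i => by
      by_cases hi : i < n
      · simpa [hi] using (hθ.1 ⟨i, hi⟩).1
      · simp [hi]) (fun i j hij => by
        obtain ⟨hi, hj⟩ := hlt i j hij
        simpa [hi, hj] using hθ.2 ⟨i, hi⟩ ⟨j, hj⟩ (h.adj_iff.2 hij))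
        (fun i j hij => hn ▸ (hlt i j hij).1)
    rw [hn] at this
    rw [← Fin.sum_univ_eq_sum_range (fun i => if hi : i < n then θ ⟨i, hi⟩ else 0)] at this
    simpa using this

theorem two_le_of_isDoubleCover {V : Type} [Fintype V] {G : SimpleGraph V} {g : V → ℕ} (h : IsDoubleCover G g) :
    IsFractionalCover G fun v => ((min (g v) 2 : ℕ) : ℝ) / 2 := by
  constructor
  · intro v
    have : ((min (g v) 2 : ℕ) : ℝ) ≤ 2 := by exact_mod_cast min_le_right _ _
    constructor
    · positivity
    · linarith
  · intro u v huv
    have h1 := h u v huv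
    have h2 : 2 ≤ min (g u) 2 + min (g v) 2 := by omega
    have : (2 : ℝ) ≤ ((min (g u) 2 : ℕ) : ℝ) + ((min (g v) 2 : ℕ) : ℝ) := by exact_mod_cast h2
    linarith

theorem sum_min_two_le {V : Type} [Fintype V] (g : V → ℕ) :
    ∑ v, ((min (g v) 2 : ℕ) : ℝ) / 2 ≤ ((∑ v, g v : ℕ) : ℝ) / 2 := by
  rw [← Finset.sum_div]
  have : ∑ v, ((min (g v) 2 : ℕ) : ℝ) ≤ ((∑ v, g v : ℕ) : ℝ) := by
    rw [← Nat.cast_sum]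
    exact_mod_cast Finset.sum_le_sum fun v _ => min_le_left _ _
  linarith

theorem IsAdj.nu_eq_lam {n : ℕ} {M : Mat} (h : IsAdj n M) : nu M = lam (gr n M) := by
  obtain ⟨⟨g, hg, hgs⟩, hθ⟩ := h.nu_spec
  refine le_antisymm ?_ ((lam_le hg).trans hgs)
  obtain ⟨g', hg', e⟩ := exists_lam (gr n M)
  have h1 := hθ _ (two_le_of_isDoubleCover hg')
  have h2 := sum_min_two_le g'
  rw [← e] at h2
  exact_mod_cast (by linarith : (nu M : ℝ) ≤ lam (gr n M))

theorem IsAdj.lpOpt_eq {n : ℕ} {M : Mat} (h : IsAdj n M) : lpOpt (gr n M) = (lam (gr n M) : ℝ) / 2 := by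
  have e := h.nu_eq_lam
  obtain ⟨g, hg, hs⟩ := exists_lam (gr n M)
  rw [lpOpt]
  have hb : BddBelow {s : ℝ | ∃ θ : Fin n → ℝ, IsFractionalCover (gr n M) θ ∧ s = ∑ v, θ v} := by
    refine ⟨0, ?_⟩
    rintro s ⟨θ, hθ, rfl⟩
    exact Finset.sum_nonneg fun v _ => (hθ.1 v).1
  refine le_antisymm ?_ ?_
  · refine (csInf_le hb ⟨_, two_le_of_isDoubleCover hg, rfl⟩).trans ?_
    rw [hs]; exact sum_min_two_le g
  · refine le_csInf ⟨_, _, two_le_of_isDoubleCover hg, rfl⟩ ?_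
    rintro s ⟨θ, hθ, rfl⟩
    have := h.nu_spec.2 θ hθ
    rw [e] at this
    linarith

/-! ### The value of the linear program in polynomial time -/

section PT
variable {γ : Type} [Enc γ]

@[fun_prop]
theorem PT.adj {M : γ → Mat} {i j : γ → ℕ} (hM : PT M) (hi : PT i) (hj : PT j) :
    PT (fun c => adj (M c) (i c) (j c)) := by
  unfold _root_.adj; fun_prop

@[fun_prop]
theorem PT.mk {n : γ → ℕ} {f : γ → ℕ → ℕ → Bool} (hn : PT n)
    (hf : PT (fun x : γ × ℕ × ℕ => f x.1 x.2.1 x.2.2)) : PT (fun c => mk (n c) (f c)) := by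
  have h1 : PT (fun x : (γ × ℕ) × ℕ => f x.1.1 x.1.2 x.2) :=
    PT.comp' (f := fun x : (γ × ℕ) × ℕ => (x.1.1, x.1.2, x.2)) hf (by fun_prop)
  have h2 : PT (fun x : (γ × ℕ) × ℕ => f x.1.1 x.2 x.1.2) :=
    PT.comp' (f := fun x : (γ × ℕ) × ℕ => (x.1.1, x.2, x.1.2)) hf (by fun_prop)
  unfold _root_.mk
  fun_prop

@[fun_prop]
theorem PT.pairs {n : γ → ℕ} (hn : PT n) : PT (fun c => pairs (n c)) := by
  unfold _root_.pairs; fun_prop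

@[fun_prop]
theorem PT.price {s : γ → List (ℕ × ℕ)} {j : γ → ℕ} (hs : PT s) (hj : PT j) :
    PT (fun c => price (s c) (j c)) := by
  unfold _root_.price; fun_prop

@[fun_prop]
theorem PT.owner {s : γ → List (ℕ × ℕ)} {j : γ → ℕ} (hs : PT s) (hj : PT j) :
    PT (fun c => owner (s c) (j c)) := by
  unfold _root_.owner; fun_prop

@[fun_prop]
theorem PT.bids {M : γ → Mat} {s : γ → List (ℕ × ℕ)} (hM : PT M) (hs : PT s) :
    PT (fun c => bids (M c) (s c)) := by
  unfold _root_.bids bidOK; fun_prop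

@[fun_prop]
theorem PT.bid {n : γ → ℕ} {s : γ → List (ℕ × ℕ)} {x : γ → ℕ × ℕ} (hn : PT n) (hs : PT s) (hx : PT x) :
    PT (fun c => bid (n c) (s c) (x c)) := by
  unfold _root_.bid; fun_prop

theorem PT.auctionStep : PT (fun x : Mat × List (ℕ × ℕ) => auctionStep x.1 x.2) := by
  unfold _root_.auctionStep; fun_prop

theorem AuctionInv.esize_le {M : Mat} {s : List (ℕ × ℕ)} (h : AuctionInv M s) :
    esize s ≤ M.length * (4 * M.length + 7) + 1 := by
  have := esize_flatMap_le (fun a : ℕ × ℕ => [a]) s (4 * M.length + 7) fun a ha => by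
    obtain ⟨j, hj, rfl⟩ := List.getElem_of_mem ha
    have h1 := h.price_le j (h.len ▸ hj)
    have h2 := h.owner_le j (h.len ▸ hj)
    rw [price, List.getD_eq_getElem _ _ hj] at h1
    rw [owner, List.getD_eq_getElem _ _ hj] at h2
    rw [esize_cons, esize_nil, esize_prod, esize_nat, esize_nat]
    omega
  rw [← List.map_eq_flatMap, List.map_id'] at this
  rwa [h.len] at this

theorem PT.auction : PT auction := by
  refine PT.natFold (n := fun M : Mat => M.length * (M.length + 1) + 1) (s := auctionInit)
    (f := _root_.auctionStep) (by fun_prop) (by unfold auctionInit; fun_prop) PT.auctionStep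
    (Polynomial.X * (4 * Polynomial.X + 7) + 1) fun M m _ => ?_
  refine (auctionInv_iterate M m).esize_le.trans ?_
  have := length_le_esize M
  simp only [Polynomial.eval_add, Polynomial.eval_mul, Polynomial.eval_ofNat, Polynomial.eval_one, Polynomial.eval_X]
  exact Nat.add_le_add_right (Nat.mul_le_mul this (by omega)) _

@[fun_prop]
theorem PT.nu {M : γ → Mat} (hM : PT M) : PT (fun c => nu (M c)) := by
  have h := PT.auction
  have : PT _root_.nu := by unfold _root_.nu; fun_prop
  exact PT.comp' this hM

end PT

/-! ### Surplus, deletion and folding -/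

section Surplus
variable {V : Type} [Fintype V] [DecidableEq V] {G H : SimpleGraph V}

theorem mem_nbhd {S : Finset V} {w : V} : w ∈ nbhd G S ↔ w ∉ S ∧ ∃ v ∈ S, G.Adj v w := by
  simp [nbhd]

theorem mem_nbhd_singleton {v w : V} : w ∈ nbhd G {v} ↔ G.Adj v w := by
  rw [mem_nbhd]
  simp only [Finset.mem_singleton, exists_eq_left, and_iff_right_iff_imp]
  exact fun h => h.ne'

theorem notMem_nbhd {S : Finset V} {v : V} (h : v ∈ S) : v ∉ nbhd G S := fun h2 => (mem_nbhd.1 h2).1 h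

/-- Independence, as a statement about pairs. -/
def Ind (G : SimpleGraph V) (I : Finset V) : Prop := ∀ u ∈ I, ∀ v ∈ I, ¬ G.Adj u v

theorem ind_iff {I : Finset V} : Ind G I ↔ G.IsIndepSet (I : Set V) := by
  constructor
  · intro h u hu v hv _; exact h u hu v hv
  · intro h u hu v hv huv; exact h hu hv huv.ne huv

theorem Ind.mono {I J : Finset V} (h : Ind G I) (hJ : J ⊆ I) : Ind G J :=
  fun u hu v hv => h u (hJ hu) v (hJ hv)

theorem ind_singleton (v : V) : Ind G {v} := by
  intro a ha b hb; rw [Finset.mem_singleton] at ha hb; rw [ha, hb]; exact G.loopless.irrefl v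

theorem Ind.mem_nbhd {I : Finset V} (h : Ind G I) {v w : V} (hv : v ∈ I) (hvw : G.Adj v w) :
    w ∈ nbhd G I :=
  _root_.mem_nbhd.2 ⟨fun hw => h v hv w hw hvw, v, hv, hvw⟩

theorem Ind.nbhd_mono {I J : Finset V} (h : Ind G I) (hJ : J ⊆ I) : nbhd G J ⊆ nbhd G I := by
  intro w hw
  obtain ⟨_, v, hv, hvw⟩ := _root_.mem_nbhd.1 hw
  exact h.mem_nbhd (hJ hv) hvw

theorem nbhd_disjoint (S : Finset V) : Disjoint S (nbhd G S) :=
  Finset.disjoint_left.2 fun _ h1 h2 => (mem_nbhd.1 h2).1 h1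

/-- The graph in which the vertices of `S` are made isolated. -/
def delG (G : SimpleGraph V) (S : Finset V) : SimpleGraph V where
  Adj a b := G.Adj a b ∧ a ∉ S ∧ b ∉ S
  symm := ⟨fun _ _ h => ⟨h.1.symm, h.2.2, h.2.1⟩⟩
  loopless := ⟨fun _ h => h.1.ne rfl⟩

theorem delG_adj {S : Finset V} {a b : V} : (delG G S).Adj a b ↔ G.Adj a b ∧ a ∉ S ∧ b ∉ S := Iff.rfl

theorem card_eq_sum_ite (S : Finset V) : S.card = ∑ v, if v ∈ S then 1 else 0 := by simp

/-- Doubled weights: 0 on I, 2 on N(I), 1 elsewhere. -/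
theorem lam_le_surplus {I : Finset V} (hI : Ind G I) : (lam G : ℤ) ≤ Fintype.card V + surplus G I := by
  have h : IsDoubleCover G fun v => if v ∈ I then 0 else if v ∈ nbhd G I then 2 else 1 := by
    intro u v huv
    have h1 := hI u
    have h2 := fun hu => hI.mem_nbhd (v := u) hu huv
    have h3 := fun hv => hI.mem_nbhd (v := v) hv huv.symm
    by_cases hu : u ∈ I
    · have h4 := h2 hu
      have h5 := (mem_nbhd.1 h4).1
      simp [hu, h4, h5]
    · by_cases hv : v ∈ I
      · have h4 := h3 hv
        have h5 := (mem_nbhd.1 h4).1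
        simp [hv, h4, h5]
      · simp only [hu, hv, if_false]
        split_ifs <;> omega
  have h1 := lam_le h
  have h2 : (∑ v, if v ∈ I then 0 else if v ∈ nbhd G I then 2 else 1) + I.card =
      Fintype.card V + (nbhd G I).card := by
    rw [card_eq_sum_ite I, card_eq_sum_ite (nbhd G I), ← Finset.card_univ,
      Finset.card_eq_sum_ones Finset.univ, ← Finset.sum_add_distrib, ← Finset.sum_add_distrib]
    refine Finset.sum_congr rfl fun v _ => ?_
    have := @mem_nbhd _ _ _ G I v
    split_ifs <;> tauto
  rw [surplus]
  omega

/-- The zero set I of an optimal doubled cover is independent; vertices of N(I) carry at least 2 and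
all remaining ones at least 1. With `lam_le_surplus`, twice the LP optimum is |V| plus the minimum
surplus. -/
theorem exists_surplus_le_lam (G : SimpleGraph V) :
    ∃ I, Ind G I ∧ (Fintype.card V : ℤ) + surplus G I ≤ lam G := by
  obtain ⟨g, hg, hs⟩ := exists_lam G
  refine ⟨Finset.univ.filter fun v => g v = 0, ?_, ?_⟩
  · intro u hu v hv huv
    have := hg u v huv
    simp only [Finset.mem_filter, Finset.mem_univ, true_and] at hu hv
    omega
  · set I := Finset.univ.filter fun v => g v = 0 with hI
    have h2 : Fintype.card V + (nbhd G I).card ≤ (∑ v, g v) + I.card := by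
      rw [card_eq_sum_ite I, card_eq_sum_ite (nbhd G I), ← Finset.card_univ,
        Finset.card_eq_sum_ones Finset.univ, ← Finset.sum_add_distrib, ← Finset.sum_add_distrib]
      refine Finset.sum_le_sum fun v _ => ?_
      by_cases hv : v ∈ nbhd G I
      · obtain ⟨h3, u, hu, huv⟩ := mem_nbhd.1 hv
        have := hg u v huv
        rw [hI, Finset.mem_filter] at hu
        rw [if_pos hv, if_neg h3]
        omega
      · by_cases h3 : v ∈ I
        · rw [if_neg hv, if_pos h3]; omega
        · rw [if_neg hv, if_neg h3]
          have : g v ≠ 0 := by simpa [hI] using h3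
          omega
    rw [surplus]
    omega

/-- The minimum surplus of the independent sets that contain `J`. -/
noncomputable def sig (G : SimpleGraph V) (J : Finset V) : ℤ :=
  lam (delG G (J ∪ nbhd G J)) + 2 * (nbhd G J).card - Fintype.card V

/-- In `delG` the vertices of J ∪ N(J) remain as isolated vertices, so I ∪ N(J) is independent
there. Compared with I in G, it gains |N(J)| members and loses at least |N(J)| neighbors; this
explains the term 2|N(J)| in `sig`. -/
theorem sig_le {I J : Finset V} (hI : Ind G I) (hJ : J ⊆ I) : sig G J ≤ surplus G I := by
  have hN := hI.nbhd_mono hJ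
  have h1 : Ind (delG G (J ∪ nbhd G J)) (I ∪ nbhd G J) := by
    intro u hu v hv huv
    obtain ⟨h1, h2, h3⟩ := huv
    simp only [Finset.mem_union] at hu hv h2 h3
    exact hI u (by tauto) v (by tauto) h1
  have h2 := lam_le_surplus h1
  have h3 : nbhd (delG G (J ∪ nbhd G J)) (I ∪ nbhd G J) ⊆ nbhd G I \ nbhd G J := by
    intro w hw
    obtain ⟨h4, v, hv, h5, h6, h7⟩ := mem_nbhd.1 hw
    simp only [Finset.mem_union, Finset.mem_sdiff] at h4 hv h6 h7 ⊢
    exact ⟨hI.mem_nbhd (by tauto) h5, by tauto⟩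
  have h4 := Finset.card_le_card h3
  have h5 := Finset.card_sdiff_add_card_eq_card hN
  have h6 : (I ∪ nbhd G J).card = I.card + (nbhd G J).card :=
    Finset.card_union_of_disjoint ((nbhd_disjoint I).mono_right hN)
  rw [surplus] at h2 ⊢
  rw [sig]
  omega

theorem exists_sig {J : Finset V} (hJ : Ind G J) : ∃ I, Ind G I ∧ J ⊆ I ∧ surplus G I = sig G J := by
  obtain ⟨I', hI', hs⟩ := exists_surplus_le_lam (delG G (J ∪ nbhd G J))
  have hI : Ind G (I' \ nbhd G J ∪ J) := by
    intro u hu v hv huv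
    have h1 := hI' u
    have h2 : u ∈ J → v ∈ nbhd G J := fun h => hJ.mem_nbhd h huv
    have h3 : v ∈ J → u ∈ nbhd G J := fun h => hJ.mem_nbhd h huv.symm
    have h4 := @notMem_nbhd _ _ _ G J u
    have h5 := @notMem_nbhd _ _ _ G J v
    simp only [Finset.mem_union, Finset.mem_sdiff] at hu hv
    have h6 := h1 (by tauto) v (by tauto)
    rw [delG_adj] at h6
    simp only [Finset.mem_union] at h6
    tauto
  refine ⟨_, hI, Finset.subset_union_right, le_antisymm ?_ (sig_le hI Finset.subset_union_right)⟩
  have h1 : nbhd G (I' \ nbhd G J ∪ J) ⊆ nbhd (delG G (J ∪ nbhd G J)) I' ∪ nbhd G J := by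
    intro w hw
    obtain ⟨h1, v, hv, hvw⟩ := mem_nbhd.1 hw
    rw [Finset.mem_union]
    by_cases h2 : w ∈ nbhd G J
    · exact Or.inr h2
    · left
      have h3 : v ∉ J := fun h => h2 (hJ.mem_nbhd h hvw)
      simp only [Finset.mem_union, Finset.mem_sdiff] at h1 hv
      refine mem_nbhd.2 ⟨by tauto, v, by tauto, hvw, ?_, ?_⟩
      · rw [Finset.mem_union]; tauto
      · rw [Finset.mem_union]; tauto
  have h2 := (Finset.card_le_card h1).trans (Finset.card_union_le _ _)
  have h3 : I'.card ≤ (I' \ nbhd G J ∪ J).card + (nbhd G J).card := by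
    rw [← Finset.card_union_of_disjoint]
    · refine Finset.card_le_card fun v hv => ?_
      simp only [Finset.mem_union, Finset.mem_sdiff]
      tauto
    · rw [Finset.disjoint_union_left]
      exact ⟨Finset.sdiff_disjoint, nbhd_disjoint J⟩
  rw [surplus] at hs ⊢
  rw [sig]
  omega

theorem sig_mono {I J : Finset V} (hI : Ind G I) (hJ : J ⊆ I) : sig G J ≤ sig G I := by
  obtain ⟨I', h1, h2, h3⟩ := exists_sig hI
  rw [← h3]
  exact sig_le h1 (hJ.trans h2)

/-- Every non-empty independent set has surplus at least two. -/
def Expanding (G : SimpleGraph V) : Prop := ∀ I, Ind G I → I.Nonempty → 2 ≤ surplus G I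

/-- A non-empty independent set of globally minimal surplus is critical, so a surplus below two
would trigger P1 or P2. -/
theorem Simplified.expanding (h : Simplified G) : Expanding G := by
  classical
  by_contra hcon
  rw [Expanding] at hcon
  push Not at hcon
  obtain ⟨I₀, hI₀, hn₀, hs₀⟩ := hcon
  obtain ⟨I, hI, hmin⟩ := Finset.exists_min_image
    (Finset.univ.filter fun I : Finset V => Ind G I ∧ I.Nonempty) (surplus G) ⟨I₀, by simp [hI₀, hn₀]⟩
  simp only [Finset.mem_filter, Finset.mem_univ, true_and] at hI hmin
  have hc : IsCriticalSet G I := ⟨hI.2, ind_iff.1 hI.1, fun J hJ hJn => hmin J ⟨hI.1.mono hJ, hJn⟩⟩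
  have h1 := hmin I₀ ⟨hI₀, hn₀⟩
  by_cases h2 : surplus G I ≤ 0
  · exact h.1 ⟨I, hc, h2⟩
  · exact h.2.1 ⟨I, hc, by omega⟩

theorem Expanding.lam_eq (h : Expanding G) : lam G = Fintype.card V := by
  apply le_antisymm
  · have := lam_le (G := G) (g := fun _ => 1) fun _ _ _ => le_rfl
    simpa using this
  · obtain ⟨I, hI, hs⟩ := exists_surplus_le_lam G
    rcases I.eq_empty_or_nonempty with rfl | hn
    · have : nbhd G ∅ = ∅ := by ext w; simp [mem_nbhd]
      rw [surplus, this] at hs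
      simp at hs; omega
    · have := h I hI hn
      omega

/-- Let I have minimum surplus after the deletion. If I ⊆ U, its surplus is at least -|U|. Otherwise
I \ U has surplus at least 2 in G, and restoring U changes the surplus by at most 2|U|. Twice the
drop of μ is therefore at least |U| or at least 2. -/
theorem Expanding.le_lam_delG (h : Expanding G) (U : Finset V) :
    (Fintype.card V : ℤ) - U.card ≤ lam (delG G U) ∨ (Fintype.card V : ℤ) + 2 - 2 * U.card ≤ lam (delG G U) := by
  obtain ⟨I, hI, hs⟩ := exists_surplus_le_lam (delG G U)
  have h1 : Ind G (I \ U) := by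
    intro u hu v hv huv
    rw [Finset.mem_sdiff] at hu hv
    exact hI u hu.1 v hv.1 ⟨huv, hu.2, hv.2⟩
  have h2 : I.card ≤ (I \ U).card + U.card := by
    rw [← Finset.card_union_of_disjoint Finset.sdiff_disjoint]
    refine Finset.card_le_card fun v hv => ?_
    simp only [Finset.mem_union, Finset.mem_sdiff]
    tauto
  have h3 : nbhd G (I \ U) ⊆ nbhd (delG G U) I ∪ U := by
    intro w hw
    obtain ⟨h3, v, hv, hvw⟩ := mem_nbhd.1 hw
    rw [Finset.mem_sdiff] at h3 hv
    rw [Finset.mem_union]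
    by_cases hw : w ∈ U
    · exact Or.inr hw
    · exact Or.inl (mem_nbhd.2 ⟨by tauto, v, hv.1, hvw, hv.2, hw⟩)
  have h4 := (Finset.card_le_card h3).trans (Finset.card_union_le _ _)
  rw [surplus] at hs
  rcases (I \ U).eq_empty_or_nonempty with he | hn
  · left
    rw [he] at h2
    simp at h2
    omega
  · right
    have := h _ h1 hn
    rw [surplus] at this
    omega

/-! ### Covers -/

/-- Vertex covers, as finite sets. -/
def Cov (G : SimpleGraph V) (C : Finset V) : Prop := ∀ u v, G.Adj u v → u ∈ C ∨ v ∈ C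

theorem feasible_iff {k : ℤ} : Feasible G k ↔ ∃ C, Cov G C ∧ (C.card : ℤ) ≤ k := by
  constructor
  · rintro ⟨C, hC, hk⟩
    exact ⟨C, fun u v huv => by simpa using hC huv, hk⟩
  · rintro ⟨C, hC, hk⟩
    exact ⟨C, fun u v huv => by simpa using hC u v huv, hk⟩

theorem Cov.swap {C I : Finset V} (hC : Cov G C) (hI : Ind G I)
    (h : (nbhd G I \ C).card ≤ (I ∩ C).card) :
    ∃ C', Cov G C' ∧ C'.card ≤ C.card ∧ nbhd G I ⊆ C' ∧ Disjoint I C' := by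
  refine ⟨C \ I ∪ nbhd G I, ?_, ?_, Finset.subset_union_right, ?_⟩
  · intro u v huv
    have h1 := hC u v huv
    have h2 : u ∈ I → _ := fun hu => hI.mem_nbhd hu huv
    have h3 : v ∈ I → _ := fun hv => hI.mem_nbhd hv huv.symm
    simp only [Finset.mem_union, Finset.mem_sdiff]
    tauto
  · have h1 : C \ I ∪ nbhd G I ⊆ C \ I ∪ nbhd G I \ C := by
      intro v
      have := @notMem_nbhd _ _ _ G I v
      simp only [Finset.mem_union, Finset.mem_sdiff]
      tauto
    have h2 := (Finset.card_le_card h1).trans (Finset.card_union_le _ _)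
    have h3 := Finset.card_sdiff_add_card_inter C I
    rw [Finset.inter_comm] at h3
    omega
  · rw [Finset.disjoint_union_right]
    exact ⟨Finset.disjoint_sdiff, nbhd_disjoint I⟩

/-- Since C is a cover, N(I \ C) ⊆ N(I) ∩ C. Hence |N(I) \ C| - |I ∩ C| is at most the surplus of I
minus that of I \ C, and exchanging I for N(I) does not enlarge the cover. -/
theorem Cov.swap_of_surplus {C I : Finset V} (hC : Cov G C) (hI : Ind G I)
    (h : surplus G I ≤ surplus G (I \ C)) :
    ∃ C', Cov G C' ∧ C'.card ≤ C.card ∧ nbhd G I ⊆ C' ∧ Disjoint I C' := by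
  refine hC.swap hI ?_
  have h1 : nbhd G (I \ C) ⊆ nbhd G I ∩ C := by
    intro w hw
    refine Finset.mem_inter.2 ⟨hI.nbhd_mono Finset.sdiff_subset hw, ?_⟩
    obtain ⟨_, v, hv, hvw⟩ := mem_nbhd.1 hw
    rw [Finset.mem_sdiff] at hv
    have := hC v w hvw
    tauto
  have h2 := Finset.card_le_card h1
  have h3 := Finset.card_sdiff_add_card_inter (nbhd G I) C
  have h4 := Finset.card_sdiff_add_card_inter I C
  rw [surplus, surplus] at h
  omega

theorem Cov.of_delG {C S : Finset V} (hC : Cov (delG G S) C) : Cov G (C ∪ S) := by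
  intro u v huv
  have := hC u v
  rw [delG_adj] at this
  simp only [Finset.mem_union]
  tauto

theorem Cov.delG_sdiff {C S T : Finset V} (hC : Cov G C) (hT : T ⊆ S) : Cov (delG G S) (C \ T) := by
  intro u v huv
  rw [delG_adj] at huv
  have := hC u v huv.1
  have h1 : u ∉ T := fun h => huv.2.1 (hT h)
  have h2 : v ∉ T := fun h => huv.2.2 (hT h)
  simp only [Finset.mem_sdiff]
  tauto

theorem Cov.of_delG_nbhd {C S : Finset V} (hS : Ind G S) (hC : Cov (delG G (S ∪ nbhd G S)) C) :
    Cov G (C ∪ nbhd G S) := by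
  intro u v huv
  have := hC u v
  have h2 : u ∈ S → v ∈ nbhd G S := fun hu => hS.mem_nbhd hu huv
  have h3 : v ∈ S → u ∈ nbhd G S := fun hv => hS.mem_nbhd hv huv.symm
  rw [delG_adj] at this
  simp only [Finset.mem_union] at this ⊢
  tauto

/-- The branching on `U ⊆ C` or `X ∩ C = ∅` is valid. -/
def ValidBase (G : SimpleGraph V) (U X : Finset V) : Prop :=
  Ind G X ∧ ∀ z ∈ U, Ind G (insert z X) ∧ sig G (insert z X) = sig G {z}

/-- If a cover C misses some z in U, take I ⊇ {z} ∪ X of surplus sig{z}. The set I \ C still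
contains z, so its surplus is no smaller, and the exchange turns C into a cover that contains N(I) ⊇
N(X). -/
theorem ValidBase.feasible_iff {U X : Finset V} (h : ValidBase G U X) (k : ℤ) :
    Feasible G k ↔ Feasible (delG G U) (k - U.card) ∨
      Feasible (delG G (X ∪ nbhd G X)) (k - (nbhd G X).card) := by
  simp only [_root_.feasible_iff]
  constructor
  · rintro ⟨C, hC, hk⟩
    by_cases hU : U ⊆ C
    · left
      refine ⟨C \ U, hC.delG_sdiff le_rfl, ?_⟩
      have := Finset.card_sdiff_add_card_eq_card hU
      omega
    · right
      obtain ⟨z, hz, hzC⟩ := Finset.not_subset.1 hU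
      obtain ⟨hi, hs⟩ := h.2 z hz
      obtain ⟨I, hI, hzI, hIs⟩ := exists_sig hi
      have hzI' : z ∈ I := hzI (Finset.mem_insert_self _ _)
      obtain ⟨C', h1, h2, h3, h4⟩ := hC.swap_of_surplus hI (by
        rw [hIs, hs]
        exact sig_le (hI.mono Finset.sdiff_subset) (by simpa using ⟨hzI', hzC⟩))
      have h5 : nbhd G X ⊆ C' := (hI.nbhd_mono ((Finset.subset_insert _ _).trans hzI)).trans h3
      refine ⟨C' \ nbhd G X, h1.delG_sdiff Finset.subset_union_right, ?_⟩
      have := Finset.card_sdiff_add_card_eq_card h5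
      omega
  · rintro (⟨C, hC, hk⟩ | ⟨C, hC, hk⟩)
    · refine ⟨_, hC.of_delG, ?_⟩
      have := Finset.card_union_le C U
      omega
    · refine ⟨_, hC.of_delG_nbhd h.1, ?_⟩
      have := Finset.card_union_le C (nbhd G X)
      omega

end Surplus

/-! ### Reductions by sets of surplus one -/

section Fold
variable {V : Type} [Fintype V] [DecidableEq V] {G H : SimpleGraph V}

/-- A set of surplus one all of whose non-empty subsets have surplus at least one. -/
structure CritOne (H : SimpleGraph V) (K : Finset V) : Prop where
  ind : Ind H K
  nonempty : K.Nonempty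
  card : (nbhd H K).card = K.card + 1
  le : ∀ J ⊆ K, J.Nonempty → J.card + 1 ≤ (nbhd H J).card

/-- Deletion of `K`, with its neighborhood contracted to `y`. -/
def conG (H : SimpleGraph V) (K : Finset V) (y : V) : SimpleGraph V :=
  SimpleGraph.fromRel fun i j => j ∉ K ∪ nbhd H K ∧
    (i = y ∧ (∃ w ∈ nbhd H K, H.Adj w j) ∨ i ∉ K ∪ nbhd H K ∧ H.Adj i j)

/-- The instances `(H, k)` and `(H', k - c)` are equivalent, and the measure does not increase. -/
structure Red (H H' : SimpleGraph V) (c : ℕ) : Prop where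
  feasible : ∀ k, Feasible H k ↔ Feasible H' (k - c)
  lam_le : lam H ≤ lam H' + 2 * c

theorem Red.refl (H : SimpleGraph V) : Red H H 0 := ⟨fun k => by simp, by simp⟩

theorem Red.trans {H₁ H₂ H₃ : SimpleGraph V} {c d : ℕ} (h₁ : Red H₁ H₂ c) (h₂ : Red H₂ H₃ d) :
    Red H₁ H₃ (c + d) := by
  refine ⟨fun k => ?_, ?_⟩
  · rw [h₁.feasible, h₂.feasible, show k - (c : ℤ) - d = k - ((c + d : ℕ) : ℤ) by push_cast; ring]
  · have := h₁.lam_le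
    have := h₂.lam_le
    omega

theorem lam_le_delG (H : SimpleGraph V) {K : Finset V} (hK : Ind H K) :
    lam H ≤ lam (delG H (K ∪ nbhd H K)) + 2 * (nbhd H K).card := by
  obtain ⟨g, hg, hs⟩ := exists_lam (delG H (K ∪ nbhd H K))
  have h : IsDoubleCover H fun v => g v + 2 * if v ∈ nbhd H K then 1 else 0 := by
    intro u v huv
    have h1 := hg u v
    have h2 : u ∈ K → v ∈ nbhd H K := fun hu => hK.mem_nbhd hu huv
    have h3 : v ∈ K → u ∈ nbhd H K := fun hv => hK.mem_nbhd hv huv.symm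
    rw [delG_adj] at h1
    simp only [Finset.mem_union] at h1
    by_cases h4 : u ∈ nbhd H K
    · simp only [h4, if_true]; omega
    · by_cases h5 : v ∈ nbhd H K
      · simp only [h5, if_true]; omega
      · have := h1 (by tauto)
        simp only
        omega
  refine (_root_.lam_le h).trans_eq ?_
  rw [Finset.sum_add_distrib, ← Finset.mul_sum, ← card_eq_sum_ite, ← hs]

theorem Red.of_forall_cover {K : Finset V} (hK : Ind H K)
    (h : ∀ C, Cov H C → ∃ C', Cov H C' ∧ C'.card ≤ C.card ∧ nbhd H K ⊆ C') :
    Red H (delG H (K ∪ nbhd H K)) (nbhd H K).card := by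
  refine ⟨fun k => ?_, lam_le_delG H hK⟩
  simp only [feasible_iff]
  constructor
  · rintro ⟨C, hC, hk⟩
    obtain ⟨C', h1, h2, h3⟩ := h C hC
    refine ⟨C' \ nbhd H K, h1.delG_sdiff Finset.subset_union_right, ?_⟩
    have := Finset.card_sdiff_add_card_eq_card h3
    omega
  · rintro ⟨C, hC, hk⟩
    refine ⟨_, hC.of_delG_nbhd hK, ?_⟩
    have := Finset.card_union_le C (nbhd H K)
    omega

theorem Red.leaf {v : V} (hv : (nbhd H {v}).card = 1) :
    Red H (delG H ({v} ∪ nbhd H {v})) 1 := by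
  have := Red.of_forall_cover (ind_singleton v) (H := H) fun C hC => by
    by_cases h : v ∈ C
    · obtain ⟨C', h1, h2, h3, _⟩ := hC.swap (ind_singleton v) (by
        rw [Finset.inter_eq_left.2 (by simpa using h), Finset.card_singleton, ← hv]
        exact Finset.card_le_card Finset.sdiff_subset)
      exact ⟨C', h1, h2, h3⟩
    · refine ⟨C, hC, le_rfl, fun w hw => ?_⟩
      have := hC v w (mem_nbhd_singleton.1 hw)
      tauto
  rwa [hv] at this

/-- If K is not contained in C, then K \ C has surplus at least one and the exchange is free. If K ⊆
C and C meets N(K), at most |K| vertices of N(K) are missing and they can replace K. -/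
theorem CritOne.cover {K : Finset V} (h : CritOne H K) {C : Finset V} (hC : Cov H C) :
    (∃ C', Cov H C' ∧ C'.card ≤ C.card ∧ nbhd H K ⊆ C' ∧ Disjoint K C') ∨ K ⊆ C ∧ Disjoint (nbhd H K) C := by
  by_cases hK : K ⊆ C
  · by_cases hd : Disjoint (nbhd H K) C
    · exact Or.inr ⟨hK, hd⟩
    · left
      refine hC.swap h.ind ?_
      rw [Finset.inter_eq_left.2 hK]
      have h1 := Finset.card_sdiff_add_card_inter (nbhd H K) C
      have h2 : (nbhd H K ∩ C).card ≠ 0 := by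
        rw [Finset.disjoint_iff_inter_eq_empty, ← Finset.card_eq_zero] at hd
        exact hd
      have := h.card
      omega
  · left
    refine hC.swap_of_surplus h.ind ?_
    have h1 := h.le (K \ C) Finset.sdiff_subset (Finset.sdiff_nonempty.2 hK)
    have := h.card
    rw [surplus, surplus]
    omega

theorem Red.crit_del {K : Finset V} (h : CritOne H K) (hN : ¬ Ind H (nbhd H K)) :
    Red H (delG H (K ∪ nbhd H K)) (K.card + 1) := by
  rw [← h.card]
  refine Red.of_forall_cover h.ind fun C hC => ?_
  rcases h.cover hC with ⟨C', h1, h2, h3, _⟩ | ⟨_, h2⟩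
  · exact ⟨C', h1, h2, h3⟩
  · exfalso
    apply hN
    intro u hu v hv huv
    rw [Finset.disjoint_left] at h2
    rcases hC u v huv with h | h
    · exact h2 hu h
    · exact h2 hv h

theorem conG_adj_left {K : Finset V} {y : V} (hy : y ∈ nbhd H K) {j : V} :
    (conG H K y).Adj y j ↔ j ∉ K ∪ nbhd H K ∧ ∃ w ∈ nbhd H K, H.Adj w j := by
  rw [conG, SimpleGraph.fromRel_adj]
  have : y ∈ K ∪ nbhd H K := Finset.mem_union_right _ hy
  constructor
  · rintro ⟨h1, ⟨h2, h3⟩ | h2⟩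
    · refine ⟨h2, ?_⟩
      rcases h3 with h3 | h3
      · exact h3.2
      · exact absurd this h3.1
    · exact absurd this h2.1
  · rintro ⟨h1, h2⟩
    exact ⟨fun e => h1 (e ▸ this), Or.inl ⟨h1, Or.inl ⟨rfl, h2⟩⟩⟩

theorem conG_adj_of_notMem {K : Finset V} {y : V} (hy : y ∈ nbhd H K) {i j : V} (hi : i ∉ K ∪ nbhd H K)
    (hj : j ∉ K ∪ nbhd H K) : (conG H K y).Adj i j ↔ H.Adj i j := by
  have : y ∈ K ∪ nbhd H K := Finset.mem_union_right _ hy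
  have h1 : i ≠ y := fun e => hi (e ▸ this)
  have h2 : j ≠ y := fun e => hj (e ▸ this)
  rw [conG, SimpleGraph.fromRel_adj]
  constructor
  · rintro ⟨h3, ⟨h4, h5⟩ | ⟨h4, h5⟩⟩
    · exact (h5.resolve_left fun h => h1 h.1).2
    · exact (h5.resolve_left fun h => h2 h.1).2.symm
  · intro h
    exact ⟨h.ne, Or.inl ⟨hj, Or.inr ⟨hi, h⟩⟩⟩

theorem conG_adj_cases {K : Finset V} {y i j : V} (h : (conG H K y).Adj i j) :
    (i ∉ K ∪ nbhd H K ∧ j ∉ K ∪ nbhd H K ∧ H.Adj i j) ∨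
    (i = y ∧ j ∉ K ∪ nbhd H K ∧ ∃ w ∈ nbhd H K, H.Adj w j) ∨
    (j = y ∧ i ∉ K ∪ nbhd H K ∧ ∃ w ∈ nbhd H K, H.Adj w i) := by
  rw [conG, SimpleGraph.fromRel_adj] at h
  obtain ⟨_, ⟨h4, h5 | h5⟩ | ⟨h4, h5 | h5⟩⟩ := h
  · exact Or.inr (Or.inl ⟨h5.1, h4, h5.2⟩)
  · exact Or.inl ⟨h5.1, h4, h5.2⟩
  · exact Or.inr (Or.inr ⟨h5.1, h4, h5.2⟩)
  · exact Or.inl ⟨h4, h5.1, h5.2.symm⟩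

/-- A doubled cover of the contraction lifts by giving c to N(K) and 2 - c to K, where c is the
weight of y truncated at 2. As |N(K)| = |K| + 1, these weights sum to 2|K| + c. -/
theorem CritOne.lam_le_conG {K : Finset V} (h : CritOne H K) (hN : Ind H (nbhd H K)) {y : V}
    (hy : y ∈ nbhd H K) : lam H ≤ lam (conG H K y) + 2 * K.card := by
  obtain ⟨g, hg, hs⟩ := exists_lam (conG H K y)
  have hyK : y ∉ K := fun hh => notMem_nbhd hh hy
  set c := min (g y) 2
  have hcov : IsDoubleCover H fun v => if v ∈ K then 2 - c else if v ∈ nbhd H K then c else g v := by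
    intro u v huv
    have h2 : u ∈ K → v ∈ nbhd H K := fun hu => h.ind.mem_nbhd hu huv
    have h3 : v ∈ K → u ∈ nbhd H K := fun hv => h.ind.mem_nbhd hv huv.symm
    have h4 := @notMem_nbhd _ _ _ H K u
    have h5 := @notMem_nbhd _ _ _ H K v
    have h6 := hN u
    by_cases hu : u ∈ K
    · simp only [hu, h5.mt (not_not_intro (h2 hu)), h2 hu, if_true, if_false]; omega
    · by_cases hv : v ∈ K
      · simp only [hv, hu, h3 hv, if_true, if_false]; omega
      · by_cases hu' : u ∈ nbhd H K
        · have hv' : v ∉ nbhd H K := fun hv' => h6 hu' v hv' huv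
          have := hg y v ((conG_adj_left hy).2 ⟨by rw [Finset.mem_union]; tauto, u, hu', huv⟩)
          simp only [hu, hv, hu', hv', if_true, if_false]
          omega
        · by_cases hv' : v ∈ nbhd H K
          · have := hg y u ((conG_adj_left hy).2 ⟨by rw [Finset.mem_union]; tauto, v, hv', huv.symm⟩)
            simp only [hu, hv, hu', hv', if_true, if_false]
            omega
          · have := hg u v ((conG_adj_of_notMem hy (by rw [Finset.mem_union]; tauto)
              (by rw [Finset.mem_union]; tauto)).2 huv)
            simp only [hu, hv, hu', hv', if_false]
            omega
  refine (_root_.lam_le hcov).trans ?_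
  rw [hs]
  have e : ∀ v, (if v ∈ K then 2 - c else if v ∈ nbhd H K then c else g v) + (if v = y then g y else 0) ≤
      g v + (2 - c) * (if v ∈ K then 1 else 0) + c * (if v ∈ nbhd H K then 1 else 0) := by
    intro v
    have h4 := @notMem_nbhd _ _ _ H K v
    by_cases hv : v ∈ K
    · have : v ≠ y := fun e => hyK (e ▸ hv)
      simp [hv, h4 hv, this]
    · by_cases hv' : v ∈ nbhd H K
      · by_cases hvy : v = y
        · simp [hyK, hy, hvy]; omega
        · simp [hv, hv', hvy]
      · have : v ≠ y := fun e => hv' (e ▸ hy)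
        simp [hv, hv', this]
  have e2 := Finset.sum_le_sum fun v (_ : v ∈ Finset.univ) => e v
  simp only [Finset.sum_add_distrib, ← Finset.mul_sum, ← card_eq_sum_ite] at e2
  rw [Finset.sum_ite_eq' Finset.univ y (fun _ => g y), if_pos (Finset.mem_univ _), h.card] at e2
  have e3 : (2 - c) * K.card + c * (K.card + 1) = 2 * K.card + c := by
    have : c ≤ 2 := min_le_right _ _
    obtain ⟨d, hd⟩ := Nat.exists_eq_add_of_le this
    rw [hd, Nat.add_sub_cancel_left]; ring
  omega

/-- A cover of the contraction with y corresponds to one containing N(K), and a cover without y to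
one containing K and avoiding N(K). By `CritOne.cover` no other covers matter. -/
theorem Red.crit_con {K : Finset V} (h : CritOne H K) (hN : Ind H (nbhd H K)) {y : V}
    (hy : y ∈ nbhd H K) : Red H (conG H K y) K.card := by
  refine ⟨fun k => ?_, h.lam_le_conG hN hy⟩
  have hyK : y ∉ K := fun hh => notMem_nbhd hh hy
  have hdisj := nbhd_disjoint (G := H) K
  simp only [feasible_iff]
  constructor
  · rintro ⟨C, hC, hk⟩
    rcases h.cover hC with ⟨C', h1, h2, h3, h4⟩ | ⟨h1, h2⟩
    · refine ⟨insert y (C' \ nbhd H K), ?_, ?_⟩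
      · intro u v huv
        simp only [Finset.mem_insert, Finset.mem_sdiff]
        rcases conG_adj_cases huv with ⟨h5, h6, h7⟩ | ⟨h5, _⟩ | ⟨h5, _⟩
        · have := h1 u v h7
          rw [Finset.mem_union] at h5 h6
          tauto
        · tauto
        · tauto
      · have h5 := Finset.card_sdiff_add_card_eq_card h3
        have h6 := Finset.card_insert_le y (C' \ nbhd H K)
        have h7 := h.card
        omega
    · refine ⟨C \ K, ?_, ?_⟩
      · intro u v huv
        rw [Finset.disjoint_left] at h2
        simp only [Finset.mem_sdiff]
        rcases conG_adj_cases huv with ⟨h5, h6, h7⟩ | ⟨h5, h6, w, hw, h7⟩ | ⟨h5, h6, w, hw, h7⟩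
        · have := hC u v h7
          rw [Finset.mem_union] at h5 h6
          tauto
        · have := hC w v h7
          have := h2 hw
          rw [Finset.mem_union] at h6
          tauto
        · have := hC w u h7
          have := h2 hw
          rw [Finset.mem_union] at h6
          tauto
      · have h5 := Finset.card_sdiff_add_card_eq_card h1
        omega
  · rintro ⟨C, hC, hk⟩
    by_cases hyC : y ∈ C
    · refine ⟨C \ {y} ∪ nbhd H K, ?_, ?_⟩
      · intro u v huv
        have h2 : u ∈ K → v ∈ nbhd H K := fun hu => h.ind.mem_nbhd hu huv
        have h3 : v ∈ K → u ∈ nbhd H K := fun hv => h.ind.mem_nbhd hv huv.symm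
        by_cases hu : u ∈ K ∪ nbhd H K
        · simp only [Finset.mem_union] at hu ⊢; tauto
        · by_cases hv : v ∈ K ∪ nbhd H K
          · simp only [Finset.mem_union] at hv ⊢; tauto
          · have h4 := hC u v ((conG_adj_of_notMem hy hu hv).2 huv)
            have h5 : u ≠ y := fun e => hu (e ▸ Finset.mem_union_right _ hy)
            have h6 : v ≠ y := fun e => hv (e ▸ Finset.mem_union_right _ hy)
            simp only [Finset.mem_union, Finset.mem_sdiff, Finset.mem_singleton]
            tauto
      · have h5 := Finset.card_union_le (C \ {y}) (nbhd H K)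
        have h6 := Finset.card_sdiff_add_card_eq_card (Finset.singleton_subset_iff.2 hyC)
        have h7 := h.card
        rw [Finset.card_singleton] at h6
        omega
    · refine ⟨C ∪ K, ?_, ?_⟩
      · intro u v huv
        have h6 := hN u
        by_cases hu : u ∈ K
        · simp only [Finset.mem_union]; tauto
        · by_cases hv : v ∈ K
          · simp only [Finset.mem_union]; tauto
          · by_cases hu' : u ∈ nbhd H K
            · have hv' : v ∉ nbhd H K := fun hv' => h6 hu' v hv' huv
              have := hC y v ((conG_adj_left hy).2 ⟨by rw [Finset.mem_union]; tauto, u, hu', huv⟩)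
              simp only [Finset.mem_union]; tauto
            · by_cases hv' : v ∈ nbhd H K
              · have := hC y u ((conG_adj_left hy).2 ⟨by rw [Finset.mem_union]; tauto, v, hv', huv.symm⟩)
                simp only [Finset.mem_union]; tauto
              · have := hC u v ((conG_adj_of_notMem hy (by rw [Finset.mem_union]; tauto)
                  (by rw [Finset.mem_union]; tauto)).2 huv)
                simp only [Finset.mem_union]; tauto
      · have h5 := Finset.card_union_le C K
        omega

/-- At most `m` reductions, with sets of at most two vertices, decrease `k` by at least `c`. -/
inductive Gain : ℕ → SimpleGraph V → ℕ → Prop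
  | zero (m : ℕ) (H : SimpleGraph V) : Gain m H 0
  | leaf {m : ℕ} {H : SimpleGraph V} {c : ℕ} (v : V) (hv : (nbhd H {v}).card = 1)
      (h : Gain m (delG H ({v} ∪ nbhd H {v})) (c - 1)) : Gain (m + 1) H c
  | crit {m : ℕ} {H : SimpleGraph V} {c : ℕ} (v w : V) (hK : CritOne H {v, w})
      (h₁ : ¬ Ind H (nbhd H {v, w}) →
        Gain m (delG H ({v, w} ∪ nbhd H {v, w})) (c - (({v, w} : Finset V).card + 1)))
      (h₂ : Ind H (nbhd H {v, w}) → ∀ y ∈ nbhd H {v, w},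
        Gain m (conG H {v, w} y) (c - ({v, w} : Finset V).card)) : Gain (m + 1) H c

theorem Gain.mono {m m' : ℕ} {c c' : ℕ} (h : Gain m H c) (hm : m ≤ m') (hc : c' ≤ c) : Gain m' H c' := by
  induction h generalizing m' c' with
  | zero m H =>
    rw [Nat.le_zero.1 hc]; exact Gain.zero _ _
  | leaf v hv h ih =>
    obtain ⟨m', rfl⟩ := Nat.exists_eq_add_of_le' (Nat.one_le_of_lt hm)
    exact Gain.leaf v hv (ih (by omega) (by omega))
  | crit v w hK h₁ h₂ ih₁ ih₂ =>
    obtain ⟨m', rfl⟩ := Nat.exists_eq_add_of_le' (Nat.one_le_of_lt hm)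
    exact Gain.crit v w hK (fun h => ih₁ h (by omega) (by omega))
      (fun h y hy => ih₂ h y hy (by omega) (by omega))

theorem critOne_singleton {v : V} (hv : (nbhd H {v}).card = 2) : CritOne H {v} :=
  ⟨ind_singleton v, by simp, by simpa using hv, fun J hJ hn => by
    rw [Finset.Nonempty.subset_singleton_iff hn] at hJ
    subst hJ
    simp [hv]⟩

/-- Reduction at a vertex of degree at most two. -/
theorem Gain.vertex {m c : ℕ} (v : V) (h₀ : (nbhd H {v}).Nonempty) (h2 : (nbhd H {v}).card ≤ 2)
    (h₁ : (nbhd H {v}).card = 1 → Gain m (delG H ({v} ∪ nbhd H {v})) (c - 1))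
    (h₂ : (nbhd H {v}).card = 2 → ¬ Ind H (nbhd H {v}) → Gain m (delG H ({v} ∪ nbhd H {v})) (c - 2))
    (h₃ : (nbhd H {v}).card = 2 → Ind H (nbhd H {v}) → ∀ y ∈ nbhd H {v}, Gain m (conG H {v} y) (c - 1)) :
    Gain (m + 1) H c := by
  have := h₀.card_pos
  rcases (by omega : (nbhd H {v}).card = 1 ∨ (nbhd H {v}).card = 2) with h | h
  · exact Gain.leaf v h (h₁ h)
  · refine Gain.crit v v ?_ ?_ ?_
    · simpa using critOne_singleton h
    · simpa using h₂ h
    · simpa using h₃ h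

theorem delG_le (H : SimpleGraph V) (S : Finset V) {a b : V} (h : (delG H S).Adj a b) : H.Adj a b := h.1

/-- Independent vertices of degree at most two, matched to neighbors, can be reduced one by one. -/
theorem Gain.of_matching (m : V → V) (S : Finset V) (hS : Ind H S)
    (hm : ∀ v ∈ S, H.Adj v (m v)) (hinj : Set.InjOn m S) (hd : ∀ v ∈ S, (nbhd H {v}).card ≤ 2) :
    Gain S.card H S.card := by
  classical
  induction hn : S.card using Nat.strong_induction_on generalizing S H m with
  | _ n ih =>
  rcases S.eq_empty_or_nonempty with rfl | ⟨v, hv⟩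
  · rw [Finset.card_empty] at hn; rw [← hn]; exact Gain.zero _ _
  obtain ⟨k, rfl⟩ : ∃ k, n = k + 1 := ⟨n - 1, by have := Finset.card_pos.2 ⟨v, hv⟩; omega⟩
  have hmv : m v ∈ nbhd H {v} := mem_nbhd_singleton.2 (hm v hv)
  have herase : (S.erase v).card = k := by rw [Finset.card_erase_of_mem hv]; omega
  have hnS : ∀ w ∈ S, w ≠ v → w ∉ {v} ∪ nbhd H {v} := by
    intro w hw hne h
    rw [Finset.mem_union, Finset.mem_singleton, mem_nbhd_singleton] at h
    exact h.elim hne (hS v hv w hw)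
  have hmv' : ∀ w ∈ S, m w ≠ v := fun w hw e => hS w hw v hv (e ▸ hm w hw)
  have hdel : ∀ S' ⊆ S.erase v, (∀ w ∈ S', m w ∉ nbhd H {v}) →
      Gain S'.card (delG H ({v} ∪ nbhd H {v})) S'.card := by
    intro S' hS' hm'
    have hS'' : ∀ w ∈ S', w ∈ S ∧ w ≠ v := fun w hw => by
      have := Finset.mem_erase.1 (hS' hw); tauto
    refine ih _ ?_ m S' ?_ ?_ ?_ ?_ rfl
    · have := Finset.card_le_card hS'; omega
    · exact fun a ha b hb h => hS a (hS'' a ha).1 b (hS'' b hb).1 h.1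
    · intro w hw
      refine ⟨hm w (hS'' w hw).1, hnS w (hS'' w hw).1 (hS'' w hw).2, ?_⟩
      rw [Finset.mem_union, Finset.mem_singleton]
      exact fun h => h.elim (hmv' w (hS'' w hw).1) (hm' w hw)
    · exact hinj.mono fun w hw => (hS'' w hw).1
    · intro w hw
      refine (Finset.card_le_card fun x hx => ?_).trans (hd w (hS'' w hw).1)
      exact mem_nbhd_singleton.2 (mem_nbhd_singleton.1 hx).1
  refine Gain.vertex v ⟨_, hmv⟩ (hd v hv) ?_ ?_ ?_
  · intro h1
    rw [Finset.card_eq_one] at h1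
    obtain ⟨p, hp⟩ := h1
    have hpm : m v = p := by rw [hp] at hmv; simpa using hmv
    have := hdel (S.erase v) le_rfl fun w hw h => by
      rw [hp, Finset.mem_singleton, ← hpm] at h
      exact (Finset.mem_erase.1 hw).1 (hinj (Finset.mem_erase.1 hw).2 hv h)
    rwa [herase] at this
  · intro h2 _
    -- Deleting both neighbors of `v` may destroy the match of one other vertex, the one matched to
    -- `q`. The deletion decreases k by two, which pays for that loss.
    obtain ⟨q, hq⟩ : ∃ q, (nbhd H {v}).erase (m v) = {q} := by
      rw [← Finset.card_eq_one, Finset.card_erase_of_mem hmv, h2]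
    have hS' := hdel ((S.erase v).filter fun w => m w ≠ q) (Finset.filter_subset _ _) fun w hw h => by
      obtain ⟨hw1, hw2⟩ := Finset.mem_filter.1 hw
      have h3 : m w ≠ m v := fun e =>
        (Finset.mem_erase.1 hw1).1 (hinj (Finset.mem_erase.1 hw1).2 hv e)
      have h4 : m w ∈ (nbhd H {v}).erase (m v) := Finset.mem_erase.2 ⟨h3, h⟩
      rw [hq, Finset.mem_singleton] at h4
      exact hw2 h4
    have h5 : ((S.erase v).filter fun w => m w = q).card ≤ 1 := by
      rw [Finset.card_le_one]
      intro a ha b hb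
      simp only [Finset.mem_filter, Finset.mem_erase] at ha hb
      exact hinj ha.1.2 hb.1.2 (ha.2.trans hb.2.symm)
    have h6 := Finset.card_filter_add_card_filter_not (s := S.erase v) (fun w => m w = q)
    have h7 := Finset.card_filter_le (S.erase v) (fun w => m w ≠ q)
    exact hS'.mono (by omega) (by simp only [ne_eq]; omega)
  · intro h2 hN y hy
    have hyv : y ∈ {v} ∪ nbhd H {v} := Finset.mem_union_right _ hy
    -- Besides `m v` there is only one vertex in the neighborhood of `v`, so at most one other
    -- vertex is matched into it. Redirecting such matches to the contracted vertex `y` keeps the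
    -- matching injective.
    have hN2 : ∀ w ∈ S.erase v, ∀ w' ∈ S.erase v, m w ∈ nbhd H {v} → m w' ∈ nbhd H {v} → m w = m w' := by
      intro w hw w' hw' h h'
      have h3 : ∀ w ∈ S.erase v, m w ≠ m v := fun w hw e =>
        (Finset.mem_erase.1 hw).1 (hinj (Finset.mem_erase.1 hw).2 hv e)
      have h4 : ((nbhd H {v}).erase (m v)).card ≤ 1 := by
        rw [Finset.card_erase_of_mem hmv, h2]
      exact Finset.card_le_one.1 h4 _ (Finset.mem_erase.2 ⟨h3 w hw, h⟩) _ (Finset.mem_erase.2 ⟨h3 w' hw', h'⟩)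
    have key : Gain (S.erase v).card (conG H {v} y) (S.erase v).card := by
      refine ih _ (by omega) (fun w => if m w ∈ nbhd H {v} then y else m w) (S.erase v) ?_ ?_ ?_ ?_ rfl
      · intro a ha b hb h
        rw [Finset.mem_erase] at ha hb
        rw [conG_adj_of_notMem hy (hnS a ha.2 ha.1) (hnS b hb.2 hb.1)] at h
        exact hS a ha.2 b hb.2 h
      · intro w hw
        rw [Finset.mem_erase] at hw
        have h3 := hnS w hw.2 hw.1
        split_ifs with h4
        · exact ((conG_adj_left hy).2 ⟨h3, m w, h4, (hm w hw.2).symm⟩).symm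
        · rw [conG_adj_of_notMem hy h3]
          · exact hm w hw.2
          · rw [Finset.mem_union, Finset.mem_singleton]
            exact fun h => h.elim (hmv' w hw.2) h4
      · intro a ha b hb h
        have ha' := (Finset.mem_erase.1 ha).2
        have hb' := (Finset.mem_erase.1 hb).2
        simp only at h
        split_ifs at h with h1 h2 h2
        · exact hinj ha' hb' (hN2 a ha b hb h1 h2)
        · exact absurd (h ▸ hy) h2
        · exact absurd (h ▸ hy) h1
        · exact hinj ha' hb' h
      · intro w hw
        rw [Finset.mem_erase] at hw
        have h3 := hnS w hw.2 hw.1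
        refine le_trans (Finset.card_le_card ?_) ((Finset.card_image_le (s := nbhd H {w})
          (f := fun x => if x ∈ nbhd H {v} then y else x)).trans (hd w hw.2))
        intro x hx
        rw [mem_nbhd_singleton] at hx
        rw [Finset.mem_image]
        rcases conG_adj_cases hx with ⟨_, h4, h5⟩ | ⟨h4, _⟩ | ⟨rfl, _, z, hz, h5⟩
        · refine ⟨x, mem_nbhd_singleton.2 h5, if_neg fun h => h4 (Finset.mem_union_right _ h)⟩
        · exact absurd hyv (h4 ▸ h3)
        · exact ⟨z, mem_nbhd_singleton.2 h5.symm, if_pos hz⟩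
    rwa [herase] at key

/-- The same, under Hall's condition. -/
theorem Gain.of_hall (S : Finset V) (hS : Ind H S) (hd : ∀ v ∈ S, (nbhd H {v}).card ≤ 2)
    (hh : ∀ J ⊆ S, J.Nonempty → J.card ≤ (nbhd H J).card) : Gain S.card H S.card := by
  obtain ⟨f, hf, hf'⟩ := (Finset.all_card_le_biUnion_card_iff_exists_injective
    (fun v : S => nbhd H {(v : V)})).1 fun s => by
      rcases s.eq_empty_or_nonempty with rfl | hn
      · simp
      have h1 := hh (s.image Subtype.val) (fun v hv => by
        obtain ⟨w, _, rfl⟩ := Finset.mem_image.1 hv; exact w.2) (hn.image _)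
      rw [Finset.card_image_of_injective _ Subtype.val_injective] at h1
      refine h1.trans (Finset.card_le_card fun w hw => ?_)
      obtain ⟨_, v, hv, hvw⟩ := mem_nbhd.1 hw
      obtain ⟨v', hv', rfl⟩ := Finset.mem_image.1 hv
      exact Finset.mem_biUnion.2 ⟨v', hv', mem_nbhd_singleton.2 hvw⟩
  refine Gain.of_matching (fun v => if h : v ∈ S then f ⟨v, h⟩ else v) S hS ?_ ?_ hd
  · intro v hv
    simpa [hv] using mem_nbhd_singleton.1 (hf' ⟨v, hv⟩)
  · intro a ha b hb h
    have ha' : a ∈ S := ha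
    have hb' : b ∈ S := hb
    simp only [ha', hb', dif_pos] at h
    simpa using hf h

end Fold

/-! ### The case analysis -/

section Cases
variable {V : Type} [Fintype V] [DecidableEq V] {G H : SimpleGraph V}

/-- The degree. -/
noncomputable def dg (G : SimpleGraph V) (v : V) : ℕ := (nbhd G {v}).card

/-- Some branching, boosted by reductions, has drops `(c₁ / 2, k₁)` and `(c₂ / 2, k₂)`. -/
def Win (G : SimpleGraph V) (c₁ k₁ c₂ k₂ : ℕ) : Prop :=
  ∃ U X : Finset V, (U.Nonempty ∧ U.card ≤ 3) ∧ (X.Nonempty ∧ X.card ≤ 3) ∧ ValidBase G U X ∧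
    (lam G + c₁ ≤ 2 * U.card + lam (delG G U) ∧ ∃ g, Gain 3 (delG G U) g ∧ k₁ ≤ U.card + g) ∧
    (lam G + c₂ ≤ 2 * (nbhd G X).card + lam (delG G (X ∪ nbhd G X)) ∧
      ((∃ g, Gain 3 (delG G (X ∪ nbhd G X)) g ∧ k₂ ≤ (nbhd G X).card + g) ∨
        Ind G (U ∪ X) ∧ ∀ I, Ind G I → U ∪ X ⊆ I → surplus G I = sig G (U ∪ X) →
          CritOne (delG G (X ∪ nbhd G X)) (I \ X) ∧ k₂ ≤ (nbhd G X).card + (I \ X).card))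

theorem Win.mono {c₁ k₁ c₂ k₂ k₁' k₂' : ℕ} (h : Win G c₁ k₁ c₂ k₂) (h₁ : k₁' ≤ k₁) (h₂ : k₂' ≤ k₂) :
    Win G c₁ k₁' c₂ k₂' := by
  obtain ⟨U, X, h3, h4, h5, ⟨h6, g, h7, h8⟩, h9, h10⟩ := h
  refine ⟨U, X, h3, h4, h5, ⟨h6, g, h7, h₁.trans h8⟩, h9, ?_⟩
  rcases h10 with ⟨g, h11, h12⟩ | ⟨h11, h12⟩
  · exact Or.inl ⟨g, h11, h₂.trans h12⟩
  · exact Or.inr ⟨h11, fun I h13 h14 h15 => ⟨(h12 I h13 h14 h15).1, h₂.trans (h12 I h13 h14 h15).2⟩⟩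

/-- What the preprocessing rules give: surpluses are at least two, and the neighborhoods of vertices of
degree three are independent. -/
structure Nice (G : SimpleGraph V) : Prop where
  exp : Expanding G
  indep : ∀ v, dg G v = 3 → Ind G (nbhd G {v})

/-- An edge between two neighbors of a vertex of degree three makes that vertex a funnel, with the
third neighbor as out-neighbor. -/
theorem Simplified.nice (h : Simplified G) : Nice G := by
  refine ⟨h.expanding, fun v hv a ha b hb hab => h.2.2 ?_⟩
  rw [mem_nbhd_singleton] at ha hb
  have hab' : ({a, b} : Finset V) ⊆ nbhd G {v} := by
    intro w hw
    rw [mem_nbhd_singleton]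
    simp only [Finset.mem_insert, Finset.mem_singleton] at hw
    rcases hw with rfl | rfl <;> assumption
  have hc : (nbhd G {v} \ {a, b}).card = 1 := by
    rw [Finset.card_sdiff_of_subset hab', Finset.card_pair hab.ne]
    rw [dg] at hv; omega
  obtain ⟨c, hc⟩ := Finset.card_eq_one.1 hc
  have hcm : c ∈ nbhd G {v} \ {a, b} := by rw [hc]; exact Finset.mem_singleton_self c
  refine ⟨v, c, mem_nbhd_singleton.1 (Finset.mem_sdiff.1 hcm).1, ?_⟩
  have key : ∀ w ∈ G.neighborSet v \ {c}, w = a ∨ w = b := by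
    rintro w ⟨hw, hwc⟩
    by_contra hcon
    have : w ∈ nbhd G {v} \ {a, b} := by
      simp only [Finset.mem_sdiff, mem_nbhd_singleton, Finset.mem_insert, Finset.mem_singleton]
      exact ⟨hw, hcon⟩
    rw [hc, Finset.mem_singleton] at this
    exact hwc this
  intro x hx y hy hxy
  rcases key x hx with rfl | rfl <;> rcases key y hy with rfl | rfl
  · exact absurd rfl hxy
  · exact hab
  · exact hab.symm
  · exact absurd rfl hxy

theorem Ind.pair {u x : V} (h : ¬ G.Adj u x) : Ind G {u, x} := by
  intro a ha b hb
  simp only [Finset.mem_insert, Finset.mem_singleton] at ha hb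
  rcases ha with rfl | rfl <;> rcases hb with rfl | rfl
  · exact G.loopless.irrefl _
  · exact h
  · exact fun h' => h h'.symm
  · exact G.loopless.irrefl _

theorem dg_le_of_mem {I : Finset V} (hI : Ind G I) {v : V} (hv : v ∈ I) : dg G v ≤ (nbhd G I).card :=
  Finset.card_le_card (hI.nbhd_mono (by simpa using hv))

theorem surplus_singleton (v : V) : surplus G {v} = dg G v - 1 := by simp [surplus, dg]

theorem Expanding.le_sig (h : Expanding G) {J : Finset V} (hJ : Ind G J) (hn : J.Nonempty) : 2 ≤ sig G J := by
  obtain ⟨I, h1, h2, h3⟩ := exists_sig hJ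
  rw [← h3]
  exact h I h1 (hn.mono h2)

theorem Expanding.three_le_dg (h : Expanding G) (v : V) : 3 ≤ dg G v := by
  have := h {v} (ind_singleton v) (by simp)
  rw [surplus_singleton] at this
  omega

theorem Expanding.le_card_nbhd (h : Expanding G) {J : Finset V} (hJ : Ind G J) (hn : J.Nonempty) :
    J.card + 2 ≤ (nbhd G J).card := by
  have := h J hJ hn
  rw [surplus] at this
  omega

theorem nbhd_delG_of_disjoint {U J : Finset V} (h : Disjoint J U) : nbhd (delG G U) J = nbhd G J \ U := by
  ext w
  rw [Finset.disjoint_left] at h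
  simp only [mem_nbhd, delG_adj, Finset.mem_sdiff]
  constructor
  · rintro ⟨h1, v, hv, h2, h3, h4⟩; exact ⟨⟨h1, v, hv, h2⟩, h4⟩
  · rintro ⟨⟨h1, v, hv, h2⟩, h4⟩; exact ⟨h1, v, hv, h2, h hv, h4⟩

theorem card_nbhd_delG {I X J : Finset V} (hI : Ind G I) (hX : X ⊆ I) (hJ : J ⊆ I \ X) :
    (nbhd (delG G (X ∪ nbhd G X)) J).card + (nbhd G X).card = (nbhd G (J ∪ X)).card := by
  have hJI : J ∪ X ⊆ I := Finset.union_subset (hJ.trans Finset.sdiff_subset) hX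
  have h1 := hI.mono hJI
  have hsub : nbhd G X ⊆ nbhd G (J ∪ X) := h1.nbhd_mono Finset.subset_union_right
  rw [← Finset.card_sdiff_add_card_eq_card hsub]
  congr 2
  rw [nbhd_delG_of_disjoint]
  · ext w
    have h2 := @mem_nbhd _ _ _ G (J ∪ X) w
    have h3 := @mem_nbhd _ _ _ G J w
    have h4 := fun v (hv : v ∈ X) (h : G.Adj v w) => (hI.mono hX).mem_nbhd hv h
    simp only [Finset.mem_sdiff, Finset.mem_union] at h2 ⊢
    constructor
    · rintro ⟨h5, h6⟩
      obtain ⟨h7, v, hv, h8⟩ := h3.1 h5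
      exact ⟨h2.2 ⟨by tauto, v, Or.inl hv, h8⟩, by tauto⟩
    · rintro ⟨h5, h6⟩
      obtain ⟨h7, v, hv | hv, h8⟩ := h2.1 h5
      · exact ⟨h3.2 ⟨by tauto, v, hv, h8⟩, by tauto⟩
      · exact absurd (h4 v hv h8) h6
  · rw [Finset.disjoint_left]
    intro v hv hv'
    have h5 := Finset.mem_sdiff.1 (hJ hv)
    rcases Finset.mem_union.1 hv' with h6 | h6
    · exact h5.2 h6
    · exact notMem_nbhd h5.1 (hI.nbhd_mono hX h6)

/-- For J ⊆ I \ X, the surplus of J after deletion of X and N(X) is the surplus of J ∪ X minus that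
of X, by `card_nbhd_delG`. -/
theorem critOne_sdiff {I X : Finset V} (hI : Ind G I) (hX : X ⊆ I) (hne : (I \ X).Nonempty)
    (hs : surplus G I = surplus G X + 1)
    (hJ : ∀ J ⊆ I \ X, J.Nonempty → surplus G X + 1 ≤ surplus G (J ∪ X)) :
    CritOne (delG G (X ∪ nbhd G X)) (I \ X) := by
  refine ⟨?_, hne, ?_, ?_⟩
  · intro u hu v hv huv
    exact hI u (Finset.sdiff_subset hu) v (Finset.sdiff_subset hv) huv.1
  · have h1 := card_nbhd_delG hI hX le_rfl
    rw [Finset.sdiff_union_of_subset hX] at h1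
    have h2 := Finset.card_sdiff_add_card_eq_card hX
    rw [surplus, surplus] at hs
    omega
  · intro J hJ' hn
    have h1 := card_nbhd_delG hI hX hJ'
    have h2 := hJ J hJ' hn
    have h3 : (J ∪ X).card = J.card + X.card :=
      Finset.card_union_of_disjoint (Finset.sdiff_disjoint.mono_left hJ')
    rw [surplus, surplus] at h2
    omega

theorem Gain.one {v : V} (h₀ : (nbhd H {v}).Nonempty) (h₁ : (nbhd H {v}).card ≤ 2) : Gain 1 H 1 :=
  Gain.vertex v h₀ h₁ (fun _ => Gain.zero _ _) (fun _ _ => Gain.zero _ _) (fun _ _ _ _ => Gain.zero _ _)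

/-- Every non-empty J ⊆ S has at least |J| + 2 neighbors, so Hall's condition survives the deletion
of two vertices. -/
theorem Expanding.gain (h : Expanding G) {U S : Finset V} (hU : U.card ≤ 2) (hS : Ind G S)
    (hSU : Disjoint S U) (hd : ∀ v ∈ S, (nbhd G {v} \ U).card ≤ 2) (h3 : S.card ≤ 3) :
    Gain 3 (delG G U) S.card := by
  refine (Gain.of_hall S (fun a ha b hb hab => hS a ha b hb (delG_le G U hab)) ?_ ?_).mono h3 le_rfl
  · intro v hv
    rw [nbhd_delG_of_disjoint (hSU.mono_left (by simpa using hv))]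
    exact hd v hv
  · intro J hJ hn
    rw [nbhd_delG_of_disjoint (hSU.mono_left hJ)]
    have := h.le_card_nbhd (hS.mono hJ) hn
    have := Finset.le_card_sdiff U (nbhd G J)
    omega

/-- A version of `Win` for graphs with minimum surplus two. -/
theorem Expanding.win (h : Expanding G) {U X : Finset V} {c₁ k₁ c₂ k₂ g : ℕ} (hX : X.Nonempty ∧ X.card ≤ 3)
    (hv : ValidBase G U X) (hU : U.card = 1 ∧ c₁ = 1 ∨ U.card = 2 ∧ c₁ = 2 ∨ U.card = 3 ∧ c₁ = 2)
    (hg : Gain 3 (delG G U) g) (hk₁ : k₁ ≤ U.card + g) (hc₂ : (c₂ : ℤ) ≤ sig G X)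
    (hk₂ : (∃ g, Gain 3 (delG G (X ∪ nbhd G X)) g ∧ k₂ ≤ (nbhd G X).card + g) ∨
        Ind G (U ∪ X) ∧ ∀ I, Ind G I → U ∪ X ⊆ I → surplus G I = sig G (U ∪ X) →
          CritOne (delG G (X ∪ nbhd G X)) (I \ X) ∧ k₂ ≤ (nbhd G X).card + (I \ X).card) :
    Win G c₁ k₁ c₂ k₂ := by
  have h1 := h.le_lam_delG U
  have h2 := h.lam_eq
  refine ⟨U, X, ?_, hX, hv, ⟨?_, g, hg, hk₁⟩, ?_, hk₂⟩ <;> clear hk₂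
  · exact ⟨Finset.card_pos.1 (by omega), by omega⟩
  · omega
  rw [sig] at hc₂
  omega

/-- One of the good pairs of drops is available. -/
def TWin (G : SimpleGraph V) : Prop :=
  Win G 2 3 2 5 ∨ Win G 2 4 2 4 ∨ Win G 2 5 2 3 ∨ Win G 1 2 4 5 ∨ Win G 2 2 3 5

theorem Expanding.win_single (h : Expanding G) (u : V) {c₂ g : ℕ} (hg : Gain 3 (delG G {u}) g)
    (hc₂ : (c₂ : ℤ) ≤ sig G {u}) : Win G 1 (1 + g) c₂ (dg G u) := by
  refine h.win (U := {u}) (X := {u}) (by simp) ⟨ind_singleton u, ?_⟩ (Or.inl (by simp)) hg (by simp) hc₂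
    (Or.inl ⟨0, Gain.zero _ _, by simp [dg]⟩)
  intro z hz
  rw [Finset.mem_singleton] at hz
  subst hz
  simpa using ind_singleton z

/-- The equalities force `sig G {u, x}` to be c as well. If either vertex may be left out of the
cover then so may the other, and U = X = {u, x} is valid. -/
theorem Expanding.win_pair (h : Expanding G) {u x : V} (hne : u ≠ x) {I : Finset V} (hI : Ind G I)
    (hu : u ∈ I) (hx : x ∈ I) {c : ℕ} (hc : surplus G I = c) (hsu : sig G {u} = c) (hsx : sig G {x} = c) :
    Win G 2 2 c (nbhd G {u, x}).card := by
  have hs : ({u, x} : Finset V) ⊆ I := by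
    intro w hw
    simp only [Finset.mem_insert, Finset.mem_singleton] at hw
    rcases hw with rfl | rfl <;> assumption
  have hi := hI.mono hs
  have h1 := sig_le hI hs
  have h2 := sig_mono (J := {u}) hi (by simp)
  refine h.win (U := {u, x}) (X := {u, x}) ⟨by simp, (Finset.card_le_two).trans (by norm_num)⟩ ⟨hi, ?_⟩
    (Or.inr (Or.inl (by simp [hne]))) (Gain.zero _ _) (by simp [hne]) (by omega)
    (Or.inl ⟨0, Gain.zero _ _, by simp⟩)
  intro z hz
  rw [Finset.insert_eq_of_mem hz]
  simp only [Finset.mem_insert, Finset.mem_singleton] at hz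
  refine ⟨hi, ?_⟩
  rcases hz with rfl | rfl <;> omega

/-- Surplus two is the least possible, so all subsets of I have `sig` equal to two. Any three
vertices of I are then all in the cover or all out of it, and they have at least five neighbors. -/
theorem Expanding.win_triple (h : Expanding G) {I : Finset V} (hI : Ind G I) (h3 : 3 ≤ I.card)
    (hs : surplus G I ≤ 2) : Win G 2 3 2 5 := by
  obtain ⟨J, hJ, hJ3⟩ := Finset.exists_subset_card_eq h3
  have hJn : J.Nonempty := Finset.card_pos.1 (by omega)
  have hi := hI.mono hJ
  have h1 := sig_le hI hJ
  refine h.win (U := J) (X := J) ⟨hJn, hJ3.le⟩ ⟨hi, fun z hz => ?_⟩ (Or.inr (Or.inr ⟨hJ3, rfl⟩))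
    (Gain.zero _ _) (by omega) (h.le_sig hi hJn)
    (Or.inl ⟨0, Gain.zero _ _, by have := h.le_card_nbhd hi hJn; omega⟩)
  rw [Finset.insert_eq_of_mem hz]
  have h2 := sig_mono (J := {z}) hi (by simpa using hz)
  have h4 := h.le_sig (ind_singleton z) (by simp)
  exact ⟨hi, by omega⟩

/-! ### Sets of surplus three through a vertex of degree at least five -/

/-- Common assumptions of the case analysis: no good branching is available. -/
structure Stuck (G : SimpleGraph V) : Prop extends Nice G where
  not_win : ¬ TWin G

namespace Stuck

theorem surplus_ge (h : Stuck G) {I : Finset V} (hI : Ind G I) (h3 : 3 ≤ I.card) : 3 ≤ surplus G I := by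
  by_contra hcon
  exact h.not_win (Or.inl (h.exp.win_triple hI h3 (by omega)))

/-- A set of surplus two containing u would have at least 5 - 2 = 3 vertices, against `surplus_ge`.
-/
theorem sig_eq_three (h : Stuck G) {u : V} (hd : 5 ≤ dg G u) (hs : sig G {u} ≤ 3) : sig G {u} = 3 := by
  obtain ⟨I, hI, hu, he⟩ := exists_sig (ind_singleton (G := G) u)
  rw [Finset.singleton_subset_iff] at hu
  have h1 := dg_le_of_mem hI hu
  by_contra hcon
  have h2 := h.surplus_ge hI (by rw [surplus] at he; omega)
  omega

/-- Deleting w leaves x with degree two, hence a reduction. With `sig` at least 4, branching on w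
would have drops (1/2, 2) and (2, 5). -/
theorem sig_le_three (h : Stuck G) {w x : V} (hd : 5 ≤ dg G w) (hx : dg G x = 3) (hwx : G.Adj w x) :
    sig G {w} ≤ 3 := by
  by_contra hcon
  have hg : Gain 3 (delG G {w}) 1 := by
    refine h.exp.gain (U := {w}) (S := {x}) (by simp) (ind_singleton x) (by simpa using hwx.ne') ?_ (by simp)
    intro v hv
    rw [Finset.mem_singleton] at hv
    subst hv
    rw [Finset.card_sdiff_of_subset (by simpa [mem_nbhd_singleton] using hwx.symm)]
    rw [dg] at hx
    simp [hx]
  exact h.not_win (Or.inr (Or.inr (Or.inr (Or.inl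
    ((h.exp.win_single w (c₂ := 4) hg (by omega)).mono le_rfl hd)))))

/-- The branching on a blocker `x` of `u` with three neighbors. -/
theorem win_of_three (h : Stuck G) {u x : V} {g m : ℕ} (hdu : 5 ≤ dg G u) (hsu : sig G {u} ≤ 3)
    (hne : u ≠ x) {I : Finset V} (hI : Ind G I) (hu : u ∈ I) (hx : x ∈ I) (hs : surplus G I = 3)
    (hdx : dg G x = 3) (hpair : ∀ I, Ind G I → u ∈ I → x ∈ I → surplus G I = 3 →
      ∀ y ∈ I, y ≠ x → 3 ≤ surplus G {x, y}) (hg : Gain 3 (delG G {u, x}) g)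
    (hm : ∀ I, Ind G I → u ∈ I → x ∈ I → surplus G I = 3 → m + 1 ≤ I.card) :
    Win G 2 (2 + g) 2 (3 + m) := by
  have hsu' := h.sig_eq_three hdu hsu
  have hsub : ({u, x} : Finset V) ⊆ I := by
    intro w hw
    simp only [Finset.mem_insert, Finset.mem_singleton] at hw
    rcases hw with rfl | rfl <;> assumption
  have hi := hI.mono hsub
  have h1 : sig G {u, x} = 3 := by
    have := sig_le hI hsub
    have := sig_mono (J := {u}) hi (by simp)
    omega
  have h2 : surplus G {x} = 2 := by rw [surplus_singleton, hdx]; norm_num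
  have e : ({u, x} ∪ {x} : Finset V) = {u, x} := Finset.union_eq_left.2 (by simp)
  refine h.exp.win (U := {u, x}) (X := {x}) (by simp) ⟨ind_singleton x, ?_⟩ (Or.inr (Or.inl (by simp [hne])))
    hg (by simp [hne]) (by simpa using h.exp.le_sig (ind_singleton x) (by simp)) (Or.inr ?_)
  · intro z hz
    simp only [Finset.mem_insert, Finset.mem_singleton] at hz
    rcases hz with rfl | rfl
    · exact ⟨hi, by omega⟩
    · simpa using ind_singleton z
  · rw [e]
    refine ⟨hi, fun I' hI' hsub' hs' => ?_⟩
    rw [h1] at hs'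
    have hu' : u ∈ I' := hsub' (by simp)
    have hx' : x ∈ I' := hsub' (by simp)
    have hxs : ({x} : Finset V) ⊆ I' := by simpa using hx'
    have hcard := Finset.card_sdiff_add_card_eq_card hxs
    have hm' := hm I' hI' hu' hx' hs'
    rw [Finset.card_singleton] at hcard
    -- Relative to {x}, of surplus two, the set `I'` has one more. Its subsets through `x` also have
    -- surplus at least three: pairs by `hpair`, larger ones by `surplus_ge`. So the whole rest of
    -- `I'` is reduced at once after `x` is left out.
    refine ⟨critOne_sdiff hI' hxs ⟨u, by simp [hu', hne]⟩ (by omega) ?_, ?_⟩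
    · intro J hJ hn
      have hJI : J ∪ {x} ⊆ I' := Finset.union_subset (hJ.trans Finset.sdiff_subset) hxs
      have hc : (J ∪ {x}).card = J.card + 1 :=
        Finset.card_union_of_disjoint (Finset.sdiff_disjoint.mono_left hJ)
      rw [h2]
      by_cases hJ2 : 2 ≤ J.card
      · exact h.surplus_ge (hI'.mono hJI) (by omega)
      · have := hn.card_pos
        obtain ⟨y, rfl⟩ := Finset.card_eq_one.1 (show J.card = 1 by omega)
        have hy := Finset.mem_sdiff.1 (Finset.singleton_subset_iff.1 hJ)
        rw [Finset.union_comm]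
        exact hpair I' hI' hu' hx' hs' y hy.1 (by simpa using hy.2)
    · change 3 + m ≤ dg G x + _
      omega

/-- Suppose {x, y} has surplus two, hence four neighbors. Branch on "u, x, y all in the cover, or x
and y out". In the second branch the rest of I, which contains u, has surplus one and is critical,
so k drops by 4 + 1; the drops are (1, 3) and (1, 5). -/
theorem surplus_pair_ge (h : Stuck G) {u x y : V} (hdu : 5 ≤ dg G u) (hsu : sig G {u} ≤ 3)
    {I : Finset V} (hI : Ind G I) (hu : u ∈ I) (hx : x ∈ I) (hs : surplus G I = 3) (hxu : x ≠ u) (hy : y ∈ I)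
    (hxy : y ≠ x) : 3 ≤ surplus G {x, y} := by
  by_contra hcon
  have hsu' := h.sig_eq_three hdu hsu
  have hsxy : ({x, y} : Finset V) ⊆ I := by
    intro w hw
    simp only [Finset.mem_insert, Finset.mem_singleton] at hw
    rcases hw with rfl | rfl <;> assumption
  have hixy := hI.mono hsxy
  have hs2 := h.exp _ hixy (by simp)
  have hN : (nbhd G {x, y}).card = 4 := by
    rw [surplus, Finset.card_pair hxy.symm] at hs2 hcon; omega
  have hyu : y ≠ u := by
    rintro rfl
    have := dg_le_of_mem hixy (v := y) (by simp)
    omega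
  have hsub : ({u, x, y} : Finset V) ⊆ I := by
    intro w hw
    simp only [Finset.mem_insert, Finset.mem_singleton] at hw
    rcases hw with rfl | rfl | rfl <;> assumption
  have hi := hI.mono hsub
  have h1 : sig G {u, x, y} = 3 := by
    have := sig_le hI hsub
    have := sig_mono (J := {u}) hi (by simp)
    omega
  have hU : ({u, x, y} : Finset V).card = 3 := by
    rw [Finset.card_insert_of_notMem (by simp [hxu.symm, hyu.symm]), Finset.card_pair hxy.symm]
  have e : ({u, x, y} ∪ {x, y} : Finset V) = {u, x, y} := Finset.union_eq_left.2 (by simp)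
  have hsig2 : sig G {x, y} = 2 := by
    have := sig_le hixy le_rfl
    have := h.exp.le_sig hixy (by simp)
    omega
  refine h.not_win (Or.inl ?_)
  refine h.exp.win (U := {u, x, y}) (X := {x, y}) ⟨by simp, by rw [Finset.card_pair hxy.symm]; omega⟩
    ⟨hixy, ?_⟩ (Or.inr (Or.inr ⟨hU, rfl⟩)) (Gain.zero _ _) (by omega) (by omega) (Or.inr ?_)
  · intro z hz
    simp only [Finset.mem_insert, Finset.mem_singleton] at hz
    rcases hz with rfl | hz
    · exact ⟨hi, by omega⟩
    · rw [Finset.insert_eq_of_mem (by simpa using hz)]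
      have h2 := sig_mono (J := {z}) hixy (by simpa using hz)
      have h3 := h.exp.le_sig (ind_singleton z) (by simp)
      exact ⟨hixy, by omega⟩
  · rw [e]
    refine ⟨hi, fun I' hI' hsub' hs' => ?_⟩
    rw [h1] at hs'
    have hX' : ({x, y} : Finset V) ⊆ I' := (by simp : ({x, y} : Finset V) ⊆ {u, x, y}).trans hsub'
    have hu' : u ∈ I' \ {x, y} := by
      simp only [Finset.mem_sdiff, Finset.mem_insert, Finset.mem_singleton]
      exact ⟨hsub' (by simp), by tauto⟩
    refine ⟨critOne_sdiff hI' hX' ⟨u, hu'⟩ (by omega) ?_, ?_⟩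
    · intro J hJ hn
      have hJI : J ∪ {x, y} ⊆ I' := Finset.union_subset (hJ.trans Finset.sdiff_subset) hX'
      have hc : (J ∪ {x, y}).card = J.card + 2 := by
        rw [Finset.card_union_of_disjoint (Finset.sdiff_disjoint.mono_left hJ), Finset.card_pair hxy.symm]
      have := hn.card_pos
      have := h.surplus_ge (hI'.mono hJI) (by omega)
      omega
    · have := Finset.card_pos.2 ⟨u, hu'⟩
      omega

/-- If sig{x} = 3, then branching on {u, x} gives (1, 2) and (3/2, 5). So x lies in a set B of
surplus two with at most two vertices and four neighbors. If deg x ≠ 3, then B = {x, y} with N(y) ⊆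
N(x). Inside I this contradicts `surplus_pair_ge`; outside I, adding y to I yields surplus two on at
least three vertices. -/
theorem dg_eq_three (h : Stuck G) {u x : V} (hdu : 5 ≤ dg G u) (hsu : sig G {u} ≤ 3)
    {I : Finset V} (hI : Ind G I) (hu : u ∈ I) (hx : x ∈ I) (hs : surplus G I = 3) (hxu : x ≠ u) :
    dg G x = 3 := by
  have hsu' := h.sig_eq_three hdu hsu
  have hdx := h.exp.three_le_dg x
  have hsx3 : sig G {x} ≤ 3 := hs ▸ sig_le hI (by simpa using hx)
  have hsx2 := h.exp.le_sig (ind_singleton x) (by simp)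
  have hsub : ({u, x} : Finset V) ⊆ I := by
    intro w hw
    simp only [Finset.mem_insert, Finset.mem_singleton] at hw
    rcases hw with rfl | rfl <;> assumption
  have hsx : sig G {x} = 2 := by
    by_contra hcon
    have h1 := h.exp.win_pair hxu.symm hI hu hx (c := 3) hs hsu' (by omega)
    have h2 := dg_le_of_mem (hI.mono hsub) (v := u) (by simp)
    exact h.not_win (Or.inr (Or.inr (Or.inr (Or.inr (h1.mono le_rfl (by omega))))))
  obtain ⟨B, hB, hxB, hBs⟩ := exists_sig (ind_singleton (G := G) x)
  rw [hsx] at hBs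
  rw [Finset.singleton_subset_iff] at hxB
  have hB2 : B.card ≤ 2 := by
    by_contra hcon
    have := h.surplus_ge hB (by omega)
    omega
  have hdB := dg_le_of_mem hB hxB
  have hBp := Finset.card_pos.2 ⟨x, hxB⟩
  rw [surplus] at hBs
  by_contra hcon
  have hB2' : B.card = 2 := by omega
  obtain ⟨y, hy⟩ : ∃ y, B.erase x = {y} := by
    rw [← Finset.card_eq_one, Finset.card_erase_of_mem hxB]; omega
  have hyB := Finset.mem_erase.1 (hy ▸ Finset.mem_singleton_self y : y ∈ B.erase x)
  have hN : nbhd G {x} = nbhd G B :=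
    Finset.eq_of_subset_of_card_le (hB.nbhd_mono (by simpa using hxB)) (by
      change _ ≤ dg G x; omega)
  have hyx : ∀ w, G.Adj y w → G.Adj x w := fun w hw => by
    rw [← mem_nbhd_singleton, hN]
    exact hB.mem_nbhd hyB.2 hw
  have hBxy : {x, y} = B := by rw [← Finset.insert_erase hxB, hy]
  by_cases hyI : y ∈ I
  · have := h.surplus_pair_ge hdu hsu hI hu hx hs hxu hyI hyB.1
    rw [hBxy, surplus] at this
    omega
  · have hyI' : ∀ w ∈ I, ¬ G.Adj y w := fun w hw hyw => hI x hx w hw (hyx w hyw)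
    have hins : Ind G (insert y I) := by
      intro a ha b hb hab
      rw [Finset.mem_insert] at ha hb
      rcases ha with rfl | ha <;> rcases hb with rfl | hb
      · exact hab.ne rfl
      · exact hyI' b hb hab
      · exact hyI' a ha hab.symm
      · exact hI a ha b hb hab
    have hNN : nbhd G (insert y I) ⊆ nbhd G I := by
      intro w hw
      obtain ⟨h1, v, hv, hvw⟩ := mem_nbhd.1 hw
      rw [Finset.mem_insert] at hv
      rcases hv with rfl | hv
      · exact hI.mem_nbhd hx (hyx w hvw)
      · exact hI.mem_nbhd hv hvw
    have h1 := Finset.card_le_card hNN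
    have h2 := Finset.card_insert_of_notMem hyI
    have h3 := Finset.card_le_card hsub
    rw [Finset.card_pair hxu.symm] at h3
    have h4 := h.surplus_ge hins (by omega)
    rw [surplus] at h4 hs
    omega

/-- The branching on a blocker of `u`. -/
theorem win_blocker (h : Stuck G) {u x : V} {g m : ℕ} (hdu : 5 ≤ dg G u) (hsu : sig G {u} ≤ 3)
    (hne : u ≠ x) {I : Finset V} (hI : Ind G I) (hu : u ∈ I) (hx : x ∈ I) (hs : surplus G I = 3)
    (hg : Gain 3 (delG G {u, x}) g)
    (hm : ∀ I, Ind G I → u ∈ I → x ∈ I → surplus G I = 3 → m + 1 ≤ I.card) :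
    Win G 2 (2 + g) 2 (3 + m) :=
  h.win_of_three hdu hsu hne hI hu hx hs (h.dg_eq_three hdu hsu hI hu hx hs hne.symm)
    (fun _ hI' hu' hx' hs' _ hy hyx => h.surplus_pair_ge hdu hsu hI' hu' hx' hs' hne.symm hy hyx) hg hm

/-! ### Heavy vertices and their blockers -/

/-- Vertices of degree at least five next to a vertex of degree three. -/
def Heavy (G : SimpleGraph V) (u : V) : Prop := 5 ≤ dg G u ∧ ∃ x, dg G x = 3 ∧ G.Adj u x

theorem card_sdiff_pair_le {N : Finset V} {u x : V} {k : ℕ} (hN : N.card ≤ k + 1) (hu : u ∈ N) :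
    (N \ {u, x}).card ≤ k := by
  have : N \ {u, x} ⊆ N.erase u := by
    intro w
    simp only [Finset.mem_sdiff, Finset.mem_insert, Finset.mem_singleton, Finset.mem_erase]
    tauto
  have h1 := Finset.card_le_card this
  rw [Finset.card_erase_of_mem hu] at h1
  omega

theorem card_sdiff_pair_le' {N : Finset V} {u x : V} {k : ℕ} (hux : u ≠ x) (hN : N.card ≤ k + 2) (hu : u ∈ N)
    (hx : x ∈ N) : (N \ {u, x}).card ≤ k := by
  rw [Finset.card_sdiff_of_subset, Finset.card_pair hux]
  · omega
  · intro w hw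
    simp only [Finset.mem_insert, Finset.mem_singleton] at hw
    rcases hw with rfl | rfl <;> assumption

theorem surplus_two {u x : V} (hux : u ≠ x) : surplus G {u, x} = (nbhd G {u, x}).card - 2 := by
  rw [surplus, Finset.card_pair hux]; rfl

theorem eq_pair {I : Finset V} {u x : V} (hux : u ≠ x) (hu : u ∈ I) (hx : x ∈ I) (hI : I.card ≤ 2) :
    {u, x} = I := by
  refine Finset.eq_of_subset_of_card_le ?_ (by rw [Finset.card_pair hux]; exact hI)
  intro w hw
  simp only [Finset.mem_insert, Finset.mem_singleton] at hw
  rcases hw with rfl | rfl <;> assumption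

/-- A set of small surplus containing `u` has another element that shares a neighbor with `u`. -/
theorem exists_common {u : V} (h : Expanding G) {I : Finset V} (hI : Ind G I) (hu : u ∈ I)
    (hd : surplus G I + 1 < dg G u) :
    ∃ x ∈ I, x ≠ u ∧ ∃ a, G.Adj u a ∧ G.Adj x a := by
  by_contra! hcon
  -- Without a shared neighbor the two neighborhoods are disjoint. If I has other elements, their
  -- neighborhood has at least |I| + 1 vertices, so I would have surplus at least deg u + 1; if I =
  -- {u}, the surplus is deg u - 1.
  have h1 : Disjoint (nbhd G {u}) (nbhd G (I.erase u)) := by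
    rw [Finset.disjoint_left]
    intro a ha ha'
    obtain ⟨_, x, hx, hxa⟩ := mem_nbhd.1 ha'
    rw [Finset.mem_erase] at hx
    exact hcon x hx.2 hx.1 a (mem_nbhd_singleton.1 ha) hxa
  have h2 : nbhd G {u} ∪ nbhd G (I.erase u) ⊆ nbhd G I :=
    Finset.union_subset (hI.nbhd_mono (by simpa using hu)) (hI.nbhd_mono (Finset.erase_subset _ _))
  have h3 := Finset.card_le_card h2
  rw [Finset.card_union_of_disjoint h1] at h3
  have h4 := Finset.card_erase_of_mem hu
  have h5 := Finset.card_pos.2 ⟨u, hu⟩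
  rw [surplus] at hd
  change dg G u + _ ≤ _ at h3
  rcases (I.erase u).eq_empty_or_nonempty with he | hn
  · rw [he, Finset.card_empty] at h4
    omega
  · have := h.le_card_nbhd (hI.mono (Finset.erase_subset u I)) hn
    omega

/-- Otherwise all neighbors of the degree-three vertex x ∈ I have degree at most four, so deleting u
and x leaves their common neighbors with degree at most two. If {u, x} has surplus three, then N(x)
⊆ N(u), and two such neighbors yield (1, 4), (1, 4). If not, the sets of surplus three through u and
x have at least three vertices, and one common neighbor yields (1, 3), (1, 5). -/
theorem exists_heavy (h : Stuck G) {u : V} (hdu : 5 ≤ dg G u) (hsu : sig G {u} ≤ 3) : ∃ w, Heavy G w := by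
  by_contra! hcon
  have hsu' := h.sig_eq_three hdu hsu
  obtain ⟨I, hI, hu, hs⟩ := exists_sig (ind_singleton (G := G) u)
  rw [Finset.singleton_subset_iff] at hu
  rw [hsu'] at hs
  obtain ⟨x, hx, hxu, a, hua, hxa⟩ := exists_common h.exp hI hu (by omega)
  have hdx := h.dg_eq_three hdu hsu hI hu hx hs hxu
  have hle : ∀ w, G.Adj x w → dg G w ≤ 4 := fun w hw => by
    by_contra hlt
    exact hcon w ⟨by omega, x, hdx, hw.symm⟩
  have hux : ¬ G.Adj u x := hI u hu x hx
  by_cases hs2 : surplus G {u, x} = 3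
  · have hN : (nbhd G {u, x}).card = 5 := by rw [surplus_two hxu.symm] at hs2; omega
    have hi := Ind.pair hux
    have hNu : nbhd G {u} = nbhd G {u, x} :=
      Finset.eq_of_subset_of_card_le (hi.nbhd_mono (by simp)) (by rw [hN]; exact hdu)
    have hNx : nbhd G {x} ⊆ nbhd G {u} := by rw [hNu]; exact hi.nbhd_mono (by simp)
    obtain ⟨S, hS, hS2⟩ := Finset.exists_subset_card_eq (show 2 ≤ (nbhd G {x}).card by
      change 2 ≤ dg G x; omega)
    have hg : Gain 3 (delG G {u, x}) S.card := by
      refine h.exp.gain (Finset.card_le_two) ((h.indep x hdx).mono hS) ?_ ?_ (by omega)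
      · rw [Finset.disjoint_left]
        intro w hw hw'
        simp only [Finset.mem_insert, Finset.mem_singleton] at hw'
        have h1 := mem_nbhd_singleton.1 (hS hw)
        have h2 := mem_nbhd_singleton.1 (hNx (hS hw))
        rcases hw' with rfl | rfl
        · exact h2.ne rfl
        · exact h1.ne rfl
      · intro w hw
        have h1 := mem_nbhd_singleton.1 (hS hw)
        have h2 := mem_nbhd_singleton.1 (hNx (hS hw))
        exact card_sdiff_pair_le' hxu.symm (hle w h1) (mem_nbhd_singleton.2 h2.symm) (mem_nbhd_singleton.2 h1.symm)
    rw [hS2] at hg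
    refine h.not_win (Or.inr (Or.inl (h.win_blocker (m := 1) hdu hsu hxu.symm hI hu hx hs hg ?_)))
    intro I' _ hu' hx' _
    exact Finset.one_lt_card.2 ⟨u, hu', x, hx', hxu.symm⟩
  · have hg : Gain 3 (delG G {u, x}) ({a} : Finset V).card := by
      refine h.exp.gain (Finset.card_le_two) (ind_singleton a) ?_ ?_ (by simp)
      · simp only [Finset.disjoint_singleton_left, Finset.mem_insert, Finset.mem_singleton, not_or]
        exact ⟨hua.ne', hxa.ne'⟩
      · intro w hw
        rw [Finset.mem_singleton] at hw
        subst hw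
        exact card_sdiff_pair_le' hxu.symm (hle w hxa) (mem_nbhd_singleton.2 hua.symm) (mem_nbhd_singleton.2 hxa.symm)
    refine h.not_win (Or.inl (h.win_blocker (m := 2) hdu hsu hxu.symm hI hu hx hs hg ?_))
    intro I' _ hu' hx' hs'
    by_contra hlt
    rw [← eq_pair hxu.symm hu' hx' (by omega)] at hs'
    exact hs2 hs'

/-- `x` has three neighbors, all of them neighbors of `u`. -/
def Blocks (G : SimpleGraph V) (u x : V) : Prop :=
  x ≠ u ∧ ¬ G.Adj u x ∧ dg G x = 3 ∧ ∀ w, G.Adj x w → G.Adj u w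

/-- If {u, x} does not have surplus three, the sets of surplus three through u and x have at least
three vertices. The degree-three neighbor of u then adds a reduction to the first branch, and (1,
3), (1, 5) results. So u and x together have exactly five neighbors, all of them neighbors of u. -/
theorem Heavy.exists_blocks (h : Stuck G) {u : V} (hu : Heavy G u) : dg G u = 5 ∧ ∃ x, Blocks G u x := by
  obtain ⟨hdu, x₀, hdx₀, hux₀⟩ := hu
  have hsu := h.sig_le_three hdu hdx₀ hux₀
  have hsu' := h.sig_eq_three hdu hsu
  obtain ⟨I, hI, hu, hs⟩ := exists_sig (ind_singleton (G := G) u)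
  rw [Finset.singleton_subset_iff] at hu
  rw [hsu'] at hs
  obtain ⟨x, hx, hxu, -⟩ := exists_common h.exp hI hu (by omega)
  have hdx := h.dg_eq_three hdu hsu hI hu hx hs hxu
  have hux : ¬ G.Adj u x := hI u hu x hx
  by_cases hs2 : surplus G {u, x} = 3
  · have hN : (nbhd G {u, x}).card = 5 := by rw [surplus_two hxu.symm] at hs2; omega
    have hi := Ind.pair hux
    have hNu : nbhd G {u} = nbhd G {u, x} :=
      Finset.eq_of_subset_of_card_le (hi.nbhd_mono (by simp)) (by rw [hN]; exact hdu)
    refine ⟨by rw [dg, hNu, hN], x, hxu, hux, hdx, fun w hw => ?_⟩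
    rw [← mem_nbhd_singleton, hNu]
    exact hi.mem_nbhd (by simp) hw
  · exfalso
    have hg : Gain 3 (delG G {u, x}) ({x₀} : Finset V).card := by
      refine h.exp.gain (Finset.card_le_two) (ind_singleton x₀) ?_ ?_ (by simp)
      · simp only [Finset.disjoint_singleton_left, Finset.mem_insert, Finset.mem_singleton, not_or]
        exact ⟨hux₀.ne', fun e => hux (e ▸ hux₀)⟩
      · intro w hw
        rw [Finset.mem_singleton] at hw
        subst hw
        exact card_sdiff_pair_le hdx₀.le (mem_nbhd_singleton.2 hux₀.symm)
    refine h.not_win (Or.inl (h.win_blocker (m := 2) hdu hsu hxu.symm hI hu hx hs hg ?_))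
    intro I' _ hu' hx' hs'
    by_contra hlt
    rw [← eq_pair hxu.symm hu' hx' (by omega)] at hs'
    exact hs2 hs'

/-- No reductions of total value two after deletion of a heavy vertex and its blocker. -/
theorem not_gain_two (h : Stuck G) {u x : V} (hu : Heavy G u) (hux : Blocks G u x) :
    ¬ Gain 3 (delG G {u, x}) 2 := by
  intro hg
  have hd5 := (Heavy.exists_blocks h hu).1
  obtain ⟨hdu, x₀, hdx₀, hux₀⟩ := hu
  have hsu := h.sig_le_three hdu hdx₀ hux₀
  obtain ⟨hxu, hna, hdx, hsub⟩ := hux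
  have hi := Ind.pair hna
  have hN : nbhd G {u, x} = nbhd G {u} := by
    refine Finset.Subset.antisymm (fun w hw => ?_) (hi.nbhd_mono (by simp))
    obtain ⟨_, v, hv, hvw⟩ := mem_nbhd.1 hw
    simp only [Finset.mem_insert, Finset.mem_singleton] at hv
    rw [mem_nbhd_singleton]
    rcases hv with rfl | rfl
    · exact hvw
    · exact hsub w hvw
  have hs : surplus G {u, x} = 3 := by
    rw [surplus_two hxu.symm, hN]
    change (dg G u : ℤ) - 2 = 3
    omega
  refine h.not_win (Or.inr (Or.inl (h.win_blocker (m := 1) hdu hsu hxu.symm hi (by simp) (by simp) hs hg ?_)))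
  intro I' _ hu' hx' _
  exact Finset.one_lt_card.2 ⟨u, hu', x, hx', hxu.symm⟩

/-- Each such vertex keeps at most two neighbors once u and x are deleted. Two of them are
non-adjacent, because neighborhoods of degree-three vertices are independent, and would give the two
reductions excluded by `not_gain_two`. -/
theorem light_unique (h : Stuck G) {u x : V} (hu : Heavy G u) (hux : Blocks G u x) {v w : V}
    (hv : G.Adj u v) (hw : G.Adj u w) (hv' : dg G v = 3 ∨ G.Adj x v ∧ dg G v ≤ 4)
    (hw' : dg G w = 3 ∨ G.Adj x w ∧ dg G w ≤ 4) : v = w := by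
  by_contra hne
  have hvw : ¬ G.Adj v w := by
    intro hvw
    rcases hv' with hv' | hv'
    · exact h.indep v hv' u (mem_nbhd_singleton.2 hv.symm) w (mem_nbhd_singleton.2 hvw) hw
    · rcases hw' with hw' | hw'
      · exact h.indep w hw' u (mem_nbhd_singleton.2 hw.symm) v (mem_nbhd_singleton.2 hvw.symm) hv
      · exact h.indep x hux.2.2.1 v (mem_nbhd_singleton.2 hv'.1) w (mem_nbhd_singleton.2 hw'.1) hvw
  have key : ∀ z, G.Adj u z → (dg G z = 3 ∨ G.Adj x z ∧ dg G z ≤ 4) → (nbhd G {z} \ {u, x}).card ≤ 2 := by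
    intro z hz hz'
    rcases hz' with hz' | hz'
    · exact card_sdiff_pair_le hz'.le (mem_nbhd_singleton.2 hz.symm)
    · exact card_sdiff_pair_le' hux.1.symm hz'.2 (mem_nbhd_singleton.2 hz.symm) (mem_nbhd_singleton.2 hz'.1.symm)
  apply h.not_gain_two hu hux
  have := h.exp.gain (U := {u, x}) (S := {v, w}) Finset.card_le_two (Ind.pair hvw) ?_ ?_
    (by rw [Finset.card_pair hne]; omega)
  · rwa [Finset.card_pair hne] at this
  · rw [Finset.disjoint_left]
    intro z hz hz'
    simp only [Finset.mem_insert, Finset.mem_singleton] at hz hz'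
    have hz : G.Adj u z := by rcases hz with rfl | rfl <;> assumption
    rcases hz' with rfl | rfl
    · exact hz.ne rfl
    · exact hux.2.1 hz
  · intro z hz
    simp only [Finset.mem_insert, Finset.mem_singleton] at hz
    rcases hz with rfl | rfl
    · exact key _ hv hv'
    · exact key _ hw hw'

/-- Suppose u and t are adjacent and delete u and x. Then t keeps one or two neighbors, all of them
in N(b), and b keeps exactly three. Reducing t removes one of these three or merges two of them, so
b has at most two neighbors left and gives a second reduction, against `not_gain_two`. -/
theorem not_adj_of_blocks (h : Stuck G) {u x b t : V} (hu : Heavy G u) (hux : Blocks G u x) (hb : Heavy G b)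
    (hxb : G.Adj x b) (hbt : Blocks G b t) : ¬ G.Adj u t := by
  intro hut
  apply h.not_gain_two hu hux
  have hd5 := (Heavy.exists_blocks h hb).1
  have hbx := hxb.symm
  have hub : G.Adj u b := hux.2.2.2 b hxb
  obtain ⟨htb, hnbt, hdt, hsub⟩ := hbt
  have htx : t ≠ x := fun e => hux.2.1 (e ▸ hut)
  have htU : Disjoint ({t} : Finset V) {u, x} := by
    simp only [Finset.disjoint_singleton_left, Finset.mem_insert, Finset.mem_singleton, not_or]
    exact ⟨hut.ne', htx⟩
  have hNt := nbhd_delG_of_disjoint (G := G) htU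
  have hbU : b ∉ ({u, x} : Finset V) := by
    simp only [Finset.mem_insert, Finset.mem_singleton, not_or]
    exact ⟨hub.ne', hxb.ne'⟩
  have huN : u ∈ nbhd G {t} := mem_nbhd_singleton.2 hut.symm
  have hNtle : (nbhd (delG G {u, x}) {t}).card ≤ 2 := by
    rw [hNt]; exact card_sdiff_pair_le hdt.le huN
  have hNtge : 1 ≤ (nbhd (delG G {u, x}) {t}).card := by
    rw [hNt]
    have h1 := Finset.le_card_sdiff {u, x} (nbhd G {t})
    have h2 : ({u, x} : Finset V).card ≤ 2 := Finset.card_le_two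
    rw [dg] at hdt
    omega
  have hNtb : nbhd (delG G {u, x}) {t} ⊆ nbhd G {b} \ {u, x} := by
    rw [hNt]
    refine Finset.sdiff_subset_sdiff (fun w hw => ?_) le_rfl
    rw [mem_nbhd_singleton] at hw ⊢
    exact hsub w hw
  have hb3 : (nbhd G {b} \ {u, x}).card = 3 := by
    rw [Finset.card_sdiff_of_subset, Finset.card_pair hux.1.symm]
    · change dg G b - 2 = 3; omega
    · intro w hw
      simp only [Finset.mem_insert, Finset.mem_singleton] at hw
      rcases hw with rfl | rfl
      · exact mem_nbhd_singleton.2 hub.symm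
      · exact mem_nbhd_singleton.2 hbx
  have hbt : b ∉ {t} ∪ nbhd (delG G {u, x}) {t} := by
    rw [Finset.mem_union, Finset.mem_singleton]
    rintro (e | h1)
    · exact htb e.symm
    · have := hNtb h1
      rw [Finset.mem_sdiff, mem_nbhd_singleton] at this
      exact this.1.ne rfl
  refine (Gain.vertex (m := 1) (c := 2) t (Finset.card_pos.1 hNtge) hNtle ?_ ?_ ?_).mono (by norm_num) le_rfl
  · intro h1
    have h2 : nbhd (delG (delG G {u, x}) ({t} ∪ nbhd (delG G {u, x}) {t})) {b} =
        (nbhd G {b} \ {u, x}) \ nbhd (delG G {u, x}) {t} := by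
      rw [nbhd_delG_of_disjoint (by simpa using hbt), nbhd_delG_of_disjoint (by simpa using hbU)]
      ext w
      have : G.Adj b w → w ≠ t := fun h e => hnbt (e ▸ h)
      simp only [Finset.mem_sdiff, Finset.mem_union, Finset.mem_singleton, mem_nbhd_singleton (w := w) (v := b)]
      tauto
    have h3 : (nbhd (delG (delG G {u, x}) ({t} ∪ nbhd (delG G {u, x}) {t})) {b}).card = 2 := by
      rw [h2, Finset.card_sdiff_of_subset hNtb, hb3, h1]
    exact Gain.one (v := b) (Finset.card_pos.1 (by omega)) h3.le
  · intro _ h2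
    exact absurd (fun a ha b hb hab => h.indep t hdt a (by
      rw [hNt] at ha; exact (Finset.mem_sdiff.1 ha).1) b (by
      rw [hNt] at hb; exact (Finset.mem_sdiff.1 hb).1) (delG_le _ _ hab)) h2
  · intro h1 _ y hy
    refine Gain.one (v := b) ⟨y, ?_⟩ ?_
    · have h2 := hNtb hy
      rw [Finset.mem_sdiff, mem_nbhd_singleton] at h2
      rw [mem_nbhd_singleton]
      exact ((conG_adj_left hy).2 ⟨hbt, y, hy, h2.1.symm, h2.2, hbU⟩).symm
    · have h2 : nbhd (conG (delG G {u, x}) {t} y) {b} ⊆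
          insert y ((nbhd G {b} \ {u, x}) \ nbhd (delG G {u, x}) {t}) := by
        intro w hw
        rw [mem_nbhd_singleton] at hw
        rw [Finset.mem_insert, Finset.mem_sdiff, Finset.mem_sdiff, mem_nbhd_singleton]
        rcases conG_adj_cases hw with ⟨_, h4, h5⟩ | ⟨h4, _⟩ | ⟨h4, _⟩
        · rw [Finset.mem_union] at h4
          exact Or.inr ⟨⟨h5.1, h5.2.2⟩, fun h6 => h4 (Or.inr h6)⟩
        · exact absurd (Finset.mem_union_right _ (h4 ▸ hy)) hbt
        · exact Or.inl h4
      have h3 := (Finset.card_le_card h2).trans (Finset.card_insert_le _ _)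
      rw [Finset.card_sdiff_of_subset hNtb, hb3, h1] at h3
      exact h3

/-- At most one of the three neighbors of x has degree at most four, by `light_unique`; the others
are heavy because of x. -/
theorem two_le_heavy (h : Stuck G) {u x : V} (hu : Heavy G u) (hux : Blocks G u x) :
    ∃ T : Finset V, T.card = 2 ∧ ∀ b ∈ T, G.Adj x b ∧ Heavy G b := by
  classical
  have h1 : ((nbhd G {x}).filter fun v => dg G v ≤ 4).card ≤ 1 := by
    rw [Finset.card_le_one]
    intro v hv w hw
    rw [Finset.mem_filter, mem_nbhd_singleton] at hv hw
    exact h.light_unique hu hux (hux.2.2.2 v hv.1) (hux.2.2.2 w hw.1) (Or.inr hv) (Or.inr hw)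
  have h2 := Finset.card_filter_add_card_filter_not (s := nbhd G {x}) (fun v => dg G v ≤ 4)
  have h3 : (nbhd G {x}).card = 3 := hux.2.2.1
  obtain ⟨T, hT, hT2⟩ := Finset.exists_subset_card_eq
    (show 2 ≤ ((nbhd G {x}).filter fun v => ¬ dg G v ≤ 4).card by omega)
  refine ⟨T, hT2, fun b hb => ?_⟩
  have := hT hb
  rw [Finset.mem_filter, mem_nbhd_singleton] at this
  exact ⟨this.1, by omega, x, hux.2.2.1, this.1.symm⟩

/-- Let b be a heavy neighbor of a common blocker x, and t a blocker of b. All of u, u', x are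
neighbors of b and none is adjacent to t, so t would have at most 5 - 3 = 2 neighbors. -/
theorem blocks_injective (h : Stuck G) {u u' x : V} (hu : Heavy G u) (hux : Blocks G u x) (hu' : Heavy G u')
    (hux' : Blocks G u' x) : u = u' := by
  by_contra hne
  obtain ⟨T, hT, hTb⟩ := h.two_le_heavy hu hux
  obtain ⟨b, hb⟩ := Finset.card_pos.1 (by omega : 0 < T.card)
  obtain ⟨hxb, hbH⟩ := hTb b hb
  obtain ⟨hd5, t, hbt⟩ := Heavy.exists_blocks h hbH
  have h1 := h.not_adj_of_blocks hu hux hbH hxb hbt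
  have h2 := h.not_adj_of_blocks hu' hux' hbH hxb hbt
  have h3 : ¬ G.Adj x t := fun h3 => h1 (hux.2.2.2 t h3)
  have h4 : nbhd G {t} ⊆ nbhd G {b} \ {u, u', x} := by
    intro w hw
    rw [mem_nbhd_singleton] at hw
    simp only [Finset.mem_sdiff, mem_nbhd_singleton, Finset.mem_insert, Finset.mem_singleton, not_or]
    refine ⟨hbt.2.2.2 w hw, ?_, ?_, ?_⟩ <;> rintro rfl
    · exact h1 hw.symm
    · exact h2 hw.symm
    · exact h3 hw.symm
  have h5 : ({u, u', x} : Finset V) ⊆ nbhd G {b} := by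
    intro w hw
    simp only [Finset.mem_insert, Finset.mem_singleton] at hw
    rw [mem_nbhd_singleton]
    rcases hw with rfl | rfl | rfl
    · exact (hux.2.2.2 b hxb).symm
    · exact (hux'.2.2.2 b hxb).symm
    · exact hxb.symm
  have h6 : ({u, u', x} : Finset V).card = 3 := by
    rw [Finset.card_insert_of_notMem (by simp [hne, hux.1.symm]), Finset.card_pair hux'.1.symm]
  have h7 := Finset.card_le_card h4
  rw [Finset.card_sdiff_of_subset h5, h6] at h7
  change dg G t ≤ dg G b - 3 at h7
  have := hbt.2.2.1
  omega

/-- Choose a blocker for each heavy vertex; the choice is injective. A heavy vertex is adjacent to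
at most one chosen blocker, as blockers have degree three (`light_unique`), while each blocker is
adjacent to at least two heavy vertices. Double counting these adjacencies is contradictory. -/
theorem not_heavy (h : Stuck G) (u : V) : ¬ Heavy G u := by
  classical
  intro hu
  have hβ : ∀ u, ∃ x, Heavy G u → Blocks G u x := fun u => by
    by_cases hu : Heavy G u
    · obtain ⟨x, hx⟩ := (Heavy.exists_blocks h hu).2
      exact ⟨x, fun _ => hx⟩
    · exact ⟨u, fun h => absurd h hu⟩
  choose β hβ using hβ
  set T := Finset.univ.filter fun u => Heavy G u
  have hT : ∀ v, v ∈ T ↔ Heavy G v := fun v => by simp [T]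
  have hinj : Set.InjOn β T := by
    intro a ha b hb e
    have ha' := (hT a).1 ha
    have hb' := (hT b).1 hb
    exact h.blocks_injective ha' (hβ a ha') hb' (e ▸ hβ b hb')
  have h1 := Finset.sum_card_bipartiteAbove_eq_sum_card_bipartiteBelow (s := T) (t := T.image β) (fun u x => G.Adj u x)
  have h2 : ∑ a ∈ T, (Finset.bipartiteAbove (fun u x => G.Adj u x) (T.image β) a).card ≤ ∑ a ∈ T, 1 := by
    refine Finset.sum_le_sum fun a ha => Finset.card_le_one.2 fun v hv w hw => ?_
    have ha' := (hT a).1 ha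
    rw [Finset.mem_bipartiteAbove, Finset.mem_image] at hv hw
    obtain ⟨⟨v', hv', rfl⟩, hv2⟩ := hv
    obtain ⟨⟨w', hw', rfl⟩, hw2⟩ := hw
    exact h.light_unique ha' (hβ a ha') hv2 hw2 (Or.inl (hβ v' ((hT v').1 hv')).2.2.1)
      (Or.inl (hβ w' ((hT w').1 hw')).2.2.1)
  have h3 : ∑ b ∈ T.image β, 2 ≤ ∑ b ∈ T.image β, (Finset.bipartiteBelow (fun u x => G.Adj u x) T b).card := by
    refine Finset.sum_le_sum fun b hb => ?_
    obtain ⟨v, hv, rfl⟩ := Finset.mem_image.1 hb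
    have hv' := (hT v).1 hv
    obtain ⟨S, hS, hSb⟩ := h.two_le_heavy hv' (hβ v hv')
    rw [← hS]
    refine Finset.card_le_card fun w hw => ?_
    rw [Finset.mem_bipartiteBelow, hT]
    exact ⟨(hSb w hw).2, (hSb w hw).1.symm⟩
  rw [Finset.sum_const, Finset.card_image_of_injOn hinj] at h3
  rw [Finset.sum_const] at h2
  have h4 := Finset.card_pos.2 ⟨u, (hT u).2 hu⟩
  simp only [smul_eq_mul] at h2 h3
  omega

/-- In a graph without good branchings, vertices of degree at least five are in no set of surplus three. -/
theorem four_le_sig (h : Stuck G) {u : V} (hdu : 5 ≤ dg G u) : 4 ≤ sig G {u} := by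
  by_contra hcon
  obtain ⟨w, hw⟩ := h.exists_heavy hdu (by omega)
  exact h.not_heavy w hw

theorem dg_le_four (h : Stuck G) {x a : V} (hdx : dg G x = 3) (hxa : G.Adj x a) : dg G a ≤ 4 := by
  by_contra hcon
  exact h.not_heavy a ⟨by omega, x, hdx, hxa.symm⟩

end Stuck

theorem Win.mono_drop {c₁ k₁ c₂ k₂ c₁' c₂' : ℕ} (h : Win G c₁ k₁ c₂ k₂) (h₁ : c₁' ≤ c₁) (h₂ : c₂' ≤ c₂) :
    Win G c₁' k₁ c₂' k₂ := by
  obtain ⟨U, X, h3, h4, h5, ⟨h6, h7⟩, h8, h9⟩ := h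
  exact ⟨U, X, h3, h4, h5, ⟨by omega, h7⟩, by omega, h9⟩

theorem exists_ne_of_surplus {I : Finset V} {u : V} (hI : Ind G I) (hu : u ∈ I)
    (hd : surplus G I + 1 < dg G u) : ∃ x ∈ I, u ≠ x := by
  have h1 := dg_le_of_mem hI hu
  rw [surplus] at hd
  obtain ⟨x, hx, hxu⟩ := Finset.exists_mem_ne (show 1 < I.card by omega) u
  exact ⟨x, hx, hxu.symm⟩

/-- The branchings on a vertex of degree at least four. -/
theorem Nice.win_of_four_le (h : Nice G) {u : V} (hd : 4 ≤ dg G u) : Win G 1 1 3 4 ∨ Win G 2 2 2 4 := by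
  have h2 := h.exp.le_sig (ind_singleton u) (by simp)
  by_cases h3 : 3 ≤ sig G {u}
  · exact Or.inl ((h.exp.win_single u (c₂ := 3) (Gain.zero _ _) h3).mono (by simp) hd)
  · right
    obtain ⟨I, hI, hu, hs⟩ := exists_sig (ind_singleton (G := G) u)
    rw [Finset.singleton_subset_iff] at hu
    obtain ⟨x, hx, hux⟩ := exists_ne_of_surplus hI hu (by omega)
    have hsx : sig G {x} = 2 := by
      have := sig_le hI (Finset.singleton_subset_iff.2 hx)
      have := h.exp.le_sig (ind_singleton x) (by simp)
      omega
    refine (h.exp.win_pair hux hI hu hx (c := 2) (by omega) (by omega) (by omega)).mono le_rfl ?_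
    have hi : Ind G {u, x} := Ind.pair (hI u hu x hx)
    exact hd.trans (dg_le_of_mem hi (by simp))

/-- The branchings on a vertex of degree at least five. -/
theorem Nice.win_of_five_le (h : Nice G) {u : V} (hd : 5 ≤ dg G u) : TWin G ∨ Win G 1 1 4 5 := by
  by_cases hw : TWin G
  · exact Or.inl hw
  · have hs : Stuck G := ⟨h, hw⟩
    exact Or.inr ((h.exp.win_single u (c₂ := 4) (Gain.zero _ _) (hs.four_le_sig hd)).mono (by simp) hd)

/-! ### Sets of surplus four through a vertex of degree at least six -/

namespace Stuck

/-- Such an x has degree four and surplus three. If some larger subset of a surplus-four set through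
u and x has surplus at most three, a pair {x, w} in it has `sig` three and at least five neighbors,
and is used as X. Otherwise the set without x is critical of surplus one after x is left out, and k
drops by 4 + 1. Both cases give (1, 2), (3/2, 5). -/
theorem sig_ne_three (h : Stuck G) {u x : V} (hsu : sig G {u} = 4) {I : Finset V} (hI : Ind G I)
    (hu : u ∈ I) (hx : x ∈ I) (hs : surplus G I = 4) : sig G {x} ≠ 3 := by
  intro hsx
  have hux : u ≠ x := by rintro rfl; omega
  have hsub : ({u, x} : Finset V) ⊆ I := by
    intro w hw
    simp only [Finset.mem_insert, Finset.mem_singleton] at hw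
    rcases hw with rfl | rfl <;> assumption
  have hi := hI.mono hsub
  have hdx : dg G x = 4 := by
    have h1 := sig_le (ind_singleton (G := G) x) le_rfl
    rw [surplus_singleton] at h1
    have h2 := mt (h.four_le_sig (u := x)) (by omega)
    omega
  have hx3 : surplus G {x} = 3 := by rw [surplus_singleton, hdx]; norm_num
  have hsux : sig G {u, x} = 4 := by
    have := sig_le hI hsub
    have := sig_mono (J := {u}) hi (by simp)
    omega
  by_cases hw : ∃ I', Ind G I' ∧ {u, x} ⊆ I' ∧ surplus G I' = 4 ∧
      ∃ J ⊆ I' \ {x}, J.Nonempty ∧ surplus G (J ∪ {x}) ≤ 3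
  · obtain ⟨I', hI', hsub', hs', J, hJ, ⟨w, hwJ⟩, hJs⟩ := hw
    have hu' : u ∈ I' := hsub' (by simp)
    have hx' : x ∈ I' := hsub' (by simp)
    have hw' := Finset.mem_sdiff.1 (hJ hwJ)
    have hwx : x ≠ w := fun e => hw'.2 (by simp [e])
    have hxw : ({x, w} : Finset V) ⊆ J ∪ {x} := by
      intro z hz
      simp only [Finset.mem_insert, Finset.mem_singleton] at hz
      rcases hz with rfl | rfl
      · simp
      · exact Finset.mem_union_left _ hwJ
    have hJI : J ∪ {x} ⊆ I' := Finset.union_subset (hJ.trans Finset.sdiff_subset) (by simpa using hx')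
    have hsxw : sig G {x, w} = 3 := by
      have := sig_le (hI'.mono hJI) hxw
      have := sig_mono (J := {x}) (hI'.mono (hxw.trans hJI)) (by simp)
      omega
    refine h.not_win (Or.inr (Or.inr (Or.inr (Or.inr ?_))))
    refine h.exp.win (U := {u, x}) (X := {x, w}) ⟨by simp, by rw [Finset.card_pair hwx]; omega⟩
      ⟨hI'.mono (hxw.trans hJI), ?_⟩ (Or.inr (Or.inl ⟨Finset.card_pair hux, rfl⟩)) (Gain.zero _ _)
      (by rw [Finset.card_pair hux]) (by omega) (Or.inl ⟨0, Gain.zero _ _, ?_⟩)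
    · intro z hz
      simp only [Finset.mem_insert, Finset.mem_singleton] at hz
      rcases hz with rfl | rfl
      · have h1 : ({z, x, w} : Finset V) ⊆ I' :=
          Finset.insert_subset hu' (hxw.trans hJI)
        have h2 := sig_le hI' h1
        have h3 := sig_mono (J := {z}) (hI'.mono h1) (by simp)
        exact ⟨hI'.mono h1, by omega⟩
      · rw [Finset.insert_eq_of_mem (by simp)]
        exact ⟨hI'.mono (hxw.trans hJI), by omega⟩
    · have h1 := sig_le (hI'.mono (hxw.trans hJI)) le_rfl
      rw [surplus_two hwx] at h1
      omega
  · push Not at hw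
    have e : ({u, x} ∪ {x} : Finset V) = {u, x} := Finset.union_eq_left.2 (by simp)
    refine h.not_win (Or.inr (Or.inr (Or.inr (Or.inr ?_))))
    refine h.exp.win (U := {u, x}) (X := {x}) (by simp)
      ⟨ind_singleton x, ?_⟩ (Or.inr (Or.inl ⟨Finset.card_pair hux, rfl⟩)) (Gain.zero _ _)
      (by rw [Finset.card_pair hux]) (by omega) (Or.inr ?_)
    · intro z hz
      simp only [Finset.mem_insert, Finset.mem_singleton] at hz
      rcases hz with rfl | rfl
      · exact ⟨hi, by omega⟩
      · simpa using ind_singleton z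
    · rw [e]
      refine ⟨hi, fun I' hI' hsub' hs' => ?_⟩
      rw [hsux] at hs'
      have hu' : u ∈ I' \ {x} := by simp [hsub' (show u ∈ {u, x} by simp), hux]
      have hxs : ({x} : Finset V) ⊆ I' := Finset.singleton_subset_iff.2 (hsub' (by simp))
      refine ⟨critOne_sdiff hI' hxs ⟨u, hu'⟩ (by omega) fun J hJ hn => ?_, ?_⟩
      · have := hw I' hI' hsub' hs' J hJ hn
        omega
      · have := Finset.card_pos.2 ⟨u, hu'⟩
        change 5 ≤ dg G x + _
        omega

/-- A pair of surplus two has four neighbors in all, hence a common neighbor a. If deg a ≥ 5, branch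
on a: deleting it turns {x, y} into a critical set of surplus one, giving (1/2, 2), (2, 5). If deg a
≤ 4, branch on "u, x, y in, or x, y out": in the first branch a has one or two neighbors left and is
reduced, giving (1, 4), (1, 4). -/
theorem three_le_surplus_pair (h : Stuck G) {u x y : V} (hdu : 5 ≤ dg G u) (hsu : sig G {u} = 4) {I : Finset V}
    (hI : Ind G I) (hu : u ∈ I) (hx : x ∈ I) (hy : y ∈ I) (hs : surplus G I = 4) (hxy : x ≠ y) :
    3 ≤ surplus G {x, y} := by
  by_contra hcon
  have hixy : Ind G {x, y} := Ind.pair (hI x hx y hy)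
  have hs2 := h.exp _ hixy (by simp)
  rw [surplus_two hxy] at hs2 hcon
  have hN : (nbhd G {x, y}).card = 4 := by omega
  have hxu : u ≠ x := by
    rintro rfl
    have := dg_le_of_mem hixy (v := u) (by simp)
    omega
  have hyu : u ≠ y := by
    rintro rfl
    have := dg_le_of_mem hixy (v := u) (by simp)
    omega
  obtain ⟨a, ha⟩ : (nbhd G {x} ∩ nbhd G {y}).Nonempty := by
    rw [← Finset.card_pos]
    have h1 := Finset.card_union_add_card_inter (nbhd G {x}) (nbhd G {y})
    have h2 := Finset.card_le_card (Finset.union_subset (hixy.nbhd_mono (J := {x}) (by simp))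
      (hixy.nbhd_mono (J := {y}) (by simp)))
    have h3 := h.exp.three_le_dg x
    have h4 := h.exp.three_le_dg y
    rw [dg] at h3 h4
    omega
  rw [Finset.mem_inter, mem_nbhd_singleton, mem_nbhd_singleton] at ha
  by_cases hda : 5 ≤ dg G a
  · have hdis : ∀ J ⊆ ({x, y} : Finset V), nbhd (delG G {a}) J = nbhd G J \ {a} := by
      intro J hJ
      refine nbhd_delG_of_disjoint (Finset.disjoint_singleton_right.2 fun haJ => ?_)
      have := hJ haJ
      simp only [Finset.mem_insert, Finset.mem_singleton] at this
      rcases this with rfl | rfl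
      · exact ha.1.ne rfl
      · exact ha.2.ne rfl
    have haN : a ∈ nbhd G {x, y} := hixy.mem_nbhd (v := x) (by simp) ha.1
    have hK : CritOne (delG G {a}) {x, y} := by
      refine ⟨fun v hv w hw hvw => hixy v hv w hw hvw.1, by simp, ?_, fun J hJ hn => ?_⟩
      · rw [hdis _ le_rfl, Finset.card_sdiff_of_subset (by simpa using haN), hN, Finset.card_pair hxy]
        rfl
      · have h1 := h.exp.le_card_nbhd (hixy.mono hJ) hn
        have h2 := Finset.le_card_sdiff {a} (nbhd G J)
        rw [hdis J hJ]
        rw [Finset.card_singleton] at h2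
        omega
    have hg : Gain 3 (delG G {a}) 1 :=
      (Gain.crit (m := 0) (c := 1) x y hK
        (fun _ => (Gain.zero _ _).mono le_rfl (by omega))
        (fun _ _ _ => (Gain.zero _ _).mono le_rfl (by rw [Finset.card_pair hxy]))).mono (by norm_num) le_rfl
    exact h.not_win (Or.inr (Or.inr (Or.inr (Or.inl
      ((h.exp.win_single a (c₂ := 4) hg (h.four_le_sig hda)).mono le_rfl hda)))))
  · have hsub : ({u, x, y} : Finset V) ⊆ I := by
      intro w hw
      simp only [Finset.mem_insert, Finset.mem_singleton] at hw
      rcases hw with rfl | rfl | rfl <;> assumption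
    have hi := hI.mono hsub
    have hU : ({u, x, y} : Finset V).card = 3 := by
      rw [Finset.card_insert_of_notMem (by simp [hxu, hyu]), Finset.card_pair hxy]
    have haU : Disjoint ({a} : Finset V) {u, x, y} := by
      rw [Finset.disjoint_singleton_left]
      intro haU
      simp only [Finset.mem_insert, Finset.mem_singleton] at haU
      rcases haU with rfl | rfl | rfl
      · exact hI x hx a hu ha.1
      · exact ha.1.ne rfl
      · exact ha.2.ne rfl
    have hda3 := h.exp.three_le_dg a
    have hNa := nbhd_delG_of_disjoint (G := G) haU
    have hxyN : ({x, y} : Finset V) ⊆ nbhd G {a} := by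
      intro w hw
      simp only [Finset.mem_insert, Finset.mem_singleton] at hw
      rw [mem_nbhd_singleton]
      rcases hw with rfl | rfl
      · exact ha.1.symm
      · exact ha.2.symm
    have hg : Gain 3 (delG G {u, x, y}) 1 := by
      refine (Gain.one (v := a) ?_ ?_).mono (by norm_num) le_rfl
      · rw [hNa, ← Finset.card_pos]
        have h2 := Finset.le_card_sdiff {u, x, y} (nbhd G {a})
        have h3 : dg G a = (nbhd G {a}).card := rfl
        by_cases hda4 : dg G a = 3
        · have hau : ¬ G.Adj a u := fun hau => by
            have := h.dg_le_four hda4 hau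
            omega
          have h4 : nbhd G {a} \ {u, x, y} = nbhd G {a} \ {x, y} := by
            ext w
            have : G.Adj a w → w ≠ u := fun hw e => hau (e ▸ hw)
            simp only [Finset.mem_sdiff, mem_nbhd_singleton, Finset.mem_insert, Finset.mem_singleton]
            tauto
          rw [h4, Finset.card_sdiff_of_subset hxyN, Finset.card_pair hxy]
          omega
        · omega
      · rw [hNa]
        have h4 : nbhd G {a} \ {u, x, y} ⊆ nbhd G {a} \ {x, y} :=
          Finset.sdiff_subset_sdiff le_rfl (Finset.subset_insert _ _)
        have h5 := Finset.card_le_card h4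
        rw [Finset.card_sdiff_of_subset hxyN, Finset.card_pair hxy] at h5
        have h3 : dg G a = (nbhd G {a}).card := rfl
        omega
    have hsig2 : sig G {x, y} = 2 := by
      have h1 := sig_le hixy le_rfl
      have := h.exp.le_sig hixy (by simp)
      rw [surplus_two hxy] at h1
      omega
    refine h.not_win (Or.inr (Or.inl ?_))
    refine h.exp.win (U := {u, x, y}) (X := {x, y}) ⟨by simp, by rw [Finset.card_pair hxy]; omega⟩
      ⟨hixy, ?_⟩ (Or.inr (Or.inr ⟨hU, rfl⟩)) hg (by omega) (by omega) (Or.inl ⟨0, Gain.zero _ _, by omega⟩)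
    intro z hz
    simp only [Finset.mem_insert, Finset.mem_singleton] at hz
    rcases hz with rfl | hz
    · have h1 := sig_le hI hsub
      have h2 := sig_mono (J := {z}) hi (by simp)
      exact ⟨hi, by omega⟩
    · rw [Finset.insert_eq_of_mem (by simpa using hz)]
      have h2 := sig_mono (J := {z}) hixy (by simpa using hz)
      have h3 := h.exp.le_sig (ind_singleton z) (by simp)
      exact ⟨hixy, by omega⟩

/-- The argument of `dg_eq_three` for surplus four. The value three of sig{x} is excluded by
`sig_ne_three`, and adding a vertex y with N(y) ⊆ N(x) to I would now contradict sig{u} = 4. -/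
theorem dg_eq_three_of_sig (h : Stuck G) {u x : V} (hdu : 6 ≤ dg G u) (hsu : sig G {u} = 4) {I : Finset V}
    (hI : Ind G I) (hu : u ∈ I) (hx : x ∈ I) (hs : surplus G I = 4) (hux : u ≠ x) : dg G x = 3 := by
  have hi : Ind G {u, x} := Ind.pair (hI u hu x hx)
  have hsx2 := h.exp.le_sig (ind_singleton x) (by simp)
  have hsx4 := sig_le hI (Finset.singleton_subset_iff.2 hx)
  have hsx3 := h.sig_ne_three hsu hI hu hx hs
  have hsx : sig G {x} = 2 := by
    by_contra hcon
    have h1 := (h.exp.win_pair hux hI hu hx (c := 4) hs hsu (by omega)).mono_drop le_rfl (show 3 ≤ 4 by norm_num)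
    have h2 := dg_le_of_mem hi (v := u) (by simp)
    exact h.not_win (Or.inr (Or.inr (Or.inr (Or.inr (h1.mono le_rfl (by omega))))))
  have hdx := h.exp.three_le_dg x
  obtain ⟨B, hB, hxB, hBs⟩ := exists_sig (ind_singleton (G := G) x)
  rw [hsx] at hBs
  rw [Finset.singleton_subset_iff] at hxB
  have hB2 : B.card ≤ 2 := by
    by_contra hcon
    have := h.surplus_ge hB (by omega)
    omega
  have hdB := dg_le_of_mem hB hxB
  have hBp := Finset.card_pos.2 ⟨x, hxB⟩
  rw [surplus] at hBs
  by_contra hcon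
  have hB2' : B.card = 2 := by omega
  obtain ⟨y, hy, hyx⟩ := Finset.exists_mem_ne (show 1 < B.card by omega) x
  have hN : nbhd G {x} = nbhd G B :=
    Finset.eq_of_subset_of_card_le (hB.nbhd_mono (by simpa using hxB)) (by
      change _ ≤ dg G x; omega)
  have hyx' : ∀ w, G.Adj y w → G.Adj x w := fun w hw => by
    rw [← mem_nbhd_singleton, hN]
    exact hB.mem_nbhd hy hw
  have hBxy : {x, y} = B := eq_pair hyx.symm hxB hy hB2
  by_cases hyI : y ∈ I
  · have := h.three_le_surplus_pair (by omega) hsu hI hu hx hyI hs hyx.symm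
    rw [hBxy, surplus] at this
    omega
  · have hyI' : ∀ w ∈ I, ¬ G.Adj y w := fun w hw hyw => hI x hx w hw (hyx' w hyw)
    have hins : Ind G (insert y I) := by
      intro a ha b hb hab
      rw [Finset.mem_insert] at ha hb
      rcases ha with rfl | ha <;> rcases hb with rfl | hb
      · exact hab.ne rfl
      · exact hyI' b hb hab
      · exact hyI' a ha hab.symm
      · exact hI a ha b hb hab
    have hNN : nbhd G (insert y I) ⊆ nbhd G I := by
      intro w hw
      obtain ⟨h1, v, hv, hvw⟩ := mem_nbhd.1 hw
      rw [Finset.mem_insert] at hv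
      rcases hv with rfl | hv
      · exact hI.mem_nbhd hx (hyx' w hvw)
      · exact hI.mem_nbhd hv hvw
    have h1 := Finset.card_le_card hNN
    have h2 := Finset.card_insert_of_notMem hyI
    have h3 := sig_le hins (J := {u}) (by simp [hu])
    rw [surplus] at h3 hs
    omega

/-- Branch on "u and x in the cover, or x out" for a degree-three x ∈ I sharing a neighbor with u.
The neighbors of x shared with u give reductions in the first branch, the others in the second. They
number three in total and at least one is shared, so the k-drops are 3 and 5, 4 and 4, or 5 and 3.
-/
theorem sig_ne_four (h : Stuck G) {u : V} (hdu : 6 ≤ dg G u) : sig G {u} ≠ 4 := by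
  classical
  intro hsu
  obtain ⟨I, ⟨hI, hu, hs⟩, hmin⟩ : ∃ I, (Ind G I ∧ u ∈ I ∧ surplus G I = 4) ∧
      ∀ J, Ind G J → u ∈ J → surplus G J = 4 → I.card ≤ J.card := by
    obtain ⟨I, hI, hu, hs⟩ := exists_sig (ind_singleton (G := G) u)
    obtain ⟨I, h1, h2⟩ := Finset.exists_min_image
      (Finset.univ.filter fun I => Ind G I ∧ u ∈ I ∧ surplus G I = 4) Finset.card
      ⟨I, by simpa [hsu ▸ hs, hI] using hu⟩
    refine ⟨I, (Finset.mem_filter.1 h1).2, fun J h3 h4 h5 => h2 J ?_⟩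
    simp [h3, h4, h5]
  obtain ⟨x, hx, hxu, a, hua, hxa⟩ := exists_common h.exp hI hu (by omega)
  have hdx := h.dg_eq_three_of_sig hdu hsu hI hu hx hs hxu.symm
  have hi : Ind G {u, x} := Ind.pair (hI u hu x hx)
  have hsub : ({u, x} : Finset V) ⊆ I := by
    intro w hw
    simp only [Finset.mem_insert, Finset.mem_singleton] at hw
    rcases hw with rfl | rfl <;> assumption
  set S := nbhd G {x} ∩ nbhd G {u} with hS
  set R := nbhd G {x} \ nbhd G {u} with hR
  have hSR : S.card + R.card = 3 := by
    rw [hS, hR, Finset.card_inter_add_card_sdiff]; exact hdx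
  have hSpos : 0 < S.card := Finset.card_pos.2 ⟨a, by
    rw [hS, Finset.mem_inter, mem_nbhd_singleton, mem_nbhd_singleton]; exact ⟨hxa, hua⟩⟩
  have hgA : Gain 3 (delG G {u, x}) S.card := by
    refine h.exp.gain Finset.card_le_two ((h.indep x hdx).mono Finset.inter_subset_left) ?_ ?_ (by omega)
    · rw [Finset.disjoint_left]
      intro w hw hw'
      rw [hS, Finset.mem_inter, mem_nbhd_singleton, mem_nbhd_singleton] at hw
      simp only [Finset.mem_insert, Finset.mem_singleton] at hw'
      rcases hw' with rfl | rfl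
      · exact hw.2.ne rfl
      · exact hw.1.ne rfl
    · intro w hw
      rw [hS, Finset.mem_inter, mem_nbhd_singleton, mem_nbhd_singleton] at hw
      exact card_sdiff_pair_le' hxu.symm (h.dg_le_four hdx hw.1) (mem_nbhd_singleton.2 hw.2.symm)
        (mem_nbhd_singleton.2 hw.1.symm)
  -- A neighbor of `x` outside N(u) has another neighbor in `I`. Otherwise removing `x` from `I`
  -- would also remove that neighbor from N(I), and a smaller set of surplus at most four would
  -- contain `u`, against minimality.
  have hwit : ∀ o, ∃ w, o ∈ R → w ∈ I ∧ w ≠ u ∧ w ≠ x ∧ G.Adj w o := by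
    intro o
    by_cases ho : o ∈ R
    swap
    · exact ⟨u, fun h => absurd h ho⟩
    rw [hR, Finset.mem_sdiff, mem_nbhd_singleton, mem_nbhd_singleton] at ho
    by_contra! hcon
    have h1 : ∀ w ∈ I, w ≠ x → ¬ G.Adj w o := fun w hw hwx => by
      by_cases hwu : w = u
      · rw [hwu]; exact ho.2
      · exact (hcon w).2 hw hwu hwx
    have h2 : Ind G (I.erase x) := hI.mono (Finset.erase_subset _ _)
    have h3 : nbhd G (I.erase x) ⊆ (nbhd G I).erase o := by
      intro w hw
      refine Finset.mem_erase.2 ⟨?_, hI.nbhd_mono (Finset.erase_subset _ _) hw⟩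
      rintro rfl
      obtain ⟨_, v, hv, hvw⟩ := mem_nbhd.1 hw
      rw [Finset.mem_erase] at hv
      exact h1 v hv.2 hv.1 hvw
    have h4 := Finset.card_le_card h3
    rw [Finset.card_erase_of_mem (hI.mem_nbhd hx ho.1)] at h4
    have h5 := Finset.card_erase_of_mem hx
    have h6 := Finset.card_pos.2 ⟨x, hx⟩
    have h7 := Finset.card_pos.2 ⟨o, hI.mem_nbhd hx ho.1⟩
    have hu' : u ∈ I.erase x := Finset.mem_erase.2 ⟨hxu.symm, hu⟩
    have h8 := sig_le h2 (J := {u}) (by simpa using hu')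
    have h9 := hmin _ h2 hu' (by rw [surplus] at hs h8 ⊢; omega)
    omega
  choose w hw using hwit
  -- A witness serving two vertices would share two neighbors with `x`; both have degree three, so
  -- the pair would have surplus at most two.
  have hinj : Set.InjOn w R := by
    intro o ho o' ho' e
    by_contra hne
    obtain ⟨h1, h2, h3, h4⟩ := hw o ho
    have h5 := (hw o' ho').2.2.2
    rw [← e] at h5
    have h6 := h.three_le_surplus_pair (by omega) hsu hI hu hx h1 hs h3.symm
    rw [surplus_two h3.symm] at h6
    have hdw := h.dg_eq_three_of_sig hdu hsu hI hu h1 hs h2.symm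
    have h7 : nbhd G {x, w o} ⊆ nbhd G {x} ∪ nbhd G {w o} := by
      intro z hz
      obtain ⟨_, v, hv, hvz⟩ := mem_nbhd.1 hz
      simp only [Finset.mem_insert, Finset.mem_singleton] at hv
      rw [Finset.mem_union, mem_nbhd_singleton, mem_nbhd_singleton]
      rcases hv with rfl | rfl
      · exact Or.inl hvz
      · exact Or.inr hvz
    have h8 := Finset.card_le_card h7
    have h9 := Finset.card_union_add_card_inter (nbhd G {x}) (nbhd G {w o})
    have ho1 := Finset.mem_sdiff.1 (Finset.mem_coe.1 ho)
    have ho1' := Finset.mem_sdiff.1 (Finset.mem_coe.1 ho')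
    have h10 : 1 < (nbhd G {x} ∩ nbhd G {w o}).card :=
      Finset.one_lt_card.2 ⟨o, by simp only [Finset.mem_inter, ho1.1, mem_nbhd_singleton, h4, and_self], o',
        by simp only [Finset.mem_inter, ho1'.1, mem_nbhd_singleton, h5, and_self], hne⟩
    rw [dg] at hdw hdx
    omega
  have hxI : ({x} : Finset V) ⊆ I := Finset.singleton_subset_iff.2 hx
  have hWI : R.image w ⊆ I \ {x} := by
    intro z hz
    obtain ⟨o, ho, rfl⟩ := Finset.mem_image.1 hz
    rw [Finset.mem_sdiff, Finset.mem_singleton]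
    exact ⟨(hw o ho).1, (hw o ho).2.2.1⟩
  have hdisj : Disjoint (R.image w) ({x} ∪ nbhd G {x}) := by
    rw [Finset.disjoint_left]
    intro z hz hz'
    have hz := Finset.mem_sdiff.1 (hWI hz)
    rcases Finset.mem_union.1 hz' with h1 | h1
    · exact hz.2 h1
    · exact hI x hx z hz.1 (mem_nbhd_singleton.1 h1)
  have hgB : Gain 3 (delG G ({x} ∪ nbhd G {x})) (R.image w).card := by
    refine (Gain.of_hall (R.image w) ?_ ?_ ?_).mono ?_ le_rfl
    · intro p hp q hq hpq
      exact hI p (Finset.sdiff_subset (hWI hp)) q (Finset.sdiff_subset (hWI hq)) hpq.1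
    · intro z hz
      rw [nbhd_delG_of_disjoint (hdisj.mono_left (by simpa using hz))]
      obtain ⟨o, ho, rfl⟩ := Finset.mem_image.1 hz
      obtain ⟨h1, h2, h3, h4⟩ := hw o ho
      have hdw := h.dg_eq_three_of_sig hdu hsu hI hu h1 hs h2.symm
      have h5 : nbhd G {w o} \ ({x} ∪ nbhd G {x}) ⊆ (nbhd G {w o}).erase o := by
        intro z hz
        rw [Finset.mem_sdiff] at hz
        refine Finset.mem_erase.2 ⟨?_, hz.1⟩
        rintro rfl
        exact hz.2 (Finset.mem_union_right _ (Finset.mem_sdiff.1 ho).1)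
      have h6 := Finset.card_le_card h5
      rw [Finset.card_erase_of_mem (mem_nbhd_singleton.2 h4)] at h6
      rw [dg] at hdw
      omega
    · intro J hJ hn
      have h1 := card_nbhd_delG hI hxI (hJ.trans hWI)
      have h2 : J ∪ {x} ⊆ I := Finset.union_subset ((hJ.trans hWI).trans Finset.sdiff_subset) hxI
      have h3 := h.exp.le_card_nbhd (hI.mono h2) (hn.mono Finset.subset_union_left)
      have h4 : (J ∪ {x}).card = J.card + 1 :=
        Finset.card_union_of_disjoint (Finset.sdiff_disjoint.mono_left (hJ.trans hWI))
      rw [dg] at hdx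
      omega
    · have := Finset.card_image_le (s := R) (f := w)
      omega
  rw [Finset.card_image_of_injOn hinj] at hgB
  have hwin : Win G 2 (2 + S.card) 2 (3 + R.card) := by
    refine h.exp.win (U := {u, x}) (X := {x}) (by simp) ⟨ind_singleton x, ?_⟩
      (Or.inr (Or.inl ⟨Finset.card_pair hxu.symm, rfl⟩)) hgA (by rw [Finset.card_pair hxu.symm])
      (by simpa using h.exp.le_sig (ind_singleton x) (by simp)) (Or.inl ⟨_, hgB, ?_⟩)
    · intro z hz
      simp only [Finset.mem_insert, Finset.mem_singleton] at hz
      rcases hz with rfl | rfl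
      · have h1 := sig_le hI hsub
        have h2 := sig_mono (J := {z}) hi (by simp)
        exact ⟨hi, by omega⟩
      · simpa using ind_singleton z
    · change 3 + _ ≤ dg G x + _
      omega
  rcases (by omega : S.card = 1 ∨ S.card = 2 ∨ S.card = 3) with h1 | h1 | h1
  · exact h.not_win (Or.inl (hwin.mono (by omega) (by omega)))
  · exact h.not_win (Or.inr (Or.inl (hwin.mono (by omega) (by omega))))
  · exact h.not_win (Or.inr (Or.inr (Or.inl (hwin.mono (by omega) (by omega)))))

end Stuck

/-- The branchings on a vertex of degree at least six. -/
theorem Nice.win_of_six_le (h : Nice G) {u : V} (hd : 6 ≤ dg G u) : TWin G ∨ Win G 1 1 5 (dg G u) := by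
  by_cases hw : TWin G
  · exact Or.inl hw
  · have hs : Stuck G := ⟨h, hw⟩
    have h1 := hs.four_le_sig (show 5 ≤ dg G u by omega)
    have h2 := hs.sig_ne_four hd
    exact Or.inr ((h.exp.win_single u (c₂ := 5) (Gain.zero _ _) (by omega)).mono (by simp) le_rfl)

end Cases

/-! ### Vertex sets as lists -/

/-- Membership, as a truth value. -/
def inList (l : List ℕ) (v : ℕ) : Bool := l.any fun w => Nat.beq w v

theorem inList_iff {l : List ℕ} {v : ℕ} : inList l v = true ↔ v ∈ l := by
  simp [inList]

/-- The set of vertices in a list. -/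
def toF (n : ℕ) (l : List ℕ) : Finset (Fin n) := Finset.univ.filter fun v => (v : ℕ) ∈ l

theorem mem_toF {n : ℕ} {l : List ℕ} {v : Fin n} : v ∈ toF n l ↔ (v : ℕ) ∈ l := by simp [toF]

/-- The number of vertices below `n` in a list. -/
def cnt (n : ℕ) (l : List ℕ) : ℕ := ((List.range n).filter fun v => inList l v).length

theorem cnt_eq (n : ℕ) (l : List ℕ) : cnt n l = (toF n l).card := by
  rw [cnt, ← List.toFinset_card_of_nodup (List.nodup_range.filter _), toF,
    ← Finset.card_map Fin.valEmbedding]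
  congr 1
  ext v
  simp only [List.mem_toFinset, List.mem_filter, List.mem_range, inList_iff, Finset.mem_map, Finset.mem_filter,
    Finset.mem_univ, true_and, Fin.valEmbedding_apply]
  exact ⟨fun h => ⟨⟨v, h.1⟩, h.2, rfl⟩, fun ⟨w, h1, h2⟩ => h2 ▸ ⟨w.2, h1⟩⟩

theorem toF_append (n : ℕ) (l m : List ℕ) : toF n (l ++ m) = toF n l ∪ toF n m := by
  ext v; simp [mem_toF]

theorem toF_cons {n v : ℕ} (hv : v < n) (l : List ℕ) : toF n (v :: l) = insert ⟨v, hv⟩ (toF n l) := by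
  ext w; simp [mem_toF, Fin.ext_iff]

theorem toF_nil (n : ℕ) : toF n [] = ∅ := by
  ext w; simp [mem_toF]

theorem toF_one {n : ℕ} (v : Fin n) : toF n [(v : ℕ)] = {v} := by rw [toF_cons v.2, toF_nil]; rfl

theorem toF_two {n : ℕ} (v w : Fin n) : toF n [(v : ℕ), (w : ℕ)] = {v, w} := by
  rw [toF_cons v.2, toF_one]

/-- The elements of the first list that are not in the second one. -/
def diffL (l m : List ℕ) : List ℕ := l.filter fun v => !(inList m v)

theorem toF_diffL (n : ℕ) (l m : List ℕ) : toF n (diffL l m) = toF n l \ toF n m := by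
  ext v; simp [mem_toF, diffL, ← Bool.not_eq_true, inList_iff]

/-- The neighborhood. -/
def nb (M : Mat) (l : List ℕ) : List ℕ :=
  (List.range M.length).filter fun v => !(inList l v) && l.any fun w => adj M w v

/-- A set with its neighborhood. -/
def cln (M : Mat) (l : List ℕ) : List ℕ := l ++ nb M l

/-- Deletion of vertices. -/
def del (M : Mat) (l : List ℕ) : Mat :=
  mk M.length fun i j => adj M i j && !(inList l i) && !(inList l j)

/-- Deletion of a set whose neighborhood is contracted. -/
def con (M : Mat) (l : List ℕ) : Mat :=
  mk M.length fun i j => !(inList (cln M l) j) &&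
    ((Nat.beq i ((nb M l).headD 0) && (nb M l).any fun w => adj M w j) || !(inList (cln M l) i) && adj M i j)

/-- Independence. -/
def indB (M : Mat) (l : List ℕ) : Bool := l.all fun i => l.all fun j => !(adj M i j)

/-- The bipartite graph between a set and its neighborhood without `y`. -/
def bip (M : Mat) (l : List ℕ) (y : ℕ) : Mat :=
  mk M.length fun i j => inList l i && inList (nb M l) j && !(Nat.beq j y) && adj M i j

/-- `CritOne`, as a truth value. -/
def critB (M : Mat) (l : List ℕ) : Bool :=
  indB M l && Nat.ble 1 (cnt M.length l) && Nat.beq (nb M l).length (cnt M.length l + 1) &&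
    (nb M l).all fun y => Nat.ble (2 * cnt M.length l) (nu (bip M l y))

theorem adj_lt {n : ℕ} {M : Mat} (h : IsAdj n M) {i j : ℕ} (hij : adj M i j = true) : i < n ∧ j < n := by
  obtain ⟨f, rfl⟩ := h
  constructor
  · by_contra hi
    rw [adj, List.getD_eq_default (n := i) _ _ (by simpa [mk] using hi)] at hij
    simp at hij
  · by_contra hj
    rw [adj] at hij
    by_cases hi : i < n
    · rw [mk, getD_map_range _ _ _ hi, List.getD_eq_default _ _ (by simpa using hj)] at hij
      exact Bool.false_ne_true hij
    · rw [List.getD_eq_default (n := i) _ _ (by simpa [mk] using hi)] at hij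
      simp at hij

theorem mem_nb_lt {M : Mat} {l : List ℕ} {v : ℕ} (h : v ∈ nb M l) : v < M.length := by
  rw [nb, List.mem_filter, List.mem_range] at h
  exact h.1

/-! ### The list operations compute the graph operations -/

section Spec
variable {n : ℕ} {M : Mat}

theorem toF_nb (h : IsAdj n M) (l : List ℕ) : toF n (nb M l) = nbhd (gr n M) (toF n l) := by
  ext v
  rw [mem_toF, mem_nbhd, mem_toF, nb, List.mem_filter, h.length, List.mem_range]
  simp only [Bool.and_eq_true, Bool.not_eq_true', ← Bool.not_eq_true, inList_iff, List.any_eq_true]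
  constructor
  · rintro ⟨_, h1, w, hw, hwv⟩
    exact ⟨h1, ⟨w, (adj_lt h hwv).1⟩, mem_toF.2 hw, h.adj_iff.2 hwv⟩
  · rintro ⟨h1, w, hw, hwv⟩
    exact ⟨v.2, h1, w, mem_toF.1 hw, h.adj_iff.1 hwv⟩

theorem nb_length (h : IsAdj n M) (l : List ℕ) : (nb M l).length = (nbhd (gr n M) (toF n l)).card := by
  rw [← toF_nb h, ← cnt_eq, cnt]
  congr 1
  rw [nb, h.length]
  refine List.filter_congr fun v hv => ?_
  rw [List.mem_range] at hv
  rw [Bool.eq_iff_iff, inList_iff, List.mem_filter, List.mem_range]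
  tauto

theorem toF_cln (h : IsAdj n M) (l : List ℕ) : toF n (cln M l) = toF n l ∪ nbhd (gr n M) (toF n l) := by
  rw [cln, toF_append, toF_nb h]

theorem isAdj_del (h : IsAdj n M) (l : List ℕ) : IsAdj n (del M l) := by
  rw [del, h.length]; exact isAdj_mk _ _

theorem gr_del (h : IsAdj n M) (l : List ℕ) : gr n (del M l) = delG (gr n M) (toF n l) := by
  ext i j
  rw [del, h.length, gr_mk_adj, delG_adj, mem_toF, mem_toF]
  simp only [Bool.and_eq_true, Bool.not_eq_true', ← Bool.not_eq_true, inList_iff, ← h.adj_iff]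
  constructor
  · rintro ⟨_, ⟨⟨h1, h2⟩, h3⟩ | ⟨⟨h1, h2⟩, h3⟩⟩
    · exact ⟨h1, h2, h3⟩
    · exact ⟨h1.symm, h3, h2⟩
  · rintro ⟨h1, h2, h3⟩
    exact ⟨h1.ne, Or.inl ⟨⟨h1, h2⟩, h3⟩⟩

theorem isAdj_con (h : IsAdj n M) (l : List ℕ) : IsAdj n (con M l) := by
  rw [con, h.length]; exact isAdj_mk _ _

/-- The program contracts to the first vertex of the neighborhood list. Its identity is irrelevant,
as `Gain` allows every choice of y. -/
theorem gr_con (h : IsAdj n M) (l : List ℕ) (hl : (nbhd (gr n M) (toF n l)).Nonempty) :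
    ∃ y ∈ nbhd (gr n M) (toF n l), gr n (con M l) = conG (gr n M) (toF n l) y := by
  obtain ⟨w, hw⟩ := hl
  rw [← toF_nb h, mem_toF] at hw
  obtain ⟨y, hy, hyh⟩ : ∃ y ∈ nb M l, (nb M l).headD 0 = y := by
    rcases hl : nb M l with _ | ⟨y, t⟩
    · rw [hl] at hw; simp at hw
    · exact ⟨y, by simp, rfl⟩
  have hyn := mem_nb_lt hy
  rw [h.length] at hyn
  refine ⟨⟨y, hyn⟩, by rw [← toF_nb h, mem_toF]; exact hy, ?_⟩
  have key : ∀ i j : Fin n, ((!(inList (cln M l) j) &&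
    ((Nat.beq i ((nb M l).headD 0) && (nb M l).any fun w => adj M w j) ||
      !(inList (cln M l) i) && adj M i j)) = true ↔
      j ∉ toF n l ∪ nbhd (gr n M) (toF n l) ∧
    (i = ⟨y, hyn⟩ ∧ (∃ w ∈ nbhd (gr n M) (toF n l), (gr n M).Adj w j) ∨
      i ∉ toF n l ∪ nbhd (gr n M) (toF n l) ∧ (gr n M).Adj i j)) := by
    intro i j
    rw [← toF_cln h, mem_toF, mem_toF, ← toF_nb h, hyh]
    simp only [Bool.and_eq_true, Bool.or_eq_true, Bool.not_eq_true', ← Bool.not_eq_true, inList_iff, Nat.beq_eq,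
      List.any_eq_true, mem_toF, h.adj_iff, Fin.ext_iff]
    refine and_congr_right fun _ => or_congr_left (and_congr_right fun _ => ?_)
    constructor
    · rintro ⟨w, hw, hwj⟩
      exact ⟨⟨w, (adj_lt h hwj).1⟩, hw, hwj⟩
    · rintro ⟨w, hw, hwj⟩
      exact ⟨w, hw, hwj⟩
  ext i j
  rw [con, h.length, gr_mk_adj, conG, SimpleGraph.fromRel_adj, key, key]

theorem indB_iff (h : IsAdj n M) (l : List ℕ) : indB M l = true ↔ Ind (gr n M) (toF n l) := by
  simp only [indB, List.all_eq_true, Bool.not_eq_true', ← Bool.not_eq_true]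
  constructor
  · intro h1 i hi j hj hij
    exact h1 i (mem_toF.1 hi) j (mem_toF.1 hj) (h.adj_iff.1 hij)
  · intro h1 i hi j hj hij
    have h2 := adj_lt h hij
    exact h1 ⟨i, h2.1⟩ (mem_toF.2 hi) ⟨j, h2.2⟩ (mem_toF.2 hj) (h.adj_iff.2 hij)

/-- The edges between a set and its neighborhood without `y`. -/
def bipG {V : Type} [Fintype V] [DecidableEq V] (G : SimpleGraph V) (K : Finset V) (y : V) : SimpleGraph V :=
  SimpleGraph.fromRel fun i j => i ∈ K ∧ j ∈ nbhd G K ∧ j ≠ y ∧ G.Adj i j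

theorem gr_bip (h : IsAdj n M) (l : List ℕ) (y : Fin n) : gr n (bip M l y) = bipG (gr n M) (toF n l) y := by
  ext i j
  rw [bip, h.length, gr_mk_adj, bipG, SimpleGraph.fromRel_adj, ← toF_nb h]
  simp only [Bool.and_eq_true, Bool.not_eq_true', ← Bool.not_eq_true, inList_iff, mem_toF, Nat.beq_eq, h.adj_iff,
    ne_eq, Fin.ext_iff, and_assoc]

/-- Makes the condition on all subsets testable. The bound |J| + 1 ≤ |N(J)| for all non-empty J ⊆ K
is Hall's condition after removal of any single y. It yields matchings saturating K, so the doubled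
LP value of each bipartite graph is at least 2|K|. Conversely, the cover of K \ J and N(J) \ {y}
gives |J| ≤ |N(J) \ {y}|. -/
theorem critOne_iff {V : Type} [Fintype V] [DecidableEq V] {G : SimpleGraph V} {K : Finset V} :
    CritOne G K ↔ Ind G K ∧ 1 ≤ K.card ∧ (nbhd G K).card = K.card + 1 ∧
      ∀ y ∈ nbhd G K, 2 * K.card ≤ lam (bipG G K y) := by
  have hadj : ∀ {y i j}, i ∈ K → j ∈ nbhd G K → j ≠ y → G.Adj i j → (bipG G K y).Adj i j := by
    intro y i j hi hj hjy hij
    exact (SimpleGraph.fromRel_adj _ _ _).2 ⟨hij.ne, Or.inl ⟨hi, hj, hjy, hij⟩⟩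
  constructor
  · intro h
    refine ⟨h.ind, h.nonempty.card_pos, h.card, fun y _ => ?_⟩
    obtain ⟨f, hf, hf'⟩ := (Finset.all_card_le_biUnion_card_iff_exists_injective
      (fun v : K => (nbhd G {(v : V)}).erase y)).1 fun s => by
        rcases s.eq_empty_or_nonempty with rfl | hn
        · simp
        have h1 := h.le (s.image Subtype.val) (fun v hv => by
          obtain ⟨w, _, rfl⟩ := Finset.mem_image.1 hv; exact w.2) (hn.image _)
        rw [Finset.card_image_of_injective _ Subtype.val_injective] at h1
        have h2 := Finset.pred_card_le_card_erase (s := nbhd G (s.image Subtype.val)) (a := y)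
        refine (Nat.le_sub_one_of_lt h1).trans (h2.trans (Finset.card_le_card fun w hw => ?_))
        rw [Finset.mem_erase] at hw
        obtain ⟨_, v, hv, hvw⟩ := mem_nbhd.1 hw.2
        obtain ⟨v', hv', rfl⟩ := Finset.mem_image.1 hv
        exact Finset.mem_biUnion.2 ⟨v', hv', Finset.mem_erase.2 ⟨hw.1, mem_nbhd_singleton.2 hvw⟩⟩
    obtain ⟨g, hg, hs⟩ := exists_lam (bipG G K y)
    rw [hs]
    have hf1 : ∀ v : K, G.Adj v (f v) := fun v => mem_nbhd_singleton.1 (Finset.mem_erase.1 (hf' v)).2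
    have hf2 : ∀ v : K, f v ∈ nbhd G K := fun v => h.ind.mem_nbhd v.2 (hf1 v)
    have hf3 : ∀ v : K, f v ≠ y := fun v => (Finset.mem_erase.1 (hf' v)).1
    have hdis : Disjoint K (K.attach.image f) := by
      rw [Finset.disjoint_left]
      intro v hv hv'
      obtain ⟨w, _, rfl⟩ := Finset.mem_image.1 hv'
      exact notMem_nbhd hv (hf2 w)
    calc 2 * K.card = ∑ v ∈ K.attach, 2 := by rw [Finset.sum_const, Finset.card_attach, smul_eq_mul, mul_comm]
      _ ≤ ∑ v ∈ K.attach, (g v + g (f v)) :=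
        Finset.sum_le_sum fun v _ => hg _ _ (hadj v.2 (hf2 v) (hf3 v) (hf1 v))
      _ = ∑ v ∈ K, g v + ∑ v ∈ K.attach.image f, g v := by
        rw [Finset.sum_add_distrib, Finset.sum_attach K (fun v => g v), Finset.sum_image fun a _ b _ e => hf e]
      _ = ∑ v ∈ K ∪ K.attach.image f, g v := (Finset.sum_union hdis).symm
      _ ≤ ∑ v, g v := Finset.sum_le_sum_of_subset (Finset.subset_univ _)
  · rintro ⟨h1, h2, h3, h4⟩
    refine ⟨h1, Finset.card_pos.1 h2, h3, fun J hJ hn => ?_⟩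
    have key : ∀ y ∈ nbhd G K, J.card ≤ ((nbhd G J).erase y).card := by
      intro y hy
      have hc : IsDoubleCover (bipG G K y) fun v =>
          2 * ((if v ∈ K \ J then 1 else 0) + if v ∈ (nbhd G J).erase y then 1 else 0) := by
        have : ∀ i j, i ∈ K → j ∈ nbhd G K → j ≠ y → G.Adj i j →
            i ∈ K \ J ∨ j ∈ (nbhd G J).erase y := by
          intro i j hi hj hjy hij
          by_cases hiJ : i ∈ J
          · exact Or.inr (Finset.mem_erase.2 ⟨hjy, (h1.mono hJ).mem_nbhd hiJ hij⟩)
          · exact Or.inl (Finset.mem_sdiff.2 ⟨hi, hiJ⟩)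
        intro i j hij
        rcases ((SimpleGraph.fromRel_adj _ _ _).1 hij).2 with ⟨h5, h6, h7, h8⟩ | ⟨h5, h6, h7, h8⟩ <;>
          rcases this _ _ h5 h6 h7 h8 with h9 | h9 <;> simp only [h9, if_true] <;> omega
      have h5 := (h4 y hy).trans (lam_le hc)
      rw [← Finset.mul_sum, Finset.sum_add_distrib, ← card_eq_sum_ite, ← card_eq_sum_ite] at h5
      have h6 := Finset.card_sdiff_add_card_eq_card hJ
      omega
    rcases (nbhd G J).eq_empty_or_nonempty with he | ⟨y, hy⟩
    · obtain ⟨y, hy⟩ := Finset.card_pos.1 (show 0 < (nbhd G K).card by omega)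
      have h5 := key y hy
      rw [he, Finset.erase_empty, Finset.card_empty] at h5
      have := hn.card_pos
      omega
    · have h5 := key y (h1.nbhd_mono hJ hy)
      rw [Finset.card_erase_of_mem hy] at h5
      have := Finset.card_pos.2 ⟨y, hy⟩
      omega

theorem critB_iff (h : IsAdj n M) (l : List ℕ) : critB M l = true ↔ CritOne (gr n M) (toF n l) := by
  rw [critOne_iff, critB]
  simp only [Bool.and_eq_true, indB_iff h, h.length, cnt_eq, Nat.ble_eq, Nat.beq_eq, nb_length h,
    List.all_eq_true, and_assoc]
  refine and_congr_right fun _ => and_congr_right fun _ => and_congr_right fun _ => ?_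
  have hb : ∀ y, nu (bip M l y) = lam (gr n (bip M l y)) := fun y => by
    refine IsAdj.nu_eq_lam ?_
    rw [bip, h.length]; exact isAdj_mk _ _
  constructor
  · intro h1 y hy
    rw [← toF_nb h, mem_toF] at hy
    rw [← gr_bip h, ← hb]
    exact h1 y hy
  · intro h1 y hy
    have hyn := mem_nb_lt hy
    rw [h.length] at hyn
    have := h1 ⟨y, hyn⟩ (by rw [← toF_nb h, mem_toF]; exact hy)
    rwa [← gr_bip h, ← hb] at this

end Spec

/-! ### The algorithm -/

/-- The result of a reduction by a set of surplus one, if it is one. -/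
def reduceBy (s : Mat × ℕ) (l : List ℕ) : List (Mat × ℕ) :=
  cond (critB s.1 l)
    (cond (indB s.1 (nb s.1 l)) [(con s.1 l, s.2 + cnt s.1.length l)]
      [(del s.1 (cln s.1 l), s.2 + (cnt s.1.length l + 1))]) []

/-- The result of the reduction at a vertex, if it has degree one. -/
def reduceLeaf (s : Mat × ℕ) (v : ℕ) : List (Mat × ℕ) :=
  cond (Nat.beq (nb s.1 [v]).length 1) [(del s.1 (cln s.1 [v]), s.2 + 1)] []

/-- The results of at most one reduction by at most two vertices. -/
def reductions (s : Mat × ℕ) : List (Mat × ℕ) :=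
  s :: (pairs s.1.length).flatMap fun x => reduceLeaf s x.1 ++ reduceBy s [x.1, x.2]

/-- The results of at most `m` reductions by at most two vertices. -/
def boost : ℕ → Mat × ℕ → List (Mat × ℕ)
  | 0, s => [s]
  | m + 1, s => (reductions s).flatMap fun t => boost m t

/-- The least surplus of an independent superset, plus the number of vertices. -/
def val (M : Mat) (l : List ℕ) : ℕ := nu (del M (cln M l)) + 2 * (nb M l).length

/-- Addition of a vertex, if the result is still contained in a set with the same surplus. -/
def extend (M : Mat) (l : List ℕ) (v : ℕ) : List ℕ :=
  cond (indB M (v :: l) && Nat.beq (val M (v :: l)) (val M l)) (v :: l) l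

/-- A maximal superset with the same value. -/
def clo (M : Mat) (l : List ℕ) : List ℕ := (List.range M.length).foldl (fun l v => extend M l v) l

/-- `ValidBase`, as a truth value. -/
def validB (M : Mat) (u x : List ℕ) : Bool :=
  indB M x && u.all fun z => indB M (z :: x) && Nat.beq (val M (z :: x)) (val M [z])

/-- The first branches. -/
def branchesA (M : Mat) (u : List ℕ) : List (Mat × ℕ) := boost 3 (del M u, cnt M.length u)

/-- The second branches. -/
def branchesB (M : Mat) (u x : List ℕ) : List (Mat × ℕ) :=
  boost 3 (del M (cln M x), (nb M x).length) ++
    cond (indB M (u ++ x)) (reduceBy (del M (cln M x), (nb M x).length) (diffL (clo M (u ++ x)) x)) []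

/-- The branchings for a pair of vertex sets. -/
def branchings (M : Mat) (u x : List ℕ) : List ((Mat × ℕ) × (Mat × ℕ)) :=
  cond (validB M u x) ((branchesA M u).flatMap fun a => (branchesB M u x).map fun b => (a, b)) []

/-- All lists of three numbers below `n`. -/
def triples (n : ℕ) : List (List ℕ) :=
  (List.range n).flatMap fun a => (pairs n).map fun x => [a, x.1, x.2]

/-- All branchings. -/
def candidates (M : Mat) : List ((Mat × ℕ) × (Mat × ℕ)) :=
  (triples M.length).flatMap fun u => (triples M.length).flatMap fun x => branchings M u x

/-- The drops of a branching are at least `(c₁ / 2, k₁)` and `(c₂ / 2, k₂)`. -/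
def hasDrops (c₁ k₁ c₂ k₂ : ℕ) (M : Mat) (x : (Mat × ℕ) × (Mat × ℕ)) : Bool :=
  Nat.ble (nu M + c₁) (2 * x.1.2 + nu x.1.1) && Nat.ble k₁ x.1.2 &&
    (Nat.ble (nu M + c₂) (2 * x.2.2 + nu x.2.1) && Nat.ble k₂ x.2.2)

/-- The first branching that passes a test. -/
def search (acc : Mat → (Mat × ℕ) × (Mat × ℕ) → Bool) (M : Mat) : List (Mat × ℕ) :=
  [(((candidates M).filter fun x => acc M x).headD ((M, 0), (M, 0))).1,
    (((candidates M).filter fun x => acc M x).headD ((M, 0), (M, 0))).2]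

/-! ### Correctness and completeness of the enumeration -/

section Spec
variable {n : ℕ} {M : Mat}

/-- `t` arises from `s` by a reduction. -/
def Reduces (n : ℕ) (s t : Mat × ℕ) : Prop :=
  IsAdj n t.1 ∧ ∃ c, t.2 = s.2 + c ∧ Red (gr n s.1) (gr n t.1) c

theorem Reduces.trans {s t u : Mat × ℕ} (h : Reduces n s t) (h' : Reduces n t u) : Reduces n s u := by
  obtain ⟨_, c, h1, h2⟩ := h
  obtain ⟨h3, d, h4, h5⟩ := h'
  exact ⟨h3, c + d, by omega, h2.trans h5⟩

theorem reduces_of_mem_reduceBy {s t : Mat × ℕ} (h : IsAdj n s.1) {l : List ℕ} (ht : t ∈ reduceBy s l) :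
    Reduces n s t := by
  rw [reduceBy] at ht
  cases hc : critB s.1 l with
  | false => rw [hc] at ht; simp at ht
  | true =>
    have hK := (critB_iff h l).1 hc
    rw [hc, cond_true, h.length] at ht
    cases hi : indB s.1 (nb s.1 l) with
    | true =>
      rw [hi, cond_true, List.mem_singleton] at ht
      subst ht
      have hI := (indB_iff h _).1 hi
      rw [toF_nb h] at hI
      obtain ⟨y, hy, e⟩ := gr_con h l (Finset.card_pos.1 (by rw [hK.card]; omega))
      refine ⟨isAdj_con h l, _, rfl, ?_⟩
      rw [e, cnt_eq]
      exact Red.crit_con hK hI hy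
    | false =>
      rw [hi, cond_false, List.mem_singleton] at ht
      subst ht
      have hI := mt (indB_iff h _).2 (by rw [hi]; simp)
      rw [toF_nb h] at hI
      refine ⟨isAdj_del h _, _, rfl, ?_⟩
      rw [gr_del h, toF_cln h, cnt_eq]
      exact Red.crit_del hK hI

theorem reduces_of_mem_reduceLeaf {s t : Mat × ℕ} (h : IsAdj n s.1) {v : ℕ} (hv : v < n)
    (ht : t ∈ reduceLeaf s v) : Reduces n s t := by
  rw [reduceLeaf] at ht
  cases hc : Nat.beq (nb s.1 [v]).length 1 with
  | false => rw [hc] at ht; simp at ht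
  | true =>
    rw [hc, cond_true, List.mem_singleton] at ht
    subst ht
    have e := toF_one ⟨v, hv⟩
    rw [Nat.beq_eq, nb_length h, e] at hc
    refine ⟨isAdj_del h _, 1, rfl, ?_⟩
    rw [gr_del h, toF_cln h, e]
    exact Red.leaf hc

theorem reduces_of_mem_reductions {s t : Mat × ℕ} (h : IsAdj n s.1) (ht : t ∈ reductions s) :
    Reduces n s t := by
  rw [reductions, List.mem_cons, List.mem_flatMap] at ht
  rcases ht with rfl | ⟨x, hx, ht⟩
  · exact ⟨h, 0, rfl, Red.refl _⟩
  · rw [mem_pairs, h.length] at hx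
    rcases List.mem_append.1 ht with ht | ht
    · exact reduces_of_mem_reduceLeaf h hx.1 ht
    · exact reduces_of_mem_reduceBy h ht

theorem reduces_of_mem_boost {m : ℕ} {s t : Mat × ℕ} (h : IsAdj n s.1) (ht : t ∈ boost m s) :
    Reduces n s t := by
  induction m generalizing s with
  | zero =>
    rw [boost, List.mem_singleton] at ht
    subst ht
    exact ⟨h, 0, rfl, Red.refl _⟩
  | succ m ih =>
    rw [boost, List.mem_flatMap] at ht
    obtain ⟨u, hu, ht⟩ := ht
    have h1 := reduces_of_mem_reductions h hu
    exact h1.trans (ih h1.1 ht)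

theorem self_mem_boost (m : ℕ) (s : Mat × ℕ) : s ∈ boost m s := by
  induction m with
  | zero => exact List.mem_singleton_self s
  | succ m ih => exact List.mem_flatMap.2 ⟨s, List.mem_cons_self, ih⟩

theorem mem_boost_succ {m : ℕ} {s t u : Mat × ℕ} (h : IsAdj n s.1) {v w : Fin n}
    (ht : t ∈ reduceLeaf s v ++ reduceBy s [(v : ℕ), (w : ℕ)]) (hu : u ∈ boost m t) : u ∈ boost (m + 1) s :=
  List.mem_flatMap.2 ⟨t, List.mem_cons_of_mem _ (List.mem_flatMap.2
    ⟨(v, w), mem_pairs.2 (by rw [h.length]; exact ⟨v.2, w.2⟩), ht⟩), hu⟩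

theorem exists_mem_reduceBy {s : Mat × ℕ} (h : IsAdj n s.1) {l : List ℕ} (hK : CritOne (gr n s.1) (toF n l)) :
    ∃ t ∈ reduceBy s l, IsAdj n t.1 ∧
      (¬ Ind (gr n s.1) (nbhd (gr n s.1) (toF n l)) ∧ t.2 = s.2 + ((toF n l).card + 1) ∧
          gr n t.1 = delG (gr n s.1) (toF n l ∪ nbhd (gr n s.1) (toF n l)) ∨
        Ind (gr n s.1) (nbhd (gr n s.1) (toF n l)) ∧ t.2 = s.2 + (toF n l).card ∧
          ∃ y ∈ nbhd (gr n s.1) (toF n l), gr n t.1 = conG (gr n s.1) (toF n l) y) := by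
  have hc := (critB_iff h l).2 hK
  rw [reduceBy, hc, cond_true, h.length, cnt_eq]
  cases hi : indB s.1 (nb s.1 l) with
  | true =>
    have hI := (indB_iff h _).1 hi
    rw [toF_nb h] at hI
    exact ⟨_, List.mem_singleton_self _, isAdj_con h l, Or.inr ⟨hI, rfl,
      gr_con h l (Finset.card_pos.1 (by rw [hK.card]; omega))⟩⟩
  | false =>
    have hI := mt (indB_iff h _).2 (by rw [hi]; simp)
    rw [toF_nb h] at hI
    exact ⟨_, List.mem_singleton_self _, isAdj_del h _, Or.inl ⟨hI, rfl, by rw [gr_del h, toF_cln h]⟩⟩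

theorem Gain.exists_mem_boost {m c : ℕ} {H : SimpleGraph (Fin n)} (hg : Gain m H c) {s : Mat × ℕ}
    (h : IsAdj n s.1) (hs : gr n s.1 = H) : ∃ t ∈ boost m s, s.2 + c ≤ t.2 := by
  induction hg generalizing s with
  | zero m H => exact ⟨s, self_mem_boost m s, le_rfl⟩
  | @leaf m H c v hv _ ih =>
    subst hs
    have h1 : (del s.1 (cln s.1 [(v : ℕ)]), s.2 + 1) ∈ reduceLeaf s v := by
      have : Nat.beq (nb s.1 [(v : ℕ)]).length 1 = true := by rw [Nat.beq_eq, nb_length h, toF_one, hv]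
      rw [reduceLeaf, this]
      exact List.mem_singleton_self _
    obtain ⟨t, ht, hts⟩ := ih (s := (del s.1 (cln s.1 [(v : ℕ)]), s.2 + 1)) (isAdj_del h _)
      (by rw [gr_del h, toF_cln h, toF_one])
    refine ⟨t, mem_boost_succ (w := v) h (List.mem_append_left _ h1) ht, ?_⟩
    change s.2 + 1 + (c - 1) ≤ t.2 at hts
    omega
  | @crit m H c v w hK _ _ ih₁ ih₂ =>
    subst hs
    rw [← toF_two] at hK ih₁ ih₂
    obtain ⟨t, ht, hta, ⟨h1, h2, h3⟩ | ⟨h1, h2, y, hy, h3⟩⟩ := exists_mem_reduceBy (s := s) h hK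
    · obtain ⟨u, hu, hus⟩ := ih₁ h1 hta h3
      exact ⟨u, mem_boost_succ h (List.mem_append_right _ ht) hu, by omega⟩
    · obtain ⟨u, hu, hus⟩ := ih₂ h1 y hy hta h3
      exact ⟨u, mem_boost_succ h (List.mem_append_right _ ht) hu, by omega⟩

theorem val_eq (h : IsAdj n M) (l : List ℕ) : (val M l : ℤ) = sig (gr n M) (toF n l) + n := by
  rw [val, (isAdj_del h _).nu_eq_lam, gr_del h, toF_cln h, nb_length h, sig, Fintype.card_fin]
  push_cast
  ring

theorem val_eq_val_iff (h : IsAdj n M) (l m : List ℕ) :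
    val M l = val M m ↔ sig (gr n M) (toF n l) = sig (gr n M) (toF n m) := by
  have h1 := val_eq h l
  have h2 := val_eq h m
  omega

theorem extend_cases (h : IsAdj n M) (l : List ℕ) {v : ℕ} (hv : v < n) :
    extend M l v = v :: l ∧ Ind (gr n M) (insert ⟨v, hv⟩ (toF n l)) ∧
      sig (gr n M) (insert ⟨v, hv⟩ (toF n l)) = sig (gr n M) (toF n l) ∨
    extend M l v = l ∧ ¬ (Ind (gr n M) (insert ⟨v, hv⟩ (toF n l)) ∧
      sig (gr n M) (insert ⟨v, hv⟩ (toF n l)) = sig (gr n M) (toF n l)) := by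
  have key : (indB M (v :: l) && Nat.beq (val M (v :: l)) (val M l)) = true ↔
      Ind (gr n M) (insert ⟨v, hv⟩ (toF n l)) ∧
      sig (gr n M) (insert ⟨v, hv⟩ (toF n l)) = sig (gr n M) (toF n l) := by
    rw [Bool.and_eq_true, indB_iff h, Nat.beq_eq, val_eq_val_iff h, toF_cons hv]
  rw [← key, extend]
  cases (indB M (v :: l) && Nat.beq (val M (v :: l)) (val M l)) <;> simp

/-- One pass is enough: `sig` is monotone, so a vertex that is rejected once remains unacceptable
for every later, larger set. -/
theorem foldl_extend (h : IsAdj n M) (r : List ℕ) (hr : ∀ v ∈ r, v < n) (l : List ℕ)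
    (hl : Ind (gr n M) (toF n l)) :
    let I := toF n (r.foldl (fun l v => extend M l v) l)
    Ind (gr n M) I ∧ toF n l ⊆ I ∧ sig (gr n M) I = sig (gr n M) (toF n l) ∧
      ∀ v : Fin n, (v : ℕ) ∈ r → Ind (gr n M) (insert v I) →
        sig (gr n M) (insert v I) = sig (gr n M) (toF n l) → v ∈ I := by
  induction r generalizing l with
  | nil => exact ⟨hl, le_rfl, rfl, fun v hv => by simp at hv⟩
  | cons a r ih =>
    have ha := hr a List.mem_cons_self
    have hr' : ∀ v ∈ r, v < n := fun v hv => hr v (List.mem_cons_of_mem a hv)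
    rw [List.foldl_cons]
    rcases extend_cases h l ha with ⟨h1, h2, h3⟩ | ⟨h1, h2⟩ <;> rw [h1]
    · obtain ⟨h4, h5, h6, h7⟩ := ih hr' (a :: l) (by rwa [toF_cons ha])
      rw [toF_cons ha] at h5 h6 h7
      rw [h3] at h6 h7
      refine ⟨h4, (Finset.subset_insert _ _).trans h5, h6, fun v hv => ?_⟩
      rcases List.mem_cons.1 hv with rfl | hv
      · exact fun _ _ => h5 (Finset.mem_insert_self _ _)
      · exact h7 v hv
    · obtain ⟨h4, h5, h6, h7⟩ := ih hr' l hl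
      refine ⟨h4, h5, h6, fun v hv hvI hvs => ?_⟩
      rcases List.mem_cons.1 hv with rfl | hv
      · refine absurd ⟨hvI.mono (Finset.insert_subset_insert _ h5), le_antisymm ?_ ?_⟩ h2
        · exact hvs ▸ sig_mono hvI (Finset.insert_subset_insert _ h5)
        · exact sig_mono (hvI.mono (Finset.insert_subset_insert _ h5)) (Finset.subset_insert _ _)
      · exact h7 v hv hvI hvs

/-- A set attaining `sig` of the closure could only add vertices that the greedy pass would have
accepted, so the closure attains it itself. -/
theorem clo_spec (h : IsAdj n M) {l : List ℕ} (hl : Ind (gr n M) (toF n l)) :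
    Ind (gr n M) (toF n (clo M l)) ∧ toF n l ⊆ toF n (clo M l) ∧
      surplus (gr n M) (toF n (clo M l)) = sig (gr n M) (toF n l) := by
  obtain ⟨h1, h2, h3, h4⟩ := foldl_extend h (List.range M.length) (fun v hv => by
    rwa [List.mem_range, h.length] at hv) l hl
  rw [← clo] at h1 h2 h3 h4
  refine ⟨h1, h2, ?_⟩
  obtain ⟨I, hI, hsub, hs⟩ := exists_sig h1
  have : I = toF n (clo M l) := by
    refine Finset.Subset.antisymm (fun v hv => ?_) hsub
    have h5 : insert v (toF n (clo M l)) ⊆ I := Finset.insert_subset hv hsub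
    refine h4 v (by rw [List.mem_range, h.length]; exact v.2) (hI.mono h5) (le_antisymm ?_ ?_)
    · rw [← h3, ← hs]
      exact sig_le hI h5
    · rw [← h3]
      exact sig_mono (hI.mono h5) (Finset.subset_insert _ _)
  rw [← h3, ← hs, this]

theorem validB_iff (h : IsAdj n M) {u : List ℕ} (hu : ∀ z ∈ u, z < n) (x : List ℕ) :
    validB M u x = true ↔ ValidBase (gr n M) (toF n u) (toF n x) := by
  rw [validB, ValidBase]
  simp only [Bool.and_eq_true, indB_iff h, List.all_eq_true, Nat.beq_eq, val_eq_val_iff h]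
  refine and_congr_right fun _ => ?_
  constructor
  · intro h1 z hz
    have := h1 z (mem_toF.1 hz)
    rwa [toF_cons z.2, toF_one] at this
  · intro h1 z hz
    have := h1 ⟨z, hu z hz⟩ (mem_toF.2 hz)
    rwa [toF_cons (hu z hz), toF_one ⟨z, hu z hz⟩]

theorem mem_triples {l : List ℕ} : l ∈ triples n ↔ ∃ a b c, a < n ∧ b < n ∧ c < n ∧ l = [a, b, c] := by
  simp only [triples, List.mem_flatMap, List.mem_range, List.mem_map, mem_pairs, Prod.exists]
  constructor
  · rintro ⟨a, ha, b, c, ⟨hb, hc⟩, rfl⟩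
    exact ⟨a, b, c, ha, hb, hc, rfl⟩
  · rintro ⟨a, b, c, ha, hb, hc, rfl⟩
    exact ⟨a, ha, b, c, ⟨hb, hc⟩, rfl⟩

/-- Entries may repeat, so triples also represent sets of one or two vertices. -/
theorem exists_triple {U : Finset (Fin n)} (hU : U.Nonempty ∧ U.card ≤ 3) : ∃ l ∈ triples n, toF n l = U := by
  obtain ⟨a, b, c, rfl⟩ : ∃ a b c, U = {a, b, c} := by
    have := hU.1.card_pos
    rcases (by omega : U.card = 1 ∨ U.card = 2 ∨ U.card = 3) with h | h | h
    · obtain ⟨a, rfl⟩ := Finset.card_eq_one.1 h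
      exact ⟨a, a, a, by simp⟩
    · obtain ⟨a, b, _, rfl⟩ := Finset.card_eq_two.1 h
      exact ⟨a, b, b, by simp⟩
    · obtain ⟨a, b, c, _, _, _, rfl⟩ := Finset.card_eq_three.1 h
      exact ⟨a, b, c, rfl⟩
  exact ⟨[(a : ℕ), (b : ℕ), (c : ℕ)], mem_triples.2 ⟨a, b, c, a.2, b.2, c.2, rfl⟩, by
    rw [toF_cons a.2, toF_two]⟩

theorem mem_candidates {p : (Mat × ℕ) × (Mat × ℕ)} : p ∈ candidates M ↔
    ∃ u ∈ triples M.length, ∃ x ∈ triples M.length, validB M u x = true ∧ p.1 ∈ branchesA M u ∧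
      p.2 ∈ branchesB M u x := by
  simp only [candidates, List.mem_flatMap]
  refine exists_congr fun u => and_congr_right fun _ => exists_congr fun x => and_congr_right fun _ => ?_
  rw [branchings]
  cases validB M u x with
  | false => simp
  | true =>
    simp only [cond_true, List.mem_flatMap, List.mem_map, true_and]
    constructor
    · rintro ⟨a, ha, b, hb, rfl⟩
      exact ⟨ha, hb⟩
    · rintro ⟨ha, hb⟩
      exact ⟨_, ha, _, hb, rfl⟩

theorem hasDrops_iff {c₁ k₁ c₂ k₂ : ℕ} {p : (Mat × ℕ) × (Mat × ℕ)} : hasDrops c₁ k₁ c₂ k₂ M p = true ↔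
    (nu M + c₁ ≤ 2 * p.1.2 + nu p.1.1 ∧ k₁ ≤ p.1.2) ∧ nu M + c₂ ≤ 2 * p.2.2 + nu p.2.1 ∧ k₂ ≤ p.2.2 := by
  simp [hasDrops]

theorem reduces_of_mem_branchesA (h : IsAdj n M) {u : List ℕ} {t : Mat × ℕ} (ht : t ∈ branchesA M u) :
    Reduces n (del M u, (toF n u).card) t := by
  rw [branchesA, h.length, cnt_eq] at ht
  exact reduces_of_mem_boost (isAdj_del h u) ht

theorem reduces_of_mem_branchesB (h : IsAdj n M) {u x : List ℕ} {t : Mat × ℕ} (ht : t ∈ branchesB M u x) :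
    Reduces n (del M (cln M x), (nbhd (gr n M) (toF n x)).card) t := by
  rw [branchesB, nb_length h, List.mem_append] at ht
  rcases ht with ht | ht
  · exact reduces_of_mem_boost (isAdj_del h _) ht
  · cases hi : indB M (u ++ x) with
    | false => rw [hi] at ht; simp at ht
    | true =>
      rw [hi, cond_true] at ht
      exact reduces_of_mem_reduceBy (isAdj_del h _) ht

/-- Candidates are branchings. -/
theorem candidates_sound (h : IsAdj n M) {p : (Mat × ℕ) × (Mat × ℕ)} (hp : p ∈ candidates M) :
    IsAdj n p.1.1 ∧ IsAdj n p.2.1 ∧ ∀ k : ℤ, Feasible (gr n M) k ↔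
      Feasible (gr n p.1.1) (k - p.1.2) ∨ Feasible (gr n p.2.1) (k - p.2.2) := by
  obtain ⟨u, hu, x, -, hv, hA, hB⟩ := mem_candidates.1 hp
  rw [h.length, mem_triples] at hu
  obtain ⟨a, b, c, ha, hb, hc, rfl⟩ := hu
  rw [validB_iff h (by simp [ha, hb, hc])] at hv
  obtain ⟨h1, c, h2, h3⟩ := reduces_of_mem_branchesA h hA
  obtain ⟨h4, d, h5, h6⟩ := reduces_of_mem_branchesB h hB
  refine ⟨h1, h4, fun k => ?_⟩
  rw [hv.feasible_iff k, ← gr_del h, h3.feasible, ← toF_cln h, ← gr_del h, h6.feasible, h2, h5]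
  push_cast
  rw [sub_sub, sub_sub]

/-- Available branchings are found. -/
theorem Win.exists_candidate {c₁ k₁ c₂ k₂ : ℕ} (h : IsAdj n M) (hw : Win (gr n M) c₁ k₁ c₂ k₂) :
    ∃ p ∈ candidates M, hasDrops c₁ k₁ c₂ k₂ M p = true := by
  obtain ⟨U, X, hU, hX, hv, ⟨hc₁, g, hg, hk₁⟩, hc₂, hB⟩ := hw
  obtain ⟨u, hu, rfl⟩ := exists_triple hU
  obtain ⟨x, hx, rfl⟩ := exists_triple hX
  have hu' : ∀ z ∈ u, z < n := by
    obtain ⟨a, b, c, ha, hb, hc, rfl⟩ := mem_triples.1 hu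
    simp [ha, hb, hc]
  obtain ⟨s, hs, hsk⟩ : ∃ s ∈ branchesA M u, k₁ ≤ s.2 := by
    obtain ⟨s, hs, hsk⟩ := hg.exists_mem_boost (s := (del M u, cnt M.length u)) (isAdj_del h u) (gr_del h u)
    refine ⟨s, hs, hk₁.trans (le_trans ?_ hsk)⟩
    rw [h.length, cnt_eq]
  have hgr : gr n (del M (cln M x)) = delG (gr n M) (toF n x ∪ nbhd (gr n M) (toF n x)) := by
    rw [gr_del h, toF_cln h]
  obtain ⟨t, ht, htk⟩ : ∃ t ∈ branchesB M u x, k₂ ≤ t.2 := by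
    rw [branchesB]
    rcases hB with ⟨g, hg, hk₂⟩ | ⟨hI, hB⟩
    · obtain ⟨t, ht, htk⟩ := hg.exists_mem_boost (s := (del M (cln M x), (nb M x).length)) (isAdj_del h _) hgr
      refine ⟨t, List.mem_append_left _ ht, hk₂.trans (le_trans ?_ htk)⟩
      rw [nb_length h]
    · rw [← toF_append] at hI hB
      obtain ⟨h1, h2, h3⟩ := clo_spec h hI
      obtain ⟨hK, hk₂⟩ := hB _ h1 h2 h3
      rw [← toF_diffL] at hK hk₂
      rw [(indB_iff h _).2 hI, cond_true]
      obtain ⟨t, ht, -, h4⟩ := exists_mem_reduceBy (s := (del M (cln M x), (nb M x).length)) (isAdj_del h _)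
        (l := diffL (clo M (u ++ x)) x) (by rwa [hgr])
      refine ⟨t, List.mem_append_right _ ht, hk₂.trans ?_⟩
      rw [← nb_length h]
      rcases h4 with ⟨_, h5, _⟩ | ⟨_, h5, _⟩
      · rw [h5]; simp only; omega
      · exact h5.ge
  refine ⟨(s, t), mem_candidates.2 ⟨u, by rwa [h.length], x, by rwa [h.length], (validB_iff h hu' x).2 hv, hs, ht⟩,
    hasDrops_iff.2 ⟨⟨?_, hsk⟩, ?_, htk⟩⟩
  · obtain ⟨h1, c, h2, h3⟩ := reduces_of_mem_branchesA h hs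
    have h4 := h3.lam_le
    rw [h.nu_eq_lam, h1.nu_eq_lam]
    rw [gr_del h] at h4
    simp only at h2 h4 ⊢
    omega
  · obtain ⟨h1, c, h2, h3⟩ := reduces_of_mem_branchesB h ht
    have h4 := h3.lam_le
    rw [h.nu_eq_lam, h1.nu_eq_lam]
    rw [hgr] at h4
    simp only at h2 h4 ⊢
    omega

end Spec

/-! ### Running time of the enumeration -/

section Time
variable {γ : Type} [Enc γ]

@[fun_prop]
theorem PT.inList {l : γ → List ℕ} {v : γ → ℕ} (hl : PT l) (hv : PT v) : PT (fun c => inList (l c) (v c)) := by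
  unfold _root_.inList; fun_prop

@[fun_prop]
theorem PT.cnt {n : γ → ℕ} {l : γ → List ℕ} (hn : PT n) (hl : PT l) : PT (fun c => cnt (n c) (l c)) := by
  unfold _root_.cnt; fun_prop

@[fun_prop]
theorem PT.diffL {l m : γ → List ℕ} (hl : PT l) (hm : PT m) : PT (fun c => diffL (l c) (m c)) := by
  unfold _root_.diffL; fun_prop

@[fun_prop]
theorem PT.nb {M : γ → Mat} {l : γ → List ℕ} (hM : PT M) (hl : PT l) : PT (fun c => nb (M c) (l c)) := by
  unfold _root_.nb; fun_prop

@[fun_prop]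
theorem PT.cln {M : γ → Mat} {l : γ → List ℕ} (hM : PT M) (hl : PT l) : PT (fun c => cln (M c) (l c)) := by
  unfold _root_.cln; fun_prop

@[fun_prop]
theorem PT.del {M : γ → Mat} {l : γ → List ℕ} (hM : PT M) (hl : PT l) : PT (fun c => del (M c) (l c)) := by
  unfold _root_.del; fun_prop

@[fun_prop]
theorem PT.con {M : γ → Mat} {l : γ → List ℕ} (hM : PT M) (hl : PT l) : PT (fun c => con (M c) (l c)) := by
  unfold _root_.con; fun_prop

@[fun_prop]
theorem PT.indB {M : γ → Mat} {l : γ → List ℕ} (hM : PT M) (hl : PT l) : PT (fun c => indB (M c) (l c)) := by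
  unfold _root_.indB; fun_prop

@[fun_prop]
theorem PT.bip {M : γ → Mat} {l : γ → List ℕ} {y : γ → ℕ} (hM : PT M) (hl : PT l) (hy : PT y) :
    PT (fun c => bip (M c) (l c) (y c)) := by
  unfold _root_.bip; fun_prop

@[fun_prop]
theorem PT.critB {M : γ → Mat} {l : γ → List ℕ} (hM : PT M) (hl : PT l) : PT (fun c => critB (M c) (l c)) := by
  unfold _root_.critB; fun_prop

@[fun_prop]
theorem PT.reduceBy {s : γ → Mat × ℕ} {l : γ → List ℕ} (hs : PT s) (hl : PT l) :
    PT (fun c => reduceBy (s c) (l c)) := by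
  unfold _root_.reduceBy; fun_prop

@[fun_prop]
theorem PT.reduceLeaf {s : γ → Mat × ℕ} {v : γ → ℕ} (hs : PT s) (hv : PT v) :
    PT (fun c => reduceLeaf (s c) (v c)) := by
  unfold _root_.reduceLeaf; fun_prop

@[fun_prop]
theorem PT.reductions {s : γ → Mat × ℕ} (hs : PT s) : PT (fun c => reductions (s c)) := by
  unfold _root_.reductions; fun_prop

theorem PT.boost (m : ℕ) : PT (boost m) := by
  induction m with
  | zero =>
    change PT fun s => [s]
    fun_prop
  | succ m ih =>
    change PT fun s => (_root_.reductions s).flatMap fun t => _root_.boost m t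
    fun_prop

@[fun_prop]
theorem PT.val {M : γ → Mat} {l : γ → List ℕ} (hM : PT M) (hl : PT l) : PT (fun c => val (M c) (l c)) := by
  unfold _root_.val; fun_prop

@[fun_prop]
theorem PT.extend {M : γ → Mat} {l : γ → List ℕ} {v : γ → ℕ} (hM : PT M) (hl : PT l) (hv : PT v) :
    PT (fun c => extend (M c) (l c) (v c)) := by
  unfold _root_.extend; fun_prop

theorem esize_foldl_extend_le (M : Mat) (r l : List ℕ) :
    esize (r.foldl (fun l v => extend M l v) l) ≤ esize r + esize l := by
  induction r generalizing l with
  | nil => simp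
  | cons a r ih =>
    rw [List.foldl_cons, esize_cons]
    refine (ih _).trans ?_
    have : esize (extend M l a) ≤ esize a + esize l + 1 := by
      rw [extend]
      cases (_root_.indB M (a :: l) && Nat.beq (_root_.val M (a :: l)) (_root_.val M l)) with
      | false => rw [cond_false]; omega
      | true => rw [cond_true, esize_cons]
    omega

@[fun_prop]
theorem PT.clo {M : γ → Mat} {l : γ → List ℕ} (hM : PT M) (hl : PT l) : PT (fun c => clo (M c) (l c)) := by
  have hr : PT (fun c => List.range (M c).length) := by fun_prop
  obtain ⟨P, hP⟩ := hr.size_le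
  obtain ⟨Q, hQ⟩ := hl.size_le
  refine PT.foldl (f := fun c l v => _root_.extend (M c) l v) hr hl (by fun_prop) (P + Q) fun c l₁ l₂ e => ?_
  refine (esize_foldl_extend_le _ _ _).trans ?_
  have h1 := hP c
  rw [e] at h1
  have h2 := esize_append l₁ l₂
  have h3 := hQ c
  have h4 := esize_pos l₂
  rw [Polynomial.eval_add]
  omega

@[fun_prop]
theorem PT.validB {M : γ → Mat} {u x : γ → List ℕ} (hM : PT M) (hu : PT u) (hx : PT x) :
    PT (fun c => validB (M c) (u c) (x c)) := by
  unfold _root_.validB; fun_prop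

@[fun_prop]
theorem PT.branchesA {M : γ → Mat} {u : γ → List ℕ} (hM : PT M) (hu : PT u) :
    PT (fun c => branchesA (M c) (u c)) := by
  have h := PT.boost 3
  unfold _root_.branchesA
  exact PT.comp' (f := fun c => (_root_.del (M c) (u c), _root_.cnt (M c).length (u c))) h (by fun_prop)

@[fun_prop]
theorem PT.branchesB {M : γ → Mat} {u x : γ → List ℕ} (hM : PT M) (hu : PT u) (hx : PT x) :
    PT (fun c => branchesB (M c) (u c) (x c)) := by
  have h : PT (fun c => _root_.boost 3 (_root_.del (M c) (_root_.cln (M c) (x c)), (_root_.nb (M c) (x c)).length)) :=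
    PT.comp' (f := fun c => (_root_.del (M c) (_root_.cln (M c) (x c)), (_root_.nb (M c) (x c)).length))
      (PT.boost 3) (by fun_prop)
  unfold _root_.branchesB
  fun_prop

@[fun_prop]
theorem PT.branchings {M : γ → Mat} {u x : γ → List ℕ} (hM : PT M) (hu : PT u) (hx : PT x) :
    PT (fun c => branchings (M c) (u c) (x c)) := by
  unfold _root_.branchings; fun_prop

@[fun_prop]
theorem PT.triples {n : γ → ℕ} (hn : PT n) : PT (fun c => triples (n c)) := by
  unfold _root_.triples; fun_prop

@[fun_prop]
theorem PT.candidates {M : γ → Mat} (hM : PT M) : PT (fun c => candidates (M c)) := by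
  unfold _root_.candidates; fun_prop

@[fun_prop]
theorem PT.hasDrops {M : γ → Mat} {x : γ → (Mat × ℕ) × (Mat × ℕ)} (c₁ k₁ c₂ k₂ : ℕ) (hM : PT M) (hx : PT x) :
    PT (fun c => hasDrops c₁ k₁ c₂ k₂ (M c) (x c)) := by
  unfold _root_.hasDrops; fun_prop

theorem PT.search {acc : Mat → (Mat × ℕ) × (Mat × ℕ) → Bool}
    (h : PT fun x : Mat × (Mat × ℕ) × (Mat × ℕ) => acc x.1 x.2) : PT (search acc) := by
  have h' : PT fun M : Mat => ((_root_.candidates M).filter fun x => acc M x).headD ((M, 0), (M, 0)) := by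
    fun_prop
  unfold _root_.search
  fun_prop

end Time

/-! ### Domination -/

theorem val_pair {a b : ℝ} (c₁ k₁ c₂ k₂ : ℝ) : BranchSeq.val a b [(c₁, k₁), (c₂, k₂)] =
    Real.exp (-a * c₁ - b * k₁) + Real.exp (-a * c₂ - b * k₂) := by
  simp [BranchSeq.val]

/-- The branch-seq `[(c₁ / 2, k₁), (c₂ / 2, k₂)]`. -/
noncomputable def pairSeq (c₁ k₁ c₂ k₂ : ℕ) : BranchSeq :=
  [((c₁ : ℝ) / 2, (k₁ : ℝ)), ((c₂ : ℝ) / 2, (k₂ : ℝ))]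

/-- Domination between pairs, in terms of `p = exp (-a / 2)` and `q = exp (-b)`. -/
theorem dominates_pair {c₁ k₁ c₂ k₂ c₃ k₃ c₄ k₄ : ℕ}
    (h : ∀ p q : ℝ, 0 < p → p ≤ 1 → 0 < q → q ≤ 1 →
      p ^ c₁ * q ^ k₁ + p ^ c₂ * q ^ k₂ ≤ p ^ c₃ * q ^ k₃ + p ^ c₄ * q ^ k₄) :
    Dominates (pairSeq c₁ k₁ c₂ k₂) (pairSeq c₃ k₃ c₄ k₄) := by
  intro a b ha hb
  have key : ∀ c k : ℕ, Real.exp (-a * ((c : ℝ) / 2) - b * k) = Real.exp (-a / 2) ^ c * Real.exp (-b) ^ k := by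
    intro c k
    rw [← Real.exp_nat_mul, ← Real.exp_nat_mul, ← Real.exp_add]
    congr 1
    ring
  rw [pairSeq, pairSeq, val_pair, val_pair, key, key, key, key]
  exact h _ _ (Real.exp_pos _) (Real.exp_le_one_iff.2 (by linarith)) (Real.exp_pos _)
    (Real.exp_le_one_iff.2 (by linarith))

theorem dominates_mono {c₁ k₁ c₂ k₂ c₃ k₃ c₄ k₄ : ℕ} (h₁ : c₃ ≤ c₁) (h₂ : k₃ ≤ k₁) (h₃ : c₄ ≤ c₂) (h₄ : k₄ ≤ k₂) :
    Dominates (pairSeq c₁ k₁ c₂ k₂) (pairSeq c₃ k₃ c₄ k₄) :=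
  dominates_pair fun p q hp hp1 hq hq1 => by
    have := pow_le_pow_of_le_one hp.le hp1 h₁
    have := pow_le_pow_of_le_one hq.le hq1 h₂
    have := pow_le_pow_of_le_one hp.le hp1 h₃
    have := pow_le_pow_of_le_one hq.le hq1 h₄
    gcongr

theorem dominates_swap {c₁ k₁ c₂ k₂ : ℕ} :
    Dominates (pairSeq c₁ k₁ c₂ k₂) (pairSeq c₂ k₂ c₁ k₁) :=
  dominates_pair fun p q _ _ _ _ => by rw [add_comm]

/-- The right side minus the left is p²q³(1 - q)². In the next three lemmas, too, the last term
supplied to `nlinarith` is this difference in factored form. -/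
theorem dominates_balanced :
    Dominates (pairSeq 2 4 2 4) (pairSeq 2 3 2 5) :=
  dominates_pair fun p q hp _ hq _ => by
    have h : 0 ≤ p ^ 2 * q ^ 3 * (1 - q) ^ 2 := by positivity
    nlinarith [h]

theorem dominates_first :
    Dominates (pairSeq 2 2 3 5) (pairSeq 1 1 4 5) :=
  dominates_pair fun p q hp hp1 hq hq1 => by
    have h1 : p ^ 2 * q ^ 4 * (1 - p) ≤ 1 - p :=
      mul_le_of_le_one_left (by linarith) (mul_le_one₀ (pow_le_one₀ hp.le hp1) (by positivity) (pow_le_one₀ hq.le hq1))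
    have h2 : p * q ≤ p := mul_le_of_le_one_right hp.le hq1
    have h3 : 0 ≤ p * q * (1 - p * q - p ^ 2 * q ^ 4 * (1 - p)) :=
      mul_nonneg (by positivity) (by linarith)
    nlinarith [h3]

theorem dominates_second :
    Dominates (pairSeq 2 2 3 5) (pairSeq 1 2 4 5) :=
  dominates_pair fun p q hp hp1 hq hq1 => by
    have h1 : p ^ 2 * q ^ 3 ≤ 1 := mul_le_one₀ (pow_le_one₀ hp.le hp1) (by positivity) (pow_le_one₀ hq.le hq1)
    have h3 : 0 ≤ p * q ^ 2 * ((1 - p) * (1 - p ^ 2 * q ^ 3)) :=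
      mul_nonneg (by positivity) (mul_nonneg (by linarith) (by linarith))
    nlinarith [h3]

theorem dominates_of_two_two : Dominates (pairSeq 2 2 2 4) (pairSeq 1 1 3 4) :=
  dominates_pair fun p q hp hp1 hq hq1 => by
    have h2 : p * q ≤ p := mul_le_of_le_one_right hp.le hq1
    have h1 : p * q ^ 3 * (1 - p) ≤ 1 - p :=
      mul_le_of_le_one_left (by linarith) (mul_le_one₀ hp1 (by positivity) (pow_le_one₀ hq.le hq1))
    have h3 : 0 ≤ p * q * (1 - p * q - p * q ^ 3 * (1 - p)) :=
      mul_nonneg (by positivity) (by linarith)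
    nlinarith [h3]

/-! ### Soundness and completeness -/

theorem finGraph_enc {n : ℕ} {M : Mat} (h : IsAdj n M) : FinGraph.enc ⟨n, gr n M⟩ = Enc.enc M := by
  classical
  change Data.ofList _ = Data.ofList (M.map Enc.enc)
  congr 1
  obtain ⟨f, rfl⟩ := h
  refine List.ext_getElem (by simp [mk]) fun i h1 h2 => ?_
  rw [List.length_ofFn] at h1
  rw [List.getElem_ofFn, List.getElem_map]
  change Data.ofList _ = Data.ofList (List.map Enc.enc _)
  congr 1
  refine List.ext_getElem (by simp [mk]) fun j h3 h4 => ?_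
  rw [List.length_ofFn] at h3
  rw [List.getElem_ofFn, List.getElem_map]
  change Data.ofBool _ = Data.ofBool _
  congr 1
  have h5 := (isAdj_mk n f).adj_iff (i := ⟨i, h1⟩) (j := ⟨j, h3⟩)
  rw [adj_mk h1 h3] at h5
  rw [Bool.eq_iff_iff, decide_eq_true_iff, h5]
  simp [mk]

theorem FinGraph.exists_mat (G : FinGraph) : ∃ M, IsAdj G.n M ∧ gr G.n M = G.graph := by
  classical
  refine ⟨_root_.mk G.n fun i j => if h : i < G.n ∧ j < G.n then decide (G.graph.Adj ⟨i, h.1⟩ ⟨j, h.2⟩) else false,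
    isAdj_mk _ _, ?_⟩
  ext i j
  rw [gr_mk_adj]
  simp only [Fin.is_lt, and_self, dif_pos, decide_eq_true_eq, Fin.eta]
  exact ⟨fun h => h.2.elim id fun h => h.symm, fun h => ⟨h.ne, Or.inl h⟩⟩

theorem dg_eq_degree {V : Type} [Fintype V] [DecidableEq V] (G : SimpleGraph V) [DecidableRel G.Adj] (v : V) :
    dg G v = G.degree v := by
  rw [dg, ← SimpleGraph.card_neighborFinset_eq_degree]
  congr 1
  ext w
  rw [mem_nbhd_singleton, SimpleGraph.mem_neighborFinset]

theorem FinGraph.dg_le_maxDeg (G : FinGraph) (v : Fin G.n) : dg G.graph v ≤ G.maxDeg := by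
  classical
  rw [dg_eq_degree, FinGraph.maxDeg]
  convert G.graph.degree_le_maxDegree v

theorem FinGraph.maxDeg_le (G : FinGraph) {k : ℕ} (h : ∀ v, dg G.graph v ≤ k) : G.maxDeg ≤ k := by
  classical
  rw [FinGraph.maxDeg]
  refine SimpleGraph.maxDegree_le_of_forall_degree_le _ _ fun v => ?_
  convert h v using 1
  rw [dg_eq_degree]

theorem FinGraph.exists_dg_eq (G : FinGraph) (h : 0 < G.maxDeg) : ∃ v, dg G.graph v = G.maxDeg := by
  by_contra! hcon
  have := G.maxDeg_le (k := G.maxDeg - 1) fun v => by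
    have := G.dg_le_maxDeg v
    have := hcon v
    omega
  omega

theorem hasDrop_of_le {G : FinGraph} {M : Mat} (hM : IsAdj G.n M) (hG : gr G.n M = G.graph) {s : Mat × ℕ}
    (hs : IsAdj G.n s.1) {c d : ℕ} (hc : nu M + c ≤ 2 * s.2 + nu s.1) (hd : d ≤ s.2) (k : ℤ) :
    HasDrop G k ⟨G.n, gr G.n s.1⟩ (k - s.2) ((c : ℝ) / 2, (d : ℝ)) := by
  constructor
  · push_cast
    have : (d : ℝ) ≤ s.2 := by exact_mod_cast hd
    linarith
  · rw [mu, mu, ← hG, hM.lpOpt_eq, hs.lpOpt_eq, ← hM.nu_eq_lam, ← hs.nu_eq_lam]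
    push_cast
    have : (nu M : ℝ) + c ≤ 2 * s.2 + nu s.1 := by exact_mod_cast hc
    linarith

/-- The subproblem of a state. -/
def subproblem (n : ℕ) (s : Mat × ℕ) : Subproblem := ⟨⟨n, gr n s.1⟩, s.2⟩

theorem subproblem_enc {n : ℕ} {s : Mat × ℕ} (h : IsAdj n s.1) : (subproblem n s).enc = Enc.enc s := by
  rw [Subproblem.enc, subproblem, finGraph_enc h]
  rfl

/-- A test that is passed by some candidate, and only by candidates with good drops, yields an algorithm. -/
theorem available_of_test {acc : Mat → (Mat × ℕ) × (Mat × ℕ) → Bool}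
    (hacc : PT fun x : Mat × (Mat × ℕ) × (Mat × ℕ) => acc x.1 x.2) {D : FinGraph → Prop}
    {Bs : FinGraph → Set BranchSeq}
    (complete : ∀ G M, D G → IsAdj G.n M → gr G.n M = G.graph → ∃ c₁ k₁ c₂ k₂, Win G.graph c₁ k₁ c₂ k₂ ∧
      ∀ x, hasDrops c₁ k₁ c₂ k₂ M x = true → acc M x = true)
    (sound : ∀ G M, D G → IsAdj G.n M → gr G.n M = G.graph → ∀ x, acc M x = true → ∃ c₁ k₁ c₂ k₂,
      hasDrops c₁ k₁ c₂ k₂ M x = true ∧ ∃ B ∈ Bs G, Dominates (pairSeq c₁ k₁ c₂ k₂) B) :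
    Available D Bs := by
  obtain ⟨p, P, hP⟩ := PT.search hacc
  refine ⟨p, P, fun G hG => ?_⟩
  obtain ⟨M, hM, hgr⟩ := G.exists_mat
  obtain ⟨t, ht, htP⟩ := hP M
  obtain ⟨c₁, k₁, c₂, k₂, hw, hq⟩ := complete G M hG hM hgr
  rw [← hgr] at hw
  obtain ⟨x, hx, hxd⟩ := hw.exists_candidate hM
  obtain ⟨y, l, hl⟩ : ∃ y l, (candidates M).filter (fun x => acc M x) = y :: l :=
    List.exists_cons_of_ne_nil (List.ne_nil_of_mem (List.mem_filter.2 ⟨hx, hq x hxd⟩))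
  have hy : y ∈ (candidates M).filter (fun x => acc M x) := by rw [hl]; exact List.mem_cons_self
  rw [List.mem_filter] at hy
  have hs : search acc M = [y.1, y.2] := by rw [search, hl]; rfl
  obtain ⟨h1, h2, h3⟩ := candidates_sound hM hy.1
  obtain ⟨d₁, l₁, d₂, l₂, hd, B, hB, hdom⟩ := sound G M hG hM hgr y hy.2
  rw [hasDrops_iff] at hd
  have henc : G.enc = Enc.enc M := by rw [← finGraph_enc hM, hgr]
  have henc' : encSubproblems [subproblem G.n y.1, subproblem G.n y.2] = Enc.enc (search acc M) := by
    rw [hs, encSubproblems, List.map_cons, List.map_cons, List.map_nil, subproblem_enc h1, subproblem_enc h2]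
    rfl
  refine ⟨[subproblem G.n y.1, subproblem G.n y.2], t, ?_, ?_, ?_, pairSeq d₁ l₁ d₂ l₂, ?_, B, hB, hdom⟩
  · rw [henc, henc']
    exact ht
  · rw [henc]
    exact htP
  · intro k
    rw [← hgr, h3]
    simp [subproblem]
  · exact List.Forall₂.cons (hasDrop_of_le hM hgr h1 hd.1.1 hd.1.2)
      (List.Forall₂.cons (hasDrop_of_le hM hgr h2 hd.2.1 hd.2.2) List.Forall₂.nil)

theorem Simplified.nice_and_dg {G : FinGraph} {r : ℕ} (hr : 0 < r) (h : Simplified G.graph ∧ r ≤ G.maxDeg) :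
    Nice G.graph ∧ ∃ u, dg G.graph u = G.maxDeg ∧ r ≤ dg G.graph u := by
  obtain ⟨u, hu⟩ := G.exists_dg_eq (hr.trans_le h.2)
  exact ⟨h.1.nice, u, hu, hu ▸ h.2⟩

/-- The test for the drops that are available at some vertices of degree at least five. -/
def testT (M : Mat) (x : (Mat × ℕ) × (Mat × ℕ)) : Bool :=
  hasDrops 2 3 2 5 M x || hasDrops 2 4 2 4 M x || hasDrops 2 5 2 3 M x || hasDrops 1 2 4 5 M x ||
    hasDrops 2 2 3 5 M x

theorem TWin.complete {V : Type} [Fintype V] [DecidableEq V] {G : SimpleGraph V} (h : TWin G) (M : Mat) :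
    ∃ c₁ k₁ c₂ k₂, Win G c₁ k₁ c₂ k₂ ∧ ∀ x, hasDrops c₁ k₁ c₂ k₂ M x = true → testT M x = true := by
  rcases h with h | h | h | h | h <;> exact ⟨_, _, _, _, h, fun x hx => by simp [testT, hx]⟩

theorem testT_sound {M : Mat} {x : (Mat × ℕ) × (Mat × ℕ)} {l : ℕ} (hl : l ≤ 2) (h : testT M x = true)
    (hd : Dominates (pairSeq 2 2 3 5) (pairSeq 1 l 4 5)) : ∃ c₁ k₁ c₂ k₂, hasDrops c₁ k₁ c₂ k₂ M x = true ∧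
      (Dominates (pairSeq c₁ k₁ c₂ k₂) (pairSeq 2 3 2 5) ∨ Dominates (pairSeq c₁ k₁ c₂ k₂) (pairSeq 1 l 4 5)) := by
  simp only [testT, Bool.or_eq_true] at h
  rcases h with (((h | h) | h) | h) | h
  · exact ⟨_, _, _, _, h, Or.inl (dominates_mono le_rfl le_rfl le_rfl le_rfl)⟩
  · exact ⟨_, _, _, _, h, Or.inl dominates_balanced⟩
  · exact ⟨_, _, _, _, h, Or.inl dominates_swap⟩
  · exact ⟨_, _, _, _, h, Or.inr (dominates_mono le_rfl hl le_rfl le_rfl)⟩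
  · exact ⟨_, _, _, _, h, Or.inr hd⟩

theorem pairSeq_two_three : pairSeq 2 3 2 5 = [(1, 3), (1, 5)] := by norm_num [pairSeq]

/-- The second listed branch-seq is always reached: the alternative (1, 2), (1, 4) dominates (1/2,
1), (3/2, 4) by `dominates_of_two_two`. -/
theorem available_of_four_le : Available (fun G => Simplified G.graph ∧ 4 ≤ G.maxDeg)
    (fun _ => {[(1, 3), (1, 5)], [(0.5, 1), (1.5, 4)]}) := by
  have e : pairSeq 1 1 3 4 = [(0.5, 1), (1.5, 4)] := by norm_num [pairSeq]
  rw [← pairSeq_two_three, ← e]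
  refine available_of_test (acc := fun M x => hasDrops 1 1 3 4 M x || hasDrops 2 2 2 4 M x) (by fun_prop) ?_ ?_
  · intro G M hG _ _
    obtain ⟨hn, u, -, hu⟩ := Simplified.nice_and_dg (by norm_num) hG
    rcases hn.win_of_four_le hu with h | h <;> exact ⟨_, _, _, _, h, fun x hx => by simp [hx]⟩
  · intro G M _ _ _ x hx
    rw [Bool.or_eq_true] at hx
    rcases hx with h | h
    · exact ⟨_, _, _, _, h, _, Or.inr rfl, dominates_mono le_rfl le_rfl le_rfl le_rfl⟩
    · exact ⟨_, _, _, _, h, _, Or.inr rfl, dominates_of_two_two⟩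

theorem available_of_five_le : Available (fun G => Simplified G.graph ∧ 5 ≤ G.maxDeg)
    (fun _ => {[(1, 3), (1, 5)], [(0.5, 1), (2, 5)]}) := by
  have e : pairSeq 1 1 4 5 = [(0.5, 1), (2, 5)] := by norm_num [pairSeq]
  rw [← pairSeq_two_three, ← e]
  refine available_of_test (acc := fun M x => testT M x || hasDrops 1 1 4 5 M x)
    (by unfold testT; fun_prop) ?_ ?_
  · intro G M hG _ _
    obtain ⟨hn, u, -, hu⟩ := Simplified.nice_and_dg (by norm_num) hG
    rcases hn.win_of_five_le hu with h | h
    · obtain ⟨c₁, k₁, c₂, k₂, h1, h2⟩ := h.complete M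
      exact ⟨c₁, k₁, c₂, k₂, h1, fun x hx => by simp [h2 x hx]⟩
    · exact ⟨_, _, _, _, h, fun x hx => by simp [hx]⟩
  · intro G M _ _ _ x hx
    rw [Bool.or_eq_true] at hx
    rcases hx with h | h
    · obtain ⟨c₁, k₁, c₂, k₂, h1, h2 | h2⟩ := testT_sound (by norm_num) h dominates_first
      · exact ⟨c₁, k₁, c₂, k₂, h1, _, Or.inl rfl, h2⟩
      · exact ⟨c₁, k₁, c₂, k₂, h1, _, Or.inr rfl, h2⟩
    · exact ⟨_, _, _, _, h, _, Or.inr rfl, dominates_mono le_rfl le_rfl le_rfl le_rfl⟩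

theorem available_of_six_le : Available (fun G => Simplified G.graph ∧ 6 ≤ G.maxDeg)
    (fun G => {[(1, 3), (1, 5)], [(0.5, 2), (2, 5)], [(0.5, 1), (2.5, (G.maxDeg : ℝ))]}) := by
  have e : pairSeq 1 2 4 5 = [(0.5, 2), (2, 5)] := by norm_num [pairSeq]
  have e' : ∀ r : ℕ, pairSeq 1 1 5 r = [(0.5, 1), (2.5, (r : ℝ))] := fun r => by norm_num [pairSeq]
  simp only [← pairSeq_two_three, ← e, ← e']
  -- The required k-drop r depends on the graph, so the test compares the k-drop of the second
  -- branch with the degrees of all vertices instead of a constant.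
  refine available_of_test (acc := fun M x => testT M x || hasDrops 1 1 5 0 M x &&
    (List.range M.length).all fun v => Nat.ble (nb M [v]).length x.2.2) (by unfold testT; fun_prop) ?_ ?_
  · intro G M hG hM hgr
    obtain ⟨hn, u, hum, hu⟩ := Simplified.nice_and_dg (by norm_num) hG
    rcases hn.win_of_six_le hu with h | h
    · obtain ⟨c₁, k₁, c₂, k₂, h1, h2⟩ := h.complete M
      exact ⟨c₁, k₁, c₂, k₂, h1, fun x hx => by simp [h2 x hx]⟩
    · refine ⟨_, _, _, _, h, fun x hx => ?_⟩
      rw [hasDrops_iff] at hx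
      simp only [Bool.or_eq_true, Bool.and_eq_true, hasDrops_iff, List.all_eq_true, List.mem_range, hM.length,
        Nat.ble_eq]
      refine Or.inr ⟨⟨hx.1, hx.2.1, Nat.zero_le _⟩, fun v hv => ?_⟩
      rw [nb_length hM, toF_one ⟨v, hv⟩, hgr]
      exact (G.dg_le_maxDeg ⟨v, hv⟩).trans (hum ▸ hx.2.2)
  · intro G M _ hM hgr x hx
    rw [Bool.or_eq_true] at hx
    rcases hx with h | h
    · obtain ⟨c₁, k₁, c₂, k₂, h1, h2 | h2⟩ := testT_sound le_rfl h dominates_second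
      · exact ⟨c₁, k₁, c₂, k₂, h1, _, Or.inl rfl, h2⟩
      · exact ⟨c₁, k₁, c₂, k₂, h1, _, Or.inr (Or.inl rfl), h2⟩
    · refine ⟨1, 1, 5, G.maxDeg, ?_, _, Or.inr (Or.inr rfl), dominates_mono le_rfl le_rfl le_rfl le_rfl⟩
      simp only [Bool.and_eq_true, hasDrops_iff, List.all_eq_true, List.mem_range, hM.length, Nat.ble_eq] at h
      refine hasDrops_iff.2 ⟨h.1.1, h.1.2.1, G.maxDeg_le fun v => ?_⟩
      rw [← hgr, dg, ← toF_one, ← nb_length hM]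
      exact h.2 v v.2

theorem mainTheorem2 :
    Available (fun G => Simplified G.graph ∧ 4 ≤ G.maxDeg)
      (fun _ => {[(1, 3), (1, 5)], [(0.5, 1), (1.5, 4)]}) ∧
    Available (fun G => Simplified G.graph ∧ 5 ≤ G.maxDeg)
      (fun _ => {[(1, 3), (1, 5)], [(0.5, 1), (2, 5)]}) ∧
    Available (fun G => Simplified G.graph ∧ 6 ≤ G.maxDeg)
      (fun G => {[(1, 3), (1, 5)], [(0.5, 2), (2, 5)], [(0.5, 1), (2.5, (G.maxDeg : ℝ))]}) :=
  ⟨available_of_four_le, available_of_five_le, available_of_six_le⟩
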